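/- **Model.** Let $V=\{1,\dots,n\}$, $n\ge 3$, and let $d\ge 1$ be an integer, $\lambda>0$. For every pair $\{u,v\}$ of distinct nodes there are two links, $uv$ and $vu$, each of capacity $D=D(n)$. Calls arrive in a Poisson process of rate $\lambda\binom n2$; the $j$-th call is for a uniformly random pair $\{u,v\}$ of distinct nodes, and comes with $d$ candidate nodes $w_1,\dots,w_d$ chosen independently and uniformly, with replacement, from $V\setminus\{u,v\}$. A call for $\{u,v\}$ that is routed via $w$ occupies one unit of each of the links $uw$ and $vw$ throughout its duration, which is exponential with mean $1$. At time $0$ there is an arbitrary, possibly random, configuration $X_0$ of calls in progress (a number $X_0(e,w)\ge 0$ of calls for each pair $e$ and each node $w\notin e$), with total number $\|X_0\|$ of finite mean; the remaining durations of these calls are also exponential with mean $1$. The initial configuration, the arrival process, the calls with their candidates, and all durations are independent. A candidate $w_i$ is available if just before the arrival both links $uw_i$ and $vw_i$ have load less than $D$. A general dynamic alternative routing algorithm (GDAR) routes each arriving call via one of its available candidates, selected in any way, if there is one; otherwise the call is lost. The first-fit algorithm FDAR is the version that always selects the first available candidate. **Theorem.** Let $\lambda>0$ and an integer $d\ge1$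 be fixed. There is a constant $\kappa=\kappa(\lambda,d)$ such that the following holds. Let $K>0$ and $\alpha>0$ be constants, let $D=D(n)\sim\alpha\,\frac{\ln n}{\ln\ln n}$ as $n\to\infty$, let $t_1=t_1(n)\ge \ln(\mathbf E\|X_0\|+1)+\kappa\ln n$, and consider the time interval $[t_1,t_1+n^K]$. (a) Suppose that $\alpha>(K+2)/d$ if $K<d-2$, and $\alpha>K+3-d$ if $K\ge d-2$. Then, whatever version of GDAR is used, the mean number of calls lost during the interval is $o(1)$ as $n\to\infty$. (b) Suppose that $\alpha<(K+2)/d$ and $0<\epsilon<K+2-d\alpha$ if $K<d-2$; and that $\alpha<K+3-d$ and $0<\epsilon<K+3-d-\alpha$ if $K\ge d-2$. Then, if FDAR is used, the mean number of calls lost during the interval is $\Omega(n^\epsilon)$. -/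

import Mathlib

open MeasureTheory ProbabilityTheory Filter Asymptotics
open scoped ENNReal

noncomputable section

namespace Routing

/-- A route in the network on the node set `Fin n`: a pair `(e, w)` where `e = {u, v}` is an
unordered pair of distinct nodes and `w ∉ e` is an intermediate node.  The route uses the two links
`uw` and `vw`. -/
def Route (n : ℕ) : Type :=
  {p : Sym2 (Fin n) × Fin n // ¬ p.1.IsDiag ∧ p.2 ∉ p.1}

instance (n : ℕ) : Fintype (Route n) :=
  inferInstanceAs (Fintype {p : Sym2 (Fin n) × Fin n // ¬ p.1.IsDiag ∧ p.2 ∉ p.1})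

instance (n : ℕ) : DecidableEq (Route n) :=
  inferInstanceAs (DecidableEq {p : Sym2 (Fin n) × Fin n // ¬ p.1.IsDiag ∧ p.2 ∉ p.1})

/-- The pair of end nodes of a route. -/
def Route.ends {n : ℕ} (r : Route n) : Sym2 (Fin n) := r.1.1

/-- The intermediate node of a route. -/
def Route.via {n : ℕ} (r : Route n) : Fin n := r.1.2

/-- A call together with its candidate intermediate nodes: an unordered pair `e` of distinct nodes
and a `d`-tuple of nodes outside `e` (repetitions allowed). -/
def Call (n d : ℕ) : Type :=
  {p : Sym2 (Fin n) × (Fin d → Fin n) // ¬ p.1.IsDiag ∧ ∀ m, p.2 m ∉ p.1}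

instance (n d : ℕ) : Fintype (Call n d) :=
  inferInstanceAs
    (Fintype {p : Sym2 (Fin n) × (Fin d → Fin n) // ¬ p.1.IsDiag ∧ ∀ m, p.2 m ∉ p.1})

instance (n d : ℕ) : MeasurableSpace (Call n d) := ⊤

/-- The `m`-th candidate route of a call. -/
def Call.route {n d : ℕ} (c : Call n d) (m : Fin d) : Route n :=
  ⟨(c.1.1, c.1.2 m), c.2.1, c.2.2 m⟩

/-- A load vector gives the number of calls in progress on each route. -/
abbrev LoadVector (n : ℕ) : Type := Route n → ℕ

/-- The total number of calls in progress. -/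
def LoadVector.total {n : ℕ} (x : LoadVector n) : ℕ := ∑ r, x r

/-- The load of the link `vw`: the number of calls in progress with one end `v` that are routed via
the intermediate node `w`.  The links `vw` and `wv` are different. -/
def LoadVector.link {n : ℕ} (x : LoadVector n) (v w : Fin n) : ℕ :=
  ∑ r : Route n, if v ∈ r.ends ∧ r.via = w then x r else 0

/-- The route `r` is available if both of its links have spare capacity. -/
def LoadVector.Available {n : ℕ} (x : LoadVector n) (cap : ℕ) (r : Route n) : Prop :=
  ∀ v ∈ r.ends, x.link v r.via < cap

/-- The random input of the network on `n` nodes with `d` candidate routes per call and arrival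
rate `lam` for each pair of nodes.

* `init` is the initial load vector, of arbitrary law; the `k`-th of the `init r` calls that are
  initially on the route `r` has the remaining duration `residual (r, k)` (the variables
  `residual (r, k)` with `k ≥ init r` are not used);
* calls arrive in a Poisson process of rate `lam * n.choose 2`, with interarrival times `gap j`;
* `call j` is the `j`-th call with its candidates: the end nodes are uniform over the pairs of
  distinct nodes and, given these, the candidates are independent and uniform over the other nodes,
  which is to say that `call j` is uniform over `Call n d`;
* `dur j` is the duration of the `j`-th call;
* durations and remaining durations are exponential with mean one;
* all these random objects are independent. -/
structure Input {Ω : Type*} [MeasurableSpace Ω] (μ : Measure Ω) (lam : ℝ) (n d : ℕ) where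
  init : Ω → LoadVector n
  residual : Route n × ℕ → Ω → ℝ
  gap : ℕ → Ω → ℝ
  call : ℕ → Ω → Call n d
  dur : ℕ → Ω → ℝ
  measurable_init : Measurable init
  measurable_residual : ∀ p, Measurable (residual p)
  measurable_gap : ∀ j, Measurable (gap j)
  measurable_call : ∀ j, Measurable (call j)
  measurable_dur : ∀ j, Measurable (dur j)
  law_residual : ∀ p, μ.map (residual p) = expMeasure 1
  law_gap : ∀ j, μ.map (gap j) = expMeasure (lam * (n.choose 2 : ℝ))
  law_call : ∀ j c, μ {ω | call j ω = c} = (Fintype.card (Call n d) : ℝ≥0∞)⁻¹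
  law_dur : ∀ j, μ.map (dur j) = expMeasure 1
  iIndep_residual : iIndepFun residual μ
  iIndep_gap : iIndepFun gap μ
  iIndep_call : iIndepFun call μ
  iIndep_dur : iIndepFun dur μ
  /-- The five blocks `init`, `residual`, `gap`, `call` and `dur` are mutually independent. -/
  indep_init : IndepFun init
    (fun ω => (fun p => residual p ω, fun j => gap j ω, fun j => call j ω, fun j => dur j ω)) μ
  indep_residual : IndepFun (fun ω p => residual p ω)
    (fun ω => (fun j => gap j ω, fun j => call j ω, fun j => dur j ω)) μ
  indep_gap : IndepFun (fun ω j => gap j ω) (fun ω => (fun j => call j ω, fun j => dur j ω)) μ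
  indep_call : IndepFun (fun ω j => call j ω) (fun ω j => dur j ω) μ

namespace Input

variable {Ω : Type*} [MeasurableSpace Ω] {μ : Measure Ω} {lam : ℝ} {n d : ℕ}

/-- The arrival time of the `j`-th call, `j = 0, 1, 2, …`. -/
def arrival (S : Input μ lam n d) (j : ℕ) (ω : Ω) : ℝ := ∑ i ∈ Finset.range (j + 1), S.gap i ω

/-- The mean total number of calls at time `0`. -/
def meanInit (S : Input μ lam n d) : ℝ := ∫ ω, ((S.init ω).total : ℝ) ∂μ

/-- The load vector just before the arrival of the `j`-th call, when the earlier calls are routed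
according to `choice`: here `choice i ω = some m` means that the `i`-th call is routed on its
`m`-th candidate route, and `choice i ω = none` that it is lost.  It counts the initial calls and
the earlier calls that are still in progress. -/
def loadBefore (S : Input μ lam n d) (choice : ℕ → Ω → Option (Fin d)) (j : ℕ) (ω : Ω) :
    LoadVector n := fun r =>
  ((Finset.range (S.init ω r)).filter fun k => S.arrival j ω ≤ S.residual (r, k) ω).card +
  ((Finset.range j).filter fun i => S.arrival j ω ≤ S.arrival i ω + S.dur i ω ∧
    (choice i ω).map (S.call i ω).route = some r).card

/-- The routing decisions `choice` are those of a general dynamic alternative routing algorithm on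
links of capacity `cap`: each call in turn is routed on one of its candidate routes that are
available when it arrives, if there is one, and is lost otherwise.  How an available candidate is
selected is left completely open: it may depend on the history and on additional randomness. -/
structure IsGDAR (S : Input μ lam n d) (cap : ℕ) (choice : ℕ → Ω → Option (Fin d)) : Prop where
  measurable_choice : ∀ j c, MeasurableSet {ω | choice j ω = c}
  available : ∀ᵐ ω ∂μ, ∀ j m, choice j ω = some m →
    (S.loadBefore choice j ω).Available cap ((S.call j ω).route m)
  lost : ∀ᵐ ω ∂μ, ∀ j, choice j ω = none →
    ∀ m, ¬ (S.loadBefore choice j ω).Available cap ((S.call j ω).route m)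

/-- The first-fit dynamic alternative routing algorithm: the version that always takes the first
available candidate route, if there is one. -/
structure IsFDAR (S : Input μ lam n d) (cap : ℕ) (choice : ℕ → Ω → Option (Fin d)) : Prop
    extends S.IsGDAR cap choice where
  first : ∀ᵐ ω ∂μ, ∀ j m, choice j ω = some m →
    ∀ m' < m, ¬ (S.loadBefore choice j ω).Available cap ((S.call j ω).route m')

/-- The mean number of calls that arrive in the time interval `[s, t]` and are lost. -/
def meanLost (S : Input μ lam n d) (choice : ℕ → Ω → Option (Fin d)) (s t : ℝ) : ℝ≥0∞ :=
  ∫⁻ ω, (({j : ℕ | S.arrival j ω ∈ Set.Icc s t ∧ choice j ω = none}.encard : ℕ∞) : ℝ≥0∞) ∂μ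

end Input

end Routing

end

/-!
Both parts count patterns of calls with Campbell's formula. The arrival times, calls and durations
are the points `S.point i` of a marked Poisson process, and the mean number of families of distinct
points that have given properties is an integral with respect to a power of its intensity
(`lintegral_tsum_embedding`). If one of the points is distinguished and the others are related to
it only, the integral is a product (`Input.lintegral_encard_patternSet`). This needs no information
on the joint law of the loads, which depend on each other and on the algorithm in a complicated way.

**Upper bound.** Once the initial calls have ended, a call for `{u, v}` can be lost only if each
candidate `w` has `D` calls in progress that are routed via `w` and have the end `u` or `v`. These
calls are different for different `w`, and they can be listed in `(D!) ^ k` ways if the call has `k`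
distinct candidates. All calls in progress that have such an end and the candidate `w`, accepted or
not, come at a bounded rate `m`, so the lost calls with `k` distinct candidates make up a fraction
of at most `q ^ k` of all such calls, where `q = m ^ D / D! = n ^ (-α + o(1))`. A call has `k`
distinct candidates with probability of order `n ^ (k - d)`, so that the mean number of lost calls
is at most of order `n ^ (K + 2) * q * (q + d / n) ^ (d - 1)` (`Input.meanLost_le`), which is
governed by `k = d` and `k = 1`. The initial calls are negligible since they last until `t₁` with
probability at most `n ^ (-3)`.

**Lower bound.** Take a call for `{u, v}` with the set `W` of candidates. Suppose that in a short
time `η` before its arrival there come, for each `w ∈ W`, `D` calls for pairs `{u, y}` whose first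
candidate is `w`, with different nodes `y`, and that they last long enough. Suppose also that
nothing else changes on the links `uw` in that time, and that the links `yw` are not filled by other
calls. Then either all these calls are accepted on `w`, because first-fit tries `w` first, or one of
them finds `uw` full; in both cases `uw` is full when the distinguished call comes, which is
therefore lost (`Input.choice_eq_none_of_mem_cleanSaturations`). Such a clean pattern contains all
calls that could take part in a pattern for the same call, so that each lost call belongs to at
most `(D!) ^ k` clean patterns (`Input.sum_encard_cleanSaturations_le`). Patterns that are not clean
extend by one more call, or by at least `D * (D - 1)` ordered pairs of calls, and Campbell's formula
for the extended patterns shows that they are at most a quarter of all patterns for small `η` and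
large `D`, while initial calls, which are independent of the patterns, interfere with probability at
most one half (`Input.card_mul_le_lintegral_lostCalls`). This gives a mean number of lost calls of
order `n ^ (K + 2 + k - d) * q ^ k` with another `q = n ^ (-α + o(1))`, for `k = d` and `k = 1`
(`eventually_le_meanLost`).
-/

namespace Routing

/-! ### The renewal measure of exponential gaps -/

/-- The density of the sum of `i + 1` independent exponential variables of rate `L`. -/
noncomputable def erlang (L : ℝ) (i : ℕ) : ℝ → ℝ≥0∞ :=
  (Set.Ioi (0 : ℝ)).indicator fun x =>
    ENNReal.ofReal (L ^ (i + 1) * x ^ i / (i.factorial : ℝ) * Real.exp (-(L * x)))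

lemma measurable_erlang (L : ℝ) (i : ℕ) : Measurable (erlang L i) := by
  refine Measurable.indicator ?_ measurableSet_Ioi
  fun_prop

lemma expMeasure_eq_erlang (L : ℝ) :
    expMeasure L = (volume : Measure ℝ).withDensity (erlang L 0) := by
  rw [expMeasure, gammaMeasure]
  refine withDensity_congr_ae ?_
  have h : ∀ᵐ x : ℝ, x ≠ 0 := by simp [ae_iff]
  filter_upwards [h] with x hx
  rcases lt_or_gt_of_ne hx with hx | hx
  · rw [gammaPDF_of_neg hx, erlang, Set.indicator_of_notMem (by simp [hx.le])]
  · rw [gammaPDF_of_nonneg hx.le, erlang, Set.indicator_of_mem (by simpa using hx)]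
    simp

/-- Convolution of Erlang densities. -/
lemma lintegral_erlang_mul_erlang {L : ℝ} (hL : 0 < L) (i : ℕ) (c : ℝ) :
    ∫⁻ a, erlang L 0 a * erlang L i (c - a) = erlang L (i + 1) c := by
  have key : ∀ a, erlang L 0 a * erlang L i (c - a) = (Set.Ioo 0 c).indicator (fun a =>
      ENNReal.ofReal (L ^ (i + 2) / (i.factorial : ℝ) * Real.exp (-(L * c)) * (c - a) ^ i)) a := by
    intro a
    simp only [erlang, Set.indicator_apply, Set.mem_Ioi, Set.mem_Ioo, sub_pos]
    by_cases h1 : 0 < a <;> by_cases h2 : a < c <;> simp only [h1, h2, if_true, if_false, and_true,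
      and_false, mul_zero, zero_mul]
    rw [← ENNReal.ofReal_mul (by positivity)]
    congr 1
    rw [show -(L * c) = -(L * a) + -(L * (c - a)) by ring, Real.exp_add]
    simp only [Nat.factorial_zero, Nat.cast_one, pow_zero]
    ring
  simp_rw [key]
  rw [lintegral_indicator measurableSet_Ioo]
  rcases le_or_gt c 0 with hc | hc
  · rw [Set.Ioo_eq_empty (by simpa using hc)]
    simp [erlang, hc]
  rw [← ofReal_integral_eq_lintegral_ofReal]
  · rw [erlang, Set.indicator_of_mem (by simpa using hc)]
    congr 1
    rw [← integral_Ioc_eq_integral_Ioo, ← intervalIntegral.integral_of_le hc.le,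
      intervalIntegral.integral_const_mul,
      intervalIntegral.integral_comp_sub_left (fun x => x ^ i) c]
    simp only [sub_self, sub_zero, integral_pow, Nat.factorial_succ]
    push_cast
    field_simp
    simp
  · have : Continuous fun a : ℝ =>
        L ^ (i + 2) / (i.factorial : ℝ) * Real.exp (-(L * c)) * (c - a) ^ i := by fun_prop
    exact (this.integrableOn_Icc (a := 0) (b := c)).mono_set Set.Ioo_subset_Icc_self
  · refine (ae_restrict_iff' measurableSet_Ioo).2 (ae_of_all _ fun a ha => ?_)
    have : 0 < c - a := sub_pos.2 ha.2
    simp only [Pi.zero_apply]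
    positivity

lemma lintegral_erlang_succ {L : ℝ} (hL : 0 < L) (i : ℕ) {f : ℝ → ℝ≥0∞} (hf : Measurable f) :
    ∫⁻ a, ∫⁻ b, f (a + b) ∂(volume.withDensity (erlang L i)) ∂(expMeasure L) =
      ∫⁻ c, f c ∂(volume.withDensity (erlang L (i + 1))) := by
  have m0 := measurable_erlang L 0
  have mi := measurable_erlang L i
  rw [expMeasure_eq_erlang, lintegral_withDensity_eq_lintegral_mul _ m0]
  swap
  · exact Measurable.lintegral_prod_right' (f := fun p : ℝ × ℝ => f (p.1 + p.2)) (by fun_prop)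
  rw [lintegral_withDensity_eq_lintegral_mul _ (measurable_erlang L _) hf]
  calc _ = ∫⁻ a, ∫⁻ c, erlang L 0 a * erlang L i (c - a) * f c := by
        refine lintegral_congr fun a => ?_
        simp only [Pi.mul_apply]
        rw [lintegral_withDensity_eq_lintegral_mul _ mi (by fun_prop),
          ← lintegral_const_mul _ (by fun_prop),
          ← lintegral_add_left_eq_self (μ := volume)
            (fun c => erlang L 0 a * erlang L i (c - a) * f c) a]
        simp [mul_assoc]
    _ = ∫⁻ c, ∫⁻ a, erlang L 0 a * erlang L i (c - a) * f c := by
        rw [lintegral_lintegral_swap]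
        exact Measurable.aemeasurable (by fun_prop)
    _ = _ := by
        refine lintegral_congr fun c => ?_
        rw [lintegral_mul_const _ (by fun_prop), lintegral_erlang_mul_erlang hL]
        rfl

/-- The arrival times of a Poisson process of rate `L` have the total density `L`. -/
lemma tsum_erlang {L : ℝ} (hL : 0 < L) (x : ℝ) :
    ∑' i, erlang L i x = (Set.Ioi (0 : ℝ)).indicator (fun _ => ENNReal.ofReal L) x := by
  by_cases hx : 0 < x
  · simp only [erlang, Set.indicator_of_mem (show x ∈ Set.Ioi 0 from hx)]
    have h := (NormedSpace.expSeries_div_hasSum_exp (L * x)).mul_left (L * Real.exp (-(L * x)))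
    rw [← ENNReal.ofReal_tsum_of_nonneg]
    · congr 1
      rw [show (fun i : ℕ => L ^ (i + 1) * x ^ i / (i.factorial : ℝ) * Real.exp (-(L * x))) =
        fun i : ℕ => L * Real.exp (-(L * x)) * ((L * x) ^ i / (i.factorial : ℝ)) by
          ext i; rw [mul_pow]; ring, h.tsum_eq, ← Real.exp_eq_exp_ℝ, mul_assoc, ← Real.exp_add]
      simp
    · intro i; positivity
    · refine h.summable.congr fun i => ?_
      rw [mul_pow]; ring
  · simp [erlang, hx]

lemma tsum_lintegral_erlang {L : ℝ} (hL : 0 < L) {f : ℝ → ℝ≥0∞} (hf : Measurable f) :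
    ∑' i, ∫⁻ x, f x ∂(volume.withDensity (erlang L i)) =
      ∫⁻ x, f x ∂(ENNReal.ofReal L • volume.restrict (Set.Ioi (0 : ℝ))) := by
  simp_rw [lintegral_withDensity_eq_lintegral_mul _ (measurable_erlang L _) hf, Pi.mul_apply]
  rw [← lintegral_tsum (f := fun i x => erlang L i x * f x)
    fun i => ((measurable_erlang L i).mul hf).aemeasurable]
  simp_rw [ENNReal.tsum_mul_right, tsum_erlang hL]
  rw [lintegral_smul_measure, smul_eq_mul, ← lintegral_const_mul _ hf,
    ← lintegral_indicator measurableSet_Ioi]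
  refine lintegral_congr fun x => ?_
  simp only [Set.indicator_apply]
  split_ifs <;> simp

/-! ### Campbell's formula for a marked Poisson process -/

section Campbell

variable {M : Type*} [MeasurableSpace M]

instance (L : ℝ) [h : Fact (0 < L)] : IsProbabilityMeasure (expMeasure L) :=
  isProbabilityMeasure_expMeasure h.out

/-- The `i`-th point of the marked renewal process with the gaps and marks `z`. -/
noncomputable def markedPoint {M : Type*} (z : ℕ → ℝ × M) (i : ℕ) : ℝ × M :=
  (∑ k ∈ Finset.range (i + 1), (z k).1, (z i).2)

/-- The intensity of a marked Poisson process of rate `L` on the half-line. -/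
noncomputable def intensity (L : ℝ) (ν : Measure M) : Measure (ℝ × M) :=
  (ENNReal.ofReal L • volume.restrict (Set.Ioi (0 : ℝ))).prod ν

/-- The law of a sequence of independent marked gaps. -/
noncomputable def gapLaw (L : ℝ) [Fact (0 < L)] (ν : Measure M) [IsProbabilityMeasure ν] :
    Measure (ℕ → ℝ × M) :=
  Measure.infinitePi fun _ => (expMeasure L).prod ν

variable {L : ℝ} [hL : Fact (0 < L)] {ν : Measure M} [IsProbabilityMeasure ν]

instance : IsProbabilityMeasure (gapLaw L ν) := by unfold gapLaw; infer_instance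

instance : SigmaFinite (intensity L ν) := by
  have : SigmaFinite (ENNReal.ofReal L • (volume : Measure ℝ).restrict (Set.Ioi (0 : ℝ))) := by
    rw [← withDensity_const]
    exact SigmaFinite.withDensity fun _ => Real.toNNReal L
  unfold intensity
  infer_instance

@[fun_prop]
lemma measurable_markedPoint (i : ℕ) : Measurable fun z : ℕ → ℝ × M => markedPoint z i := by
  unfold markedPoint
  fun_prop

lemma markedPoint_add {M : Type*} (z : ℕ → ℝ × M) (i k : ℕ) :
    markedPoint z (i + 1 + k) =
      ((markedPoint z i).1 + (markedPoint (fun l => z (i + 1 + l)) k).1,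
        (markedPoint (fun l => z (i + 1 + l)) k).2) := by
  simp only [markedPoint, Prod.mk.injEq, and_true]
  rw [add_assoc (i + 1), Finset.sum_range_add]

lemma map_cons_infinitePi {X : Type*} [MeasurableSpace X] (Q : Measure X)
    [IsProbabilityMeasure Q] :
    (Q.prod (Measure.infinitePi fun _ : ℕ => Q)).map
      (fun p i => Nat.casesOn (motive := fun _ => X) i p.1 p.2) =
      Measure.infinitePi fun _ : ℕ => Q := by
  have hm : Measurable (fun (p : X × (ℕ → X)) (i : ℕ) =>
      Nat.casesOn (motive := fun _ => X) i p.1 p.2) := by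
    refine measurable_pi_iff.2 fun i => ?_
    cases i <;> fun_prop
  refine Measure.eq_infinitePi _ fun s t ht => ?_
  classical
  rw [Measure.map_apply hm (MeasurableSet.pi s.countable_toSet fun i _ => ht i)]
  have : (fun (p : X × (ℕ → X)) (i : ℕ) => Nat.casesOn (motive := fun _ => X) i p.1 p.2) ⁻¹'
      (Set.pi s t) = (if 0 ∈ s then t 0 else Set.univ) ×ˢ
        (Set.pi (s.preimage Nat.succ (Nat.succ_injective.injOn)) fun i => t (i + 1)) := by
    ext ⟨x, z⟩
    simp only [Set.mem_preimage, Set.mem_pi, Finset.mem_coe, Set.mem_prod, Finset.mem_preimage]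
    constructor
    · intro h
      refine ⟨?_, fun i hi => h (i + 1) hi⟩
      split_ifs with h0
      · exact h 0 h0
      · trivial
    · rintro ⟨h0, h1⟩ i hi
      cases i with
      | zero => simpa [hi] using h0
      | succ i => exact h1 i hi
  rw [this, Measure.prod_prod, Measure.infinitePi_pi _ fun i _ => ht (i + 1)]
  by_cases h0 : 0 ∈ s
  · have hs : s = insert 0 ((s.preimage Nat.succ (Nat.succ_injective.injOn)).image Nat.succ) := by
      ext i
      cases i <;> simp [h0]
    conv_rhs => rw [hs]
    rw [Finset.prod_insert (by simp), Finset.prod_image (by simp), if_pos h0]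
  · have hs : s = (s.preimage Nat.succ (Nat.succ_injective.injOn)).image Nat.succ := by
      ext i
      cases i <;> simp [h0]
    conv_rhs => rw [hs]
    rw [Finset.prod_image (by simp), if_neg h0]
    simp

/-- The first gap and mark are independent of the later ones. -/
lemma lintegral_gapLaw_cons {G : ℝ × M → (ℕ → ℝ × M) → ℝ≥0∞}
    (hG : Measurable (Function.uncurry G)) :
    ∫⁻ z, G (z 0) (fun k => z (k + 1)) ∂(gapLaw L ν) =
      ∫⁻ t, ∫⁻ m, ∫⁻ z, G (t, m) z ∂(gapLaw L ν) ∂ν ∂(expMeasure L) := by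
  have hm : Measurable (fun (p : (ℝ × M) × (ℕ → ℝ × M)) (i : ℕ) =>
      Nat.casesOn (motive := fun _ => ℝ × M) i p.1 p.2) := by
    refine measurable_pi_iff.2 fun i => ?_
    cases i <;> fun_prop
  conv_lhs => rw [gapLaw, ← map_cons_infinitePi]
  rw [lintegral_map (by fun_prop) hm]
  rw [lintegral_prod _ (by fun_prop), lintegral_prod _ (by
    refine Measurable.aemeasurable ?_
    exact Measurable.lintegral_prod_right' (f := fun p : (ℝ × M) × (ℕ → ℝ × M) => G p.1 p.2) hG)]
  rfl

/-- The `i`-th point of the process is independent of the later gaps and marks. -/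
lemma lintegral_gapLaw_markedPoint (i : ℕ) {G : ℝ × M → (ℕ → ℝ × M) → ℝ≥0∞}
    (hG : Measurable (Function.uncurry G)) :
    ∫⁻ z, G (markedPoint z i) (fun k => z (i + 1 + k)) ∂(gapLaw L ν) =
      ∫⁻ t, ∫⁻ m, ∫⁻ z, G (t, m) z ∂(gapLaw L ν) ∂ν ∂(volume.withDensity (erlang L i)) := by
  induction i generalizing G with
  | zero =>
    rw [← expMeasure_eq_erlang, ← lintegral_gapLaw_cons hG]
    simp [markedPoint, add_comm]
  | succ i ih =>
    have hG' : Measurable fun t : ℝ => ∫⁻ m, ∫⁻ z, G (t, m) z ∂(gapLaw L ν) ∂ν := by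
      refine Measurable.lintegral_prod_right' (f := fun q : ℝ × M => ∫⁻ z, G q z ∂(gapLaw L ν)) ?_
      exact Measurable.lintegral_prod_right' (f := fun p : (ℝ × M) × (ℕ → ℝ × M) => G p.1 p.2) hG
    rw [← lintegral_erlang_succ hL.out i hG']
    let H : ℝ × M → (ℕ → ℝ × M) → ℝ≥0∞ := fun x z =>
      G (x.1 + (markedPoint z i).1, (markedPoint z i).2) (fun k => z (i + 1 + k))
    have hH : Measurable (Function.uncurry H) := by
      have : Measurable fun p : (ℝ × M) × (ℕ → ℝ × M) =>
        (((p.1.1 + (markedPoint p.2 i).1, (markedPoint p.2 i).2), fun k => p.2 (i + 1 + k)) :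
          (ℝ × M) × (ℕ → ℝ × M)) := by
        fun_prop
      exact hG.comp this
    have e1 : ∀ z : ℕ → ℝ × M, G (markedPoint z (i + 1)) (fun k => z (i + 1 + 1 + k)) =
        H (z 0) (fun k => z (k + 1)) := by
      intro z
      have h1 := markedPoint_add z 0 i
      rw [show 0 + 1 + i = i + 1 by omega] at h1
      have h2 : (fun k => z (i + 1 + 1 + k)) = fun k => z (i + 1 + k + 1) := by
        funext k
        rw [show i + 1 + 1 + k = i + 1 + k + 1 by omega]
      simp only [H]
      rw [h1, h2]
      simp [markedPoint, add_comm]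
    simp_rw [e1]
    rw [lintegral_gapLaw_cons hH]
    refine lintegral_congr fun a => ?_
    simp only [H]
    have : ∫⁻ z, G (a + (markedPoint z i).1, (markedPoint z i).2)
        (fun k => z (i + 1 + k)) ∂(gapLaw L ν) = ∫⁻ t, ∫⁻ m, ∫⁻ z, G (a + t, m) z ∂(gapLaw L ν) ∂ν
          ∂(volume.withDensity (erlang L i)) := by
      have hm : Measurable fun p : (ℝ × M) × (ℕ → ℝ × M) =>
          ((a + p.1.1, p.1.2), p.2) := by fun_prop
      exact ih (G := fun x z => G (a + x.1, x.2) z) (hG.comp hm)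
    refine (lintegral_congr fun _ => this).trans ?_
    rw [lintegral_const, measure_univ, mul_one]

omit hL in
lemma map_intensity_shift {s : ℝ} (hs : 0 ≤ s) :
    (intensity L ν).map (fun x => (s + x.1, x.2)) =
      (intensity L ν).restrict (Set.Ioi s ×ˢ Set.univ) := by
  have h1 : (ENNReal.ofReal L • volume.restrict (Set.Ioi (0 : ℝ))).map (fun t => s + t) =
      (ENNReal.ofReal L • volume.restrict (Set.Ioi (0 : ℝ))).restrict (Set.Ioi s) := by
    rw [Measure.map_smul, Measure.restrict_smul, Measure.restrict_restrict measurableSet_Ioi,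
      Set.inter_eq_left.2 (Set.Ioi_subset_Ioi hs)]
    congr 1
    have := (measurePreserving_add_left (volume : Measure ℝ) s).restrict_preimage
      (measurableSet_Ioi (a := s))
    rw [← this.map_eq]
    simp
  have := Measure.map_prod_map (ENNReal.ofReal L • volume.restrict (Set.Ioi (0 : ℝ))) ν
    (f := fun t => s + t) (g := id) (by fun_prop) measurable_id
  rw [intensity, ← Measure.prod_restrict, ← h1]
  rw [Measure.map_id] at this
  rw [Measure.restrict_univ]
  exact this.symm

omit hL in
lemma lintegral_pi_intensity_shift {ι : Type*} [Fintype ι] {s : ℝ} (hs : 0 ≤ s)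
    {g : (ι → ℝ × M) → ℝ≥0∞} (hg : Measurable g) :
    ∫⁻ x, g (fun a => (s + (x a).1, (x a).2)) ∂(Measure.pi fun _ => intensity L ν) =
      ∫⁻ x in {x | ∀ a, s < (x a).1}, g x ∂(Measure.pi fun _ => intensity L ν) := by
  have hs' : {x : ι → ℝ × M | ∀ a, s < (x a).1} = Set.univ.pi fun _ => Set.Ioi s ×ˢ Set.univ := by
    ext x; simp [Set.mem_pi]
  have : SigmaFinite ((intensity L ν).map fun x => (s + x.1, x.2)) := by
    rw [map_intensity_shift hs]
    infer_instance
  rw [hs', Measure.restrict_pi_pi, ← map_intensity_shift hs,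
    ← Measure.pi_map_pi (fun _ => by fun_prop), lintegral_map hg (by fun_prop)]

lemma strictMono_cons_iff {α : Type*} [Preorder α] {p : ℕ} {x : α} {y : Fin p → α} :
    StrictMono (Fin.cons x y : Fin (p + 1) → α) ↔ (∀ a, x < y a) ∧ StrictMono y := by
  constructor
  · intro h
    refine ⟨fun a => by simpa using h (Fin.succ_pos a), fun a b hab => ?_⟩
    simpa using h (Fin.succ_lt_succ_iff.2 hab)
  · rintro ⟨h1, h2⟩ a b hab
    induction b using Fin.cases with
    | zero => simp at hab
    | succ b =>
      induction a using Fin.cases with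
      | zero => simpa using h1 b
      | succ a => simpa using h2 (Fin.succ_lt_succ_iff.1 hab)

end Campbell

section Campbell

variable {M : Type*} [MeasurableSpace M]
variable {L : ℝ} [hL : Fact (0 < L)] {ν : Measure M} [IsProbabilityMeasure ν]

lemma measurableSet_strictMono_fst (p : ℕ) :
    MeasurableSet {x : Fin p → ℝ × M | StrictMono fun a => (x a).1} := by
  have : {x : Fin p → ℝ × M | StrictMono fun a => (x a).1} =
      ⋂ a, ⋂ b, {x | a < b → (x a).1 < (x b).1} := by
    ext x; simp [StrictMono]
  rw [this]
  refine MeasurableSet.iInter fun a => MeasurableSet.iInter fun b => ?_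
  by_cases hab : a < b
  · simp only [hab, true_imp_iff]
    exact measurableSet_lt (by fun_prop) (by fun_prop)
  · simp [hab]

lemma measurable_cons {X : Type*} [MeasurableSpace X] (p : ℕ) :
    Measurable fun q : X × (Fin p → X) => (Fin.cons q.1 q.2 : Fin (p + 1) → X) := by
  refine measurable_pi_iff.2 fun a => ?_
  induction a using Fin.cases <;> simp <;> fun_prop

lemma tsum_strictMono_succ (p : ℕ) (g : (Fin (p + 1) → ℕ) → ℝ≥0∞) :
    ∑' i, {i : Fin (p + 1) → ℕ | StrictMono i}.indicator g i =
      ∑' i₀ : ℕ, ∑' i : Fin p → ℕ, {i : Fin p → ℕ | StrictMono i}.indicator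
        (fun i => g (Fin.cons i₀ fun a => i₀ + 1 + i a)) i := by
  have h : ∀ q : ℕ × (Fin p → ℕ), (Fin.consEquiv fun _ => ℕ) q = Fin.cons q.1 q.2 := fun q => rfl
  rw [← (Fin.consEquiv fun _ => ℕ).tsum_eq]
  simp_rw [h]
  rw [ENNReal.tsum_prod (f := fun (i₀ : ℕ) (i : Fin p → ℕ) =>
    {i : Fin (p + 1) → ℕ | StrictMono i}.indicator g (Fin.cons i₀ i))]
  refine tsum_congr fun i₀ => ?_
  have hinj : Function.Injective fun (i : Fin p → ℕ) (a : Fin p) => i₀ + 1 + i a := by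
    intro i j hij
    funext a
    have := congrFun hij a
    simpa using this
  rw [← hinj.tsum_eq]
  · refine tsum_congr fun i => ?_
    simp only [Set.indicator_apply, Set.mem_ofPred_eq, strictMono_cons_iff]
    have h1 : (∀ a, i₀ < i₀ + 1 + i a) := fun a => by omega
    have h2 : (StrictMono fun a => i₀ + 1 + i a) ↔ StrictMono i := by
      simp [StrictMono]
    simp only [h1, h2, implies_true, true_and]
  · intro i hi
    have : ∀ a, i₀ < i a := by
      have hi' := Set.mem_of_indicator_ne_zero (Function.mem_support.1 hi)
      exact (strictMono_cons_iff.1 hi').1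
    refine ⟨fun a => i a - (i₀ + 1), ?_⟩
    funext a
    have := this a
    simp only
    omega

lemma lintegral_pi_succ {X : Type*} [MeasurableSpace X] (ρ : Measure X) [SigmaFinite ρ] {p : ℕ}
    {f : (Fin (p + 1) → X) → ℝ≥0∞} (hf : Measurable f) :
    ∫⁻ x, f x ∂(Measure.pi fun _ => ρ) =
      ∫⁻ x, ∫⁻ y, f (Fin.cons x y) ∂(Measure.pi fun _ => ρ) ∂ρ := by
  have h := (measurePreserving_piFinSuccAbove (fun _ : Fin (p + 1) => ρ) 0).symm
  rw [← h.lintegral_comp hf, lintegral_prod]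
  · refine lintegral_congr fun x => lintegral_congr fun y => ?_
    congr 1
    exact Fin.insertNth_zero' x y
  · exact (hf.comp h.measurable).aemeasurable

/-- Campbell's formula for increasing tuples of points: the points after the first one form a
shifted copy of the process. -/
lemma lintegral_tsum_strictMono (p : ℕ) {f : (Fin p → ℝ × M) → ℝ≥0∞} (hf : Measurable f) :
    ∫⁻ z, ∑' i, {i : Fin p → ℕ | StrictMono i}.indicator (fun i => f fun a => markedPoint z (i a)) i
        ∂(gapLaw L ν) =
      ∫⁻ x in {x | StrictMono fun a => (x a).1}, f x ∂(Measure.pi fun _ => intensity L ν) := by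
  induction p with
  | zero =>
    have h1 : {x : Fin 0 → ℝ × M | StrictMono fun a => (x a).1} = Set.univ := by
      ext x; simp [Subsingleton.strictMono]
    have h2 : ∀ x y, f x = f y := fun x y => by rw [Subsingleton.elim x y]
    have h3 : {i : Fin 0 → ℕ | StrictMono i} = Set.univ := by
      ext x; simp [Subsingleton.strictMono]
    rw [h1, h3, Measure.restrict_univ, Measure.pi_of_empty, lintegral_dirac]
    simp only [Set.indicator_univ]
    simp_rw [tsum_fintype, Fintype.sum_unique, h2 _ isEmptyElim]
    simp
  | succ p ih =>
    let fx : ℝ × M → (Fin p → ℝ × M) → ℝ≥0∞ := fun x y =>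
      f (Fin.cons x fun a => (x.1 + (y a).1, (y a).2))
    have hfx : Measurable (Function.uncurry fx) :=
      hf.comp ((measurable_cons p).comp
        (f := fun q : (ℝ × M) × (Fin p → ℝ × M) => (q.1, fun a => (q.1.1 + (q.2 a).1, (q.2 a).2)))
        (by fun_prop))
    let G : ℝ × M → (ℕ → ℝ × M) → ℝ≥0∞ := fun x z =>
      ∑' i, {i : Fin p → ℕ | StrictMono i}.indicator (fun i => fx x fun a => markedPoint z (i a)) i
    have hG : Measurable (Function.uncurry G) := by
      refine Measurable.tsum fun i => ?_
      by_cases hi : StrictMono i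
      · simp only [Set.indicator_apply, Set.mem_ofPred_eq, hi, if_true]
        exact hfx.comp (f := fun q : (ℝ × M) × (ℕ → ℝ × M) => (q.1, fun a => markedPoint q.2 (i a)))
          (by fun_prop)
      · simp only [Set.indicator_apply, Set.mem_ofPred_eq, hi, if_false]
        exact measurable_const
    have e1 : ∀ z, ∑' i, {i : Fin (p + 1) → ℕ | StrictMono i}.indicator
        (fun i => f fun a => markedPoint z (i a)) i =
          ∑' i₀ : ℕ, G (markedPoint z i₀) (fun k => z (i₀ + 1 + k)) := by
      intro z
      rw [tsum_strictMono_succ]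
      refine tsum_congr fun i₀ => tsum_congr fun i => ?_
      congr 1
      funext i
      simp only [fx]
      congr 1
      funext a
      induction a using Fin.cases with
      | zero => simp
      | succ a => simp [markedPoint_add]
    simp_rw [e1]
    rw [lintegral_tsum fun i₀ => by
      refine Measurable.aemeasurable ?_
      exact hG.comp (f := fun z : ℕ → ℝ × M => (markedPoint z i₀, fun k => z (i₀ + 1 + k)))
        (by fun_prop)]
    have hG' : Measurable fun x => ∫⁻ z, G x z ∂(gapLaw L ν) :=
      Measurable.lintegral_prod_right' (f := fun p : (ℝ × M) × (ℕ → ℝ × M) => G p.1 p.2) hG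
    simp_rw [lintegral_gapLaw_markedPoint _ hG]
    rw [tsum_lintegral_erlang hL.out (f := fun t => ∫⁻ m, ∫⁻ z, G (t, m) z ∂(gapLaw L ν) ∂ν)
      hG'.lintegral_prod_right', ← lintegral_prod (fun x => ∫⁻ z, G x z ∂(gapLaw L ν))
        hG'.aemeasurable]
    rw [← lintegral_indicator (measurableSet_strictMono_fst _),
      lintegral_pi_succ _ (hf.indicator (measurableSet_strictMono_fst _))]
    have hpos : ∀ᵐ x ∂(intensity L ν), 0 < x.1 := by
      have : (intensity L ν) {x | 0 < x.1}ᶜ = 0 := by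
        have : {x : ℝ × M | 0 < x.1}ᶜ = Set.Iic 0 ×ˢ Set.univ := by
          ext x; simp
        rw [this, intensity, Measure.prod_prod, Measure.smul_apply,
          Measure.restrict_apply measurableSet_Iic]
        have : Set.Iic (0 : ℝ) ∩ Set.Ioi 0 = ∅ := by ext; simp
        simp [this]
      exact this
    refine lintegral_congr_ae ?_
    filter_upwards [hpos] with x hx
    rw [ih (f := fx x) (hfx.of_uncurry_left)]
    rw [← lintegral_indicator (measurableSet_strictMono_fst _)]
    have := lintegral_pi_intensity_shift (L := L) (ν := ν) hx.le
      (g := {y : Fin p → ℝ × M | StrictMono fun a => (y a).1}.indicator fun y => f (Fin.cons x y))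
      (Measurable.indicator (hf.comp ((measurable_cons p).comp measurable_prodMk_left))
        (measurableSet_strictMono_fst _))
    have hms : MeasurableSet {y : Fin p → ℝ × M | ∀ a, x.1 < (y a).1} := by
      rw [Set.ofPred_forall]
      exact MeasurableSet.iInter fun a => measurableSet_lt (by fun_prop) (by fun_prop)
    rw [← lintegral_indicator hms] at this
    convert this using 1
    · refine lintegral_congr fun y => ?_
      simp only [Set.indicator_apply, Set.mem_ofPred_eq, fx]
      have : (StrictMono fun a => x.1 + (y a).1) ↔ StrictMono fun a => (y a).1 := by
        simp [StrictMono]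
      simp only [this]
    · refine lintegral_congr fun y => ?_
      have : (fun a => ((Fin.cons x y : Fin (p + 1) → ℝ × M) a).1) =
          (Fin.cons x.1 (fun a => (y a).1) : Fin (p + 1) → ℝ) := by
        funext a
        induction a using Fin.cases <;> simp
      simp only [Set.indicator_apply, Set.mem_ofPred_eq, this, strictMono_cons_iff]
      by_cases h1 : ∀ a, x.1 < (y a).1 <;> simp [h1]

/-- Exactly one permutation sorts an injective tuple, and none sorts a tuple with a repetition. -/
lemma sum_perm_indicator_strictMono {α : Type*} [LinearOrder α] {p : ℕ} (x : Fin p → α) :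
    ∑ σ : Equiv.Perm (Fin p), {x : Fin p → α | StrictMono x}.indicator (fun _ => (1 : ℝ≥0∞))
      (x ∘ σ) =
      {x : Fin p → α | Function.Injective x}.indicator (fun _ => 1) x := by
  classical
  by_cases hx : Function.Injective x
  · have huniq : ∀ σ : Equiv.Perm (Fin p), StrictMono (x ∘ σ) ↔ σ = Tuple.sort x := by
      intro σ
      rw [Tuple.eq_sort_iff]
      constructor
      · intro h
        exact ⟨h.monotone, fun i j hij h' => absurd (h'.trans rfl) (h hij).ne⟩
      · intro h
        exact h.1.strictMono_of_injective (hx.comp σ.injective)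
    simp only [Set.indicator_apply, Set.mem_ofPred_eq, huniq, hx, if_true]
    simp
  · have : ∀ σ : Equiv.Perm (Fin p), ¬ StrictMono (x ∘ σ) := fun σ h =>
      hx ((Function.Injective.of_comp_iff' x σ.bijective).1 h.injective)
    simp [this, hx]

omit hL in
lemma intensity_fst_eq (t : ℝ) : intensity L ν {x | x.1 = t} = 0 := by
  have : {x : ℝ × M | x.1 = t} = {t} ×ˢ Set.univ := by
    ext x; simp
  rw [this, intensity, Measure.prod_prod, Measure.smul_apply]
  have : (volume.restrict (Set.Ioi (0 : ℝ))) {t} = 0 := measure_singleton t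
  simp [this]

omit hL in
lemma ae_injective_fst (p : ℕ) :
    ∀ᵐ x ∂(Measure.pi fun _ : Fin p => intensity L ν), Function.Injective fun a => (x a).1 := by
  induction p with
  | zero => exact ae_of_all _ fun x => Function.injective_of_subsingleton _
  | succ p ih =>
    have hm : MeasurableSet {x : Fin (p + 1) → ℝ × M | Function.Injective fun a => (x a).1} := by
      have : {x : Fin (p + 1) → ℝ × M | Function.Injective fun a => (x a).1} =
          ⋂ a, ⋂ b, {x | (x a).1 = (x b).1 → a = b} := by
        ext x; simp [Function.Injective]
      rw [this]
      refine MeasurableSet.iInter fun a => MeasurableSet.iInter fun b => ?_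
      by_cases hab : a = b
      · simp [hab]
      · simp only [hab, imp_false]
        exact (measurableSet_eq_fun (by fun_prop) (by fun_prop)).compl
    have h0 : ∫⁻ x, {x : Fin (p + 1) → ℝ × M | Function.Injective fun a => (x a).1}ᶜ.indicator
        (fun _ => (1 : ℝ≥0∞)) x ∂(Measure.pi fun _ => intensity L ν) = 0 := by
      rw [lintegral_pi_succ _ (measurable_const.indicator hm.compl), lintegral_eq_zero_iff']
      swap
      · refine Measurable.aemeasurable ?_
        exact Measurable.lintegral_prod_right' (f := fun q : (ℝ × M) × (Fin p → ℝ × M) =>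
          {x : Fin (p + 1) → ℝ × M | Function.Injective fun a => (x a).1}ᶜ.indicator
            (fun _ => (1 : ℝ≥0∞)) (Fin.cons q.1 q.2))
          ((measurable_const.indicator hm.compl).comp (measurable_cons p))
      refine ae_of_all _ fun x => ?_
      have hne : ∀ᵐ y ∂(Measure.pi fun _ : Fin p => intensity L ν), ∀ a, (y a).1 ≠ x.1 := by
        refine ae_all_iff.2 fun a => ?_
        exact Measure.pi_eval_preimage_null (μ := fun _ : Fin p => intensity L ν) (i := a)
          (s := {y : ℝ × M | ¬ y.1 ≠ x.1}) (by simpa using intensity_fst_eq x.1)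
      refine lintegral_eq_zero_of_ae_eq_zero ?_
      filter_upwards [ih, hne] with y hy hyx
      refine Set.indicator_of_notMem ?_ _
      have : (fun a => ((Fin.cons x y : Fin (p + 1) → ℝ × M) a).1) =
          (Fin.cons x.1 (fun a => (y a).1) : Fin (p + 1) → ℝ) := by
        funext a
        induction a using Fin.cases <;> simp
      simp only [Set.mem_compl_iff, Set.mem_ofPred_eq, not_not, this, Fin.cons_injective_iff]
      exact ⟨by simpa using hyx, hy⟩
    rw [lintegral_indicator_const hm.compl, one_mul] at h0
    exact h0

lemma measurePreserving_comp_symm {X ι ι' : Type*} [MeasurableSpace X] [Fintype ι] [Fintype ι']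
    (ρ : Measure X) [SigmaFinite ρ] (e : ι ≃ ι') :
    MeasurePreserving (fun (x : ι → X) (a : ι') => x (e.symm a)) (Measure.pi fun _ => ρ)
      (Measure.pi fun _ => ρ) := by
  have h := measurePreserving_piCongrLeft (fun _ : ι' => ρ) e
  convert h using 1
  funext x a
  obtain ⟨b, rfl⟩ := e.surjective a
  rw [MeasurableEquiv.piCongrLeft_apply_apply]
  simp

/-- Campbell's formula: the factorial moment measures of a marked Poisson process are the powers
of its intensity. -/
lemma lintegral_tsum_injective_fin (p : ℕ) {f : (Fin p → ℝ × M) → ℝ≥0∞} (hf : Measurable f) :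
    ∫⁻ z, ∑' i, {i : Fin p → ℕ | Function.Injective i}.indicator
        (fun i => f fun a => markedPoint z (i a)) i ∂(gapLaw L ν) =
      ∫⁻ x, f x ∂(Measure.pi fun _ => intensity L ν) := by
  have hσ : ∀ σ : Equiv.Perm (Fin p), Measurable fun x : Fin p → ℝ × M => f fun a => x (σ.symm a) :=
    fun σ => hf.comp (by fun_prop)
  have e1 : ∀ z : ℕ → ℝ × M, ∑' i, {i : Fin p → ℕ | Function.Injective i}.indicator
      (fun i => f fun a => markedPoint z (i a)) i = ∑ σ : Equiv.Perm (Fin p), ∑' i,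
        {i : Fin p → ℕ | StrictMono i}.indicator
          (fun i => f fun a => markedPoint z (i (σ.symm a))) i := by
    intro z
    rw [← Summable.tsum_finsetSum fun _ _ => ENNReal.summable]
    have : ∀ i : Fin p → ℕ, {i : Fin p → ℕ | Function.Injective i}.indicator
        (fun i => f fun a => markedPoint z (i a)) i = ∑ σ : Equiv.Perm (Fin p),
          {i : Fin p → ℕ | StrictMono i}.indicator (fun _ => (1 : ℝ≥0∞)) (i ∘ σ) *
            f fun a => markedPoint z (i a) := by
      intro i
      rw [← Finset.sum_mul, sum_perm_indicator_strictMono]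
      by_cases hi : Function.Injective i <;> simp [hi]
    simp_rw [this]
    rw [Summable.tsum_finsetSum fun _ _ => ENNReal.summable,
      Summable.tsum_finsetSum fun _ _ => ENNReal.summable]
    refine Finset.sum_congr rfl fun σ _ => ?_
    rw [← (Equiv.arrowCongr σ (Equiv.refl ℕ)).tsum_eq]
    refine tsum_congr fun i => ?_
    have : (Equiv.arrowCongr σ (Equiv.refl ℕ)) i ∘ σ = i := by
      funext a; simp
    rw [this]
    by_cases hi : StrictMono i <;> simp [hi]
  have hmi : ∀ σ : Equiv.Perm (Fin p), Measurable fun x : Fin p → ℝ × M =>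
      {t : Fin p → ℝ | StrictMono t}.indicator (fun _ => (1 : ℝ≥0∞)) ((fun a => (x a).1) ∘ σ) := by
    intro σ
    have hms : MeasurableSet {x : Fin p → ℝ × M | StrictMono ((fun a => (x a).1) ∘ σ)} :=
      (measurableSet_strictMono_fst p).preimage (f := fun (x : Fin p → ℝ × M) a => x (σ a))
        (by fun_prop)
    have : (fun x : Fin p → ℝ × M => {t : Fin p → ℝ | StrictMono t}.indicator
        (fun _ => (1 : ℝ≥0∞)) ((fun a => (x a).1) ∘ σ)) =
          {x : Fin p → ℝ × M | StrictMono ((fun a => (x a).1) ∘ σ)}.indicator fun _ => 1 := by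
      funext x
      simp [Set.indicator_apply]
    rw [this]
    exact measurable_const.indicator hms
  have e2 : ∀ σ : Equiv.Perm (Fin p), ∫⁻ x in {x | StrictMono fun a => (x a).1},
      f (fun a => x (σ.symm a)) ∂(Measure.pi fun _ => intensity L ν) =
        ∫⁻ x, {t : Fin p → ℝ | StrictMono t}.indicator (fun _ => (1 : ℝ≥0∞))
          ((fun a => (x a).1) ∘ σ) * f x ∂(Measure.pi fun _ => intensity L ν) := by
    intro σ
    rw [← lintegral_indicator (measurableSet_strictMono_fst _),
      ← (measurePreserving_comp_symm (intensity L ν) σ).lintegral_comp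
        (f := fun x => {t : Fin p → ℝ | StrictMono t}.indicator (fun _ => (1 : ℝ≥0∞))
          ((fun a => (x a).1) ∘ σ) * f x) ((hmi σ).mul hf)]
    refine lintegral_congr fun x => ?_
    have : ((fun a => (x (σ.symm a)).1) ∘ σ) = fun a => (x a).1 := by
      funext a; simp
    rw [this]
    by_cases hx : StrictMono fun a => (x a).1 <;> simp [hx]
  simp_rw [e1]
  rw [lintegral_finsetSum]
  · simp_rw [fun σ : Equiv.Perm (Fin p) => lintegral_tsum_strictMono (L := L) (ν := ν) p (hσ σ), e2]
    rw [← lintegral_finsetSum (f := fun (σ : Equiv.Perm (Fin p)) x =>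
      {t : Fin p → ℝ | StrictMono t}.indicator (fun _ => (1 : ℝ≥0∞)) ((fun a => (x a).1) ∘ σ) * f x) _
        fun σ _ => (hmi σ).mul hf]
    refine lintegral_congr_ae ?_
    filter_upwards [ae_injective_fst (L := L) (ν := ν) p] with x hx
    rw [← Finset.sum_mul, sum_perm_indicator_strictMono]
    simp [hx]
  · intro σ _
    refine Measurable.tsum fun i => ?_
    by_cases hi : StrictMono i
    · simp only [Set.indicator_apply, Set.mem_ofPred_eq, hi, if_true]
      exact hf.comp (by fun_prop)
    · simp only [Set.indicator_apply, Set.mem_ofPred_eq, hi, if_false]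
      exact measurable_const

end Campbell

section Campbell

variable {M : Type*} [MeasurableSpace M]
variable {L : ℝ} [hL : Fact (0 < L)] {ν : Measure M} [IsProbabilityMeasure ν]

/-- Campbell's formula for families of distinct points with an arbitrary finite index type. -/
lemma lintegral_tsum_embedding {ι : Type*} [Fintype ι] {f : (ι → ℝ × M) → ℝ≥0∞}
    (hf : Measurable f) :
    ∫⁻ z, ∑' i : ι ↪ ℕ, f (fun a => markedPoint z (i a)) ∂(gapLaw L ν) =
      ∫⁻ x, f x ∂(Measure.pi fun _ => intensity L ν) := by
  let e := (Fintype.equivFin ι).symm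
  have hf' : Measurable fun x : Fin (Fintype.card ι) → ℝ × M => f fun a => x (e.symm a) :=
    hf.comp (by fun_prop)
  rw [← (measurePreserving_comp_symm (intensity L ν) e).lintegral_comp hf,
    ← lintegral_tsum_injective_fin _ hf']
  refine lintegral_congr fun z => ?_
  rw [← tsum_subtype]
  let e' : {i : Fin (Fintype.card ι) → ℕ | Function.Injective i} ≃ (ι ↪ ℕ) :=
    (Equiv.subtypeInjectiveEquivEmbedding _ _).trans (Equiv.embeddingCongr e (Equiv.refl ℕ))
  rw [← e'.tsum_eq]
  rfl

lemma lintegral_pi_prod {X ι : Type*} [MeasurableSpace X] [Fintype ι] (ρ : Measure X)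
    [SigmaFinite ρ] {g : ι → X → ℝ≥0∞} (hg : ∀ a, Measurable (g a)) :
    ∫⁻ x, ∏ a, g a (x a) ∂(Measure.pi fun _ => ρ) = ∏ a, ∫⁻ y, g a y ∂ρ := by
  have hfin : ∀ (p : ℕ) (g : Fin p → X → ℝ≥0∞), (∀ a, Measurable (g a)) →
      ∫⁻ x, ∏ a, g a (x a) ∂(Measure.pi fun _ => ρ) = ∏ a, ∫⁻ y, g a y ∂ρ := by
    intro p
    induction p with
    | zero => intro g _; simp
    | succ p ih =>
      intro g hg
      rw [lintegral_pi_succ ρ (by fun_prop), Fin.prod_univ_succ]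
      simp_rw [Fin.prod_univ_succ, Fin.cons_zero, Fin.cons_succ]
      rw [← ih _ fun a => hg a.succ, ← lintegral_mul_const _ (hg 0)]
      refine lintegral_congr fun x => ?_
      rw [lintegral_const_mul _ (by fun_prop)]
  let e := (Fintype.equivFin ι).symm
  rw [← (measurePreserving_comp_symm ρ e).lintegral_comp (by fun_prop)]
  rw [← e.prod_comp, ← hfin _ (fun a => g (e a)) fun a => hg _]
  refine lintegral_congr fun x => ?_
  rw [← e.prod_comp]
  simp

/-- Campbell's formula for a marked point `x` and further marked points, whose weights depend on
`x` and are independent of each other. -/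
lemma lintegral_tsum_option {ι : Type*} [Fintype ι] {G : ℝ × M → ℝ≥0∞} (hG : Measurable G)
    {g : ι → ℝ × M → ℝ × M → ℝ≥0∞} (hg : ∀ a, Measurable (Function.uncurry (g a))) :
    ∫⁻ z, ∑' i : Option ι ↪ ℕ, (G (markedPoint z (i none)) *
        ∏ a, g a (markedPoint z (i none)) (markedPoint z (i (some a)))) ∂(gapLaw L ν) =
      ∫⁻ x, G x * ∏ a, ∫⁻ y, g a x y ∂(intensity L ν) ∂(intensity L ν) := by
  let F : (Option ι → ℝ × M) → ℝ≥0∞ := fun x => G (x none) * ∏ a, g a (x none) (x (some a))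
  have hm : Measurable F := by
    refine (hG.comp (measurable_pi_apply _)).mul ?_
    refine Finset.measurable_fun_prod _ fun a _ => ?_
    exact (hg a).comp (f := fun x : Option ι → ℝ × M => (x none, x (some a))) (by fun_prop)
  refine (lintegral_tsum_embedding hm).trans ?_
  have hm' : Measurable fun q => F ((MeasurableEquiv.piOptionEquivProd fun _ => ℝ × M).symm q) :=
    hm.comp (MeasurableEquiv.measurable _)
  rw [← Measure.pi_map_piOptionEquivProd, lintegral_map hm (MeasurableEquiv.measurable _),
    lintegral_prod_symm _ hm'.aemeasurable]
  refine lintegral_congr fun x => ?_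
  have hgx : ∀ a, Measurable (g a x) := fun a => (hg a).of_uncurry_left
  rw [← lintegral_pi_prod _ hgx, ← lintegral_const_mul]
  · rfl
  · exact Finset.measurable_fun_prod _ fun a _ => (hgx a).comp (measurable_pi_apply a)

end Campbell

/-! ### The marked Poisson process of the arriving calls -/

section Pairs

variable {Ω : Type*} [MeasurableSpace Ω] {μ : Measure Ω}

/-- Two independent sequences of independent variables form a sequence of independent pairs. -/
lemma iIndepFun_pair {A B : Type*} [MeasurableSpace A] [MeasurableSpace B]
    [IsProbabilityMeasure μ] {X : ℕ → Ω → A} {Y : ℕ → Ω → B}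
    (mX : ∀ i, Measurable (X i)) (mY : ∀ i, Measurable (Y i)) (hX : iIndepFun X μ)
    (hY : iIndepFun Y μ) (hXY : IndepFun (fun ω i => X i ω) (fun ω i => Y i ω) μ) :
    iIndepFun (fun i ω => (X i ω, Y i ω)) μ := by
  rw [iIndepFun_iff_finset]
  intro s
  have hXs : iIndepFun (fun i : s => X i) μ :=
    .precomp (g := fun i : s => i.1) Subtype.val_injective hX
  have hYs : iIndepFun (fun i : s => Y i) μ :=
    .precomp (g := fun i : s => i.1) Subtype.val_injective hY
  have pX : ∀ i : s, IsProbabilityMeasure (μ.map (X i)) := fun i =>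
    Measure.isProbabilityMeasure_map (mX i).aemeasurable
  have pY : ∀ i : s, IsProbabilityMeasure (μ.map (Y i)) := fun i =>
    Measure.isProbabilityMeasure_map (mY i).aemeasurable
  have hpair : ∀ i : s, μ.map (fun ω => (X i ω, Y i ω)) = (μ.map (X i)).prod (μ.map (Y i)) := by
    intro i
    have : IndepFun (X i) (Y i) μ := hXY.comp (φ := fun x : ℕ → A => x i.1)
      (ψ := fun y : ℕ → B => y i.1) (measurable_pi_apply _) (measurable_pi_apply _)
    exact (indepFun_iff_map_prod_eq_prod_map_map (mX i).aemeasurable (mY i).aemeasurable).1 this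
  have hXYs : IndepFun (fun ω (i : s) => X i ω) (fun ω (i : s) => Y i ω) μ :=
    hXY.comp (φ := fun (x : ℕ → A) (i : s) => x i.1) (ψ := fun (y : ℕ → B) (i : s) => y i.1)
      (by fun_prop) (by fun_prop)
  have hj := (indepFun_iff_map_prod_eq_prod_map_map
    (Measurable.aemeasurable (by fun_prop)) (Measurable.aemeasurable (by fun_prop))).1 hXYs
  rw [iIndepFun_iff_map_fun_eq_pi_map (fun i => by
    exact ((mX i).prodMk (mY i)).aemeasurable)]
  have e := measurePreserving_arrowProdEquivProdArrow A B s (fun i => μ.map (X i))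
    (fun i => μ.map (Y i))
  have h1 : Measure.pi (fun i : s => μ.map (X i)) = μ.map fun ω (i : s) => X i ω :=
    ((iIndepFun_iff_map_fun_eq_pi_map (f := fun i : s => X i)
      fun i => (mX i).aemeasurable).1 hXs).symm
  have h2 : Measure.pi (fun i : s => μ.map (Y i)) = μ.map fun ω (i : s) => Y i ω :=
    ((iIndepFun_iff_map_fun_eq_pi_map (f := fun i : s => Y i)
      fun i => (mY i).aemeasurable).1 hYs).symm
  have h3 := e.symm.map_eq
  rw [h1, h2, ← hj, Measure.map_map (MeasurableEquiv.measurable _) (by fun_prop)] at h3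
  simp_rw [← hpair] at h3
  exact h3

end Pairs

namespace Input

variable {Ω : Type*} [MeasurableSpace Ω] {μ : Measure Ω} {lam : ℝ} {n d : ℕ}

/-- The rate of the arrival process. -/
noncomputable def _root_.Routing.rate (lam : ℝ) (n : ℕ) : ℝ := lam * (n.choose 2 : ℝ)

/-- The law of a call together with its duration. -/
noncomputable def _root_.Routing.markLaw (n d : ℕ) : Measure (Call n d × ℝ) :=
  (((Fintype.card (Call n d) : ℝ≥0∞)⁻¹) • Measure.count).prod (expMeasure 1)

/-- The arrival time, the call and the duration of the `i`-th call. -/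
noncomputable def point (S : Input μ lam n d) (i : ℕ) (ω : Ω) : ℝ × (Call n d × ℝ) :=
  (S.arrival i ω, S.call i ω, S.dur i ω)

/-- The interarrival times, calls and durations. -/
def gaps (S : Input μ lam n d) (ω : Ω) (i : ℕ) : ℝ × (Call n d × ℝ) :=
  (S.gap i ω, S.call i ω, S.dur i ω)

lemma measurable_gaps (S : Input μ lam n d) : Measurable S.gaps :=
  measurable_pi_iff.2 fun i =>
    (S.measurable_gap i).prodMk ((S.measurable_call i).prodMk (S.measurable_dur i))

lemma map_call (S : Input μ lam n d) (i : ℕ) :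
    μ.map (S.call i) = ((Fintype.card (Call n d) : ℝ≥0∞)⁻¹) • Measure.count := by
  refine Measure.ext_of_singleton fun c => ?_
  rw [Measure.map_apply (S.measurable_call i) (MeasurableSet.singleton c), Measure.smul_apply,
    Measure.count_singleton, smul_eq_mul, mul_one]
  exact S.law_call i c

lemma isProbabilityMeasure_markLaw [IsProbabilityMeasure μ] (S : Input μ lam n d) :
    IsProbabilityMeasure (markLaw n d) := by
  have h : IsProbabilityMeasure (((Fintype.card (Call n d) : ℝ≥0∞)⁻¹) •
      (Measure.count : Measure (Call n d))) := by
    rw [← S.map_call 0]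
    exact Measure.isProbabilityMeasure_map (S.measurable_call 0).aemeasurable
  have : Fact ((0 : ℝ) < 1) := ⟨one_pos⟩
  unfold markLaw
  infer_instance

lemma iIndep_mark [IsProbabilityMeasure μ] (S : Input μ lam n d) :
    iIndepFun (fun i ω => (S.call i ω, S.dur i ω)) μ :=
  iIndepFun_pair S.measurable_call S.measurable_dur S.iIndep_call S.iIndep_dur S.indep_call

lemma iIndep_gaps [IsProbabilityMeasure μ] (S : Input μ lam n d) :
    iIndepFun (fun i ω => S.gaps ω i) μ := by
  refine iIndepFun_pair S.measurable_gap
    (fun i => (S.measurable_call i).prodMk (S.measurable_dur i)) S.iIndep_gap S.iIndep_mark ?_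
  exact S.indep_gap.comp (φ := id)
    (ψ := fun q : (ℕ → Call n d) × (ℕ → ℝ) => fun i => (q.1 i, q.2 i)) measurable_id (by fun_prop)

lemma map_gaps [IsProbabilityMeasure μ] (S : Input μ lam n d) [Fact (0 < rate lam n)]
    [IsProbabilityMeasure (markLaw n d)] : μ.map S.gaps = gapLaw (rate lam n) (markLaw n d) := by
  have h := S.iIndep_gaps.map_fun_eq_infinitePi_map fun i =>
    (measurable_pi_iff.1 S.measurable_gaps) i
  have hi : ∀ i, μ.map (fun ω => S.gaps ω i) =
      (expMeasure (rate lam n)).prod (markLaw n d) := by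
    intro i
    have h1 : IndepFun (S.gap i) (fun ω => (S.call i ω, S.dur i ω)) μ :=
      S.indep_gap.comp (φ := fun x : ℕ → ℝ => x i)
        (ψ := fun q : (ℕ → Call n d) × (ℕ → ℝ) => (q.1 i, q.2 i)) (by fun_prop) (by fun_prop)
    have h2 : IndepFun (S.call i) (S.dur i) μ :=
      S.indep_call.comp (φ := fun x : ℕ → Call n d => x i) (ψ := fun x : ℕ → ℝ => x i)
        (by fun_prop) (by fun_prop)
    have h1' := (indepFun_iff_map_prod_eq_prod_map_map (S.measurable_gap i).aemeasurable
      ((S.measurable_call i).prodMk (S.measurable_dur i)).aemeasurable).1 h1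
    have h2' := (indepFun_iff_map_prod_eq_prod_map_map (S.measurable_call i).aemeasurable
      (S.measurable_dur i).aemeasurable).1 h2
    rw [S.law_gap] at h1'
    rw [S.law_dur, S.map_call] at h2'
    rw [h2'] at h1'
    exact h1'
  rw [gapLaw]
  refine h.trans ?_
  simp_rw [hi]

end Input

/-! ### Exponential durations and the initial calls -/

lemma expMeasure_Ici {t : ℝ} (ht : 0 ≤ t) :
    expMeasure 1 (Set.Ici t) = ENNReal.ofReal (Real.exp (-t)) := by
  have : Fact ((0 : ℝ) < 1) := ⟨one_pos⟩
  have h1 : (expMeasure 1) (Set.Ici t) = (expMeasure 1) (Set.Ioi t) := by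
    refine measure_congr ?_
    rw [expMeasure_eq_erlang]
    exact (withDensity_absolutelyContinuous _ _).ae_le Ioi_ae_eq_Ici.symm
  have h2 := cdf_expMeasure_eq one_pos t
  rw [cdf_eq_real, if_pos ht, one_mul] at h2
  rw [h1, ← Set.compl_Iic, measure_compl measurableSet_Iic (measure_ne_top _ _), measure_univ,
    ← ofReal_measureReal, h2, ← ENNReal.ofReal_one, ← ENNReal.ofReal_sub _ (by
      have := Real.exp_le_one_iff.2 (neg_nonpos.2 ht); linarith)]
  congr 1
  ring

lemma lintegral_ofReal_expMeasure : ∫⁻ x, ENNReal.ofReal x ∂(expMeasure 1) = 1 := by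
  have : Fact ((0 : ℝ) < 1) := ⟨one_pos⟩
  have h := (lintegral_erlang_succ one_pos 0 (f := fun _ => 1) measurable_const).symm
  rw [← expMeasure_eq_erlang] at h
  simp only [lintegral_const, measure_univ, mul_one, zero_add] at h
  rw [withDensity_apply _ MeasurableSet.univ, Measure.restrict_univ, one_mul] at h
  rw [← h, expMeasure_eq_erlang, lintegral_withDensity_eq_lintegral_mul _ (measurable_erlang 1 0)
    (by fun_prop)]
  refine lintegral_congr fun x => ?_
  simp only [Pi.mul_apply, erlang, Set.indicator_apply, Set.mem_Ioi]
  split_ifs with hx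
  · rw [← ENNReal.ofReal_mul (by positivity)]
    congr 1
    simp [mul_comm]
  · simp

lemma expMeasure_Iio_zero (L : ℝ) : expMeasure L (Set.Iio 0) = 0 := by
  rw [expMeasure_eq_erlang, withDensity_apply _ measurableSet_Iio, lintegral_eq_zero_iff
    (measurable_erlang L 0)]
  refine (ae_restrict_iff' measurableSet_Iio).2 (ae_of_all _ fun x hx => ?_)
  simp only [Set.mem_Iio] at hx
  simp [erlang, hx.le]

/-- The probability that a call and its candidates lie in a given set. -/
noncomputable def callProb {n d : ℕ} (C : Set (Call n d)) : ℝ≥0∞ :=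
  (Fintype.card (Call n d) : ℝ≥0∞)⁻¹ * Measure.count C

lemma intensity_eq_mul {n d : ℕ} [IsProbabilityMeasure (markLaw n d)] (L : ℝ) (C : Set (Call n d))
    {B : Set (ℝ × ℝ)} (hB : MeasurableSet B) :
    intensity L (markLaw n d) {y | y.2.1 ∈ C ∧ (y.1, y.2.2) ∈ B} =
      ENNReal.ofReal L * callProb C *
        ((volume.restrict (Set.Ioi (0 : ℝ))).prod (expMeasure 1)) B := by
  have : Fact ((0 : ℝ) < 1) := ⟨one_pos⟩
  have hms : MeasurableSet {y : ℝ × (Call n d × ℝ) | y.2.1 ∈ C ∧ (y.1, y.2.2) ∈ B} := by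
    have hC : MeasurableSet C := trivial
    exact (hC.preimage (f := fun y : ℝ × (Call n d × ℝ) => y.2.1) (by fun_prop)).inter
      (hB.preimage (f := fun y : ℝ × (Call n d × ℝ) => (y.1, y.2.2)) (by fun_prop))
  rw [intensity, Measure.prod_apply hms, Measure.prod_apply hB, lintegral_smul_measure,
    smul_eq_mul, mul_assoc, ← lintegral_const_mul _ (measurable_measure_prodMk_left hB)]
  congr 1
  refine lintegral_congr fun s => ?_
  have : Prod.mk s ⁻¹' {y : ℝ × (Call n d × ℝ) | y.2.1 ∈ C ∧ (y.1, y.2.2) ∈ B} =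
      C ×ˢ (Prod.mk s ⁻¹' B) := by
    ext ⟨c, x⟩; simp
  rw [this, markLaw, Measure.prod_prod, Measure.smul_apply, smul_eq_mul, callProb]

lemma measurableSet_inProgress (s t : ℝ) :
    MeasurableSet {p : ℝ × ℝ | p.1 ≤ t ∧ s ≤ p.1 + p.2} := by
  have h1 : MeasurableSet {p : ℝ × ℝ | p.1 ≤ t} := measurableSet_le (by fun_prop) (by fun_prop)
  have h2 : MeasurableSet {p : ℝ × ℝ | s ≤ p.1 + p.2} :=
    measurableSet_le (by fun_prop) (by fun_prop)
  exact h1.inter h2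

lemma measurableSet_arriveOrEnd (s t : ℝ) :
    MeasurableSet {p : ℝ × ℝ | p.1 ∈ Set.Icc s t ∨ p.1 + p.2 ∈ Set.Icc s t} := by
  have h1 : MeasurableSet {p : ℝ × ℝ | p.1 ∈ Set.Icc s t} :=
    measurableSet_Icc.preimage measurable_fst
  have h2 : MeasurableSet {p : ℝ × ℝ | p.1 + p.2 ∈ Set.Icc s t} :=
    measurableSet_Icc.preimage (f := fun p : ℝ × ℝ => p.1 + p.2) (by fun_prop)
  exact h1.union h2

/-- The calls that arrive before `t` and are still in progress at time `s`. -/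
lemma prod_inProgress_le {s t : ℝ} (hst : s ≤ t) :
    ((volume.restrict (Set.Ioi (0 : ℝ))).prod (expMeasure 1))
      {p | p.1 ≤ t ∧ s ≤ p.1 + p.2} ≤ ENNReal.ofReal (1 + (t - s)) := by
  have : Fact ((0 : ℝ) < 1) := ⟨one_pos⟩
  have hms : MeasurableSet {p : ℝ × ℝ | p.1 ≤ t ∧ s ≤ p.1 + p.2} := measurableSet_inProgress s t
  rw [Measure.prod_apply_symm hms]
  calc _ ≤ ∫⁻ x, (ENNReal.ofReal x + ENNReal.ofReal (t - s)) ∂(expMeasure 1) := by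
        have h0 : ∀ᵐ x ∂(expMeasure 1), 0 ≤ x := by
          rw [ae_iff]
          simpa [Set.Iio_def] using expMeasure_Iio_zero 1
        refine lintegral_mono_ae ?_
        filter_upwards [h0] with x hx
        refine (Measure.restrict_apply_le _ _).trans ?_
        have : (fun y => (y, x)) ⁻¹' {p : ℝ × ℝ | p.1 ≤ t ∧ s ≤ p.1 + p.2} = Set.Icc (s - x) t := by
          ext y; simp [and_comm]
        rw [this, Real.volume_Icc, ← ENNReal.ofReal_add hx (sub_nonneg.2 hst)]
        exact ENNReal.ofReal_le_ofReal (by linarith)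
    _ = _ := by
        rw [lintegral_add_right _ measurable_const, lintegral_ofReal_expMeasure, lintegral_const,
          measure_univ, mul_one, ENNReal.ofReal_add zero_le_one (sub_nonneg.2 hst),
          ENNReal.ofReal_one]

/-- The calls that arrive or end in the time interval `[s, t]`. -/
lemma prod_arriveOrEnd_le {s t : ℝ} :
    ((volume.restrict (Set.Ioi (0 : ℝ))).prod (expMeasure 1))
      {p | p.1 ∈ Set.Icc s t ∨ p.1 + p.2 ∈ Set.Icc s t} ≤ ENNReal.ofReal (t - s) * 2 := by
  have : Fact ((0 : ℝ) < 1) := ⟨one_pos⟩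
  have hms : MeasurableSet {p : ℝ × ℝ | p.1 ∈ Set.Icc s t ∨ p.1 + p.2 ∈ Set.Icc s t} :=
    measurableSet_arriveOrEnd s t
  rw [Measure.prod_apply_symm hms]
  calc _ ≤ ∫⁻ x, ENNReal.ofReal (t - s) * 2 ∂(expMeasure 1) := by
        refine lintegral_mono fun x => ?_
        refine (Measure.restrict_apply_le _ _).trans ?_
        have : (fun y => (y, x)) ⁻¹' {p : ℝ × ℝ | p.1 ∈ Set.Icc s t ∨ p.1 + p.2 ∈ Set.Icc s t} =
            Set.Icc s t ∪ Set.Icc (s - x) (t - x) := by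
          ext y; simp [le_sub_iff_add_le]
        rw [this]
        refine (measure_union_le _ _).trans ?_
        rw [Real.volume_Icc, Real.volume_Icc, show t - x - (s - x) = t - s by ring, mul_two]
    _ = _ := by rw [lintegral_const, measure_univ, mul_one]

lemma prod_Ico_Ici {s t η : ℝ} (hs : 0 ≤ s) (hη : 0 ≤ η) :
    ((volume.restrict (Set.Ioi (0 : ℝ))).prod (expMeasure 1))
      (Set.Ico s t ×ˢ Set.Ici η) = ENNReal.ofReal (t - s) * ENNReal.ofReal (Real.exp (-η)) := by
  have : Fact ((0 : ℝ) < 1) := ⟨one_pos⟩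
  rw [Measure.prod_prod, expMeasure_Ici hη, restrict_Ioi_eq_restrict_Ici,
    Measure.restrict_apply measurableSet_Ico]
  have : Set.Ico s t ∩ Set.Ici 0 = Set.Ico s t := Set.inter_eq_left.2 fun x hx => hs.trans hx.1
  rw [this, Real.volume_Ico]

namespace Input

variable {Ω : Type*} [MeasurableSpace Ω] {μ : Measure Ω} {lam : ℝ} {n d : ℕ}

lemma indep_initial_gaps [IsProbabilityMeasure μ] (S : Input μ lam n d) :
    IndepFun (fun ω => (S.init ω, fun p => S.residual p ω)) S.gaps μ := by
  have mi := S.measurable_init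
  have mr : Measurable fun ω p => S.residual p ω := measurable_pi_iff.2 S.measurable_residual
  have mg := S.measurable_gaps
  have hφ : Measurable fun q : (ℕ → ℝ) × (ℕ → Call n d) × (ℕ → ℝ) =>
      fun i => (q.1 i, q.2.1 i, q.2.2 i) := by fun_prop
  have h1 : IndepFun S.init (fun ω => (fun p => S.residual p ω, S.gaps ω)) μ :=
    S.indep_init.comp (φ := id)
      (ψ := fun q : (Route n × ℕ → ℝ) × (ℕ → ℝ) × (ℕ → Call n d) × (ℕ → ℝ) =>
        (q.1, fun i => (q.2.1 i, q.2.2.1 i, q.2.2.2 i))) measurable_id (by fun_prop)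
  have h2 : IndepFun (fun ω p => S.residual p ω) S.gaps μ :=
    S.indep_residual.comp (φ := id) measurable_id hφ
  rw [indepFun_iff_map_prod_eq_prod_map_map mi.aemeasurable (mr.prodMk mg).aemeasurable] at h1
  have h2' := (indepFun_iff_map_prod_eq_prod_map_map mr.aemeasurable mg.aemeasurable).1 h2
  have h3 : IndepFun S.init (fun ω p => S.residual p ω) μ :=
    S.indep_init.comp (φ := id) (ψ := Prod.fst) measurable_id measurable_fst
  have h3' := (indepFun_iff_map_prod_eq_prod_map_map mi.aemeasurable mr.aemeasurable).1 h3
  rw [indepFun_iff_map_prod_eq_prod_map_map (mi.prodMk mr).aemeasurable mg.aemeasurable, h3']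
  have := Measure.isProbabilityMeasure_map (μ := μ) mi.aemeasurable
  have := Measure.isProbabilityMeasure_map (μ := μ) mr.aemeasurable
  have := Measure.isProbabilityMeasure_map (μ := μ) mg.aemeasurable
  have h4 := (measurePreserving_prodAssoc (μ.map S.init) (μ.map fun ω p => S.residual p ω)
    (μ.map S.gaps)).symm.map_eq
  rw [← h2', ← h1, Measure.map_map (MeasurableEquiv.measurable _) (mi.prodMk (mr.prodMk mg))] at h4
  exact h4

/-- Some initial call is in progress at time `t`. -/
def InitAlive (S : Input μ lam n d) (t : ℝ) (ω : Ω) : Prop :=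
  ∃ r k, k < S.init ω r ∧ t ≤ S.residual (r, k) ω

@[fun_prop]
lemma measurable_init_apply (S : Input μ lam n d) (r : Route n) :
    Measurable fun ω => S.init ω r :=
  (measurable_pi_apply r).comp S.measurable_init

lemma measurableSet_initAlive (S : Input μ lam n d) (t : ℝ) :
    MeasurableSet {ω | S.InitAlive t ω} := by
  have : {ω | S.InitAlive t ω} =
      ⋃ r, ⋃ k, {ω | k < S.init ω r} ∩ {ω | t ≤ S.residual (r, k) ω} := by
    ext ω; simp [InitAlive]
  rw [this]
  refine MeasurableSet.iUnion fun r => MeasurableSet.iUnion fun k => ?_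
  exact (measurableSet_lt measurable_const (S.measurable_init_apply r)).inter
    (measurableSet_le measurable_const (S.measurable_residual (r, k)))

lemma tsum_indicator_lt (m : ℕ) : ∑' k : ℕ, (if k < m then (1 : ℝ≥0∞) else 0) = m := by
  rw [tsum_eq_sum (s := Finset.range m) (by simp),
    Finset.sum_congr rfl fun k hk => if_pos (Finset.mem_range.1 hk)]
  simp

/-- By the union bound, some initial call lasts until `t` with probability at most its mean number
times `exp (-t)`. -/
lemma measure_initAlive_le [IsProbabilityMeasure μ] (S : Input μ lam n d)
    (hint : Integrable (fun ω => ((S.init ω).total : ℝ)) μ) {t : ℝ} (ht : 0 ≤ t) :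
    μ {ω | S.InitAlive t ω} ≤ ENNReal.ofReal (S.meanInit * Real.exp (-t)) := by
  have h1 : {ω | S.InitAlive t ω} =
      ⋃ r, ⋃ k, {ω | k < S.init ω r} ∩ {ω | t ≤ S.residual (r, k) ω} := by
    ext ω; simp [InitAlive]
  have h2 : ∀ r k, μ ({ω | k < S.init ω r} ∩ {ω | t ≤ S.residual (r, k) ω}) =
      μ {ω | k < S.init ω r} * ENNReal.ofReal (Real.exp (-t)) := by
    intro r k
    have hi : IndepFun (fun ω => S.init ω r) (S.residual (r, k)) μ :=
      S.indep_init.comp (φ := fun x : LoadVector n => x r)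
        (ψ := fun q : (Route n × ℕ → ℝ) × (ℕ → ℝ) × (ℕ → Call n d) × (ℕ → ℝ) => q.1 (r, k))
        (measurable_pi_apply r) (by fun_prop)
    rw [← expMeasure_Ici ht, ← S.law_residual (r, k),
      Measure.map_apply (S.measurable_residual _) measurableSet_Ici]
    exact hi.measure_inter_preimage_eq_mul (Set.Ioi k) (Set.Ici t) measurableSet_Ioi
      measurableSet_Ici
  have h3 : ∀ r, ∑' k, μ {ω | k < S.init ω r} = ∫⁻ ω, (S.init ω r : ℝ≥0∞) ∂μ := by
    intro r
    simp_rw [← tsum_indicator_lt]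
    rw [lintegral_tsum fun k => Measurable.aemeasurable (Measurable.ite
      (measurableSet_lt measurable_const (S.measurable_init_apply r)) measurable_const
        measurable_const)]
    refine tsum_congr fun k => ?_
    rw [← lintegral_indicator_one (measurableSet_lt measurable_const (S.measurable_init_apply r))]
    simp [Set.indicator_apply]
  have h4 : ∑ r, ∫⁻ ω, (S.init ω r : ℝ≥0∞) ∂μ = ENNReal.ofReal S.meanInit := by
    rw [meanInit, ofReal_integral_eq_lintegral_ofReal hint (ae_of_all _ fun ω => by positivity),
      ← lintegral_finsetSum _ fun r _ => by
        exact (measurable_of_countable _).comp (S.measurable_init_apply r)]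
    refine lintegral_congr fun ω => ?_
    rw [LoadVector.total, ENNReal.ofReal_natCast, Nat.cast_sum]
  rw [h1]
  calc _ ≤ ∑ r, ∑' k, μ ({ω | k < S.init ω r} ∩ {ω | t ≤ S.residual (r, k) ω}) := by
        refine (measure_iUnion_fintype_le _ _).trans (Finset.sum_le_sum fun r _ => ?_)
        exact measure_iUnion_le _
    _ = _ := by
        simp_rw [h2, ENNReal.tsum_mul_right, h3]
        rw [← Finset.sum_mul, h4, ENNReal.ofReal_mul]
        exact integral_nonneg fun ω => by positivity

lemma lintegral_tsum_arrival [IsProbabilityMeasure μ] (S : Input μ lam n d)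
    [Fact (0 < rate lam n)] {h : ℝ → ℝ≥0∞} (hh : Measurable h) :
    ∫⁻ ω, ∑' j, h (S.arrival j ω) ∂μ =
      ENNReal.ofReal (rate lam n) * ∫⁻ t in Set.Ioi 0, h t := by
  have := S.isProbabilityMeasure_markLaw
  have : Countable (Unit ↪ ℕ) := DFunLike.coe_injective.countable
  let f : (Unit → ℝ × (Call n d × ℝ)) → ℝ≥0∞ := fun x => h (x ()).1
  have hf : Measurable f := hh.comp (by fun_prop)
  have e := lintegral_tsum_embedding (L := rate lam n) (ν := markLaw n d) hf
  have hms : Measurable fun z : ℕ → ℝ × (Call n d × ℝ) =>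
      ∑' i : Unit ↪ ℕ, f fun a => markedPoint z (i a) :=
    Measurable.tsum fun i => hf.comp (measurable_pi_iff.2 fun a => measurable_markedPoint (i a))
  rw [← S.map_gaps, lintegral_map hms S.measurable_gaps] at e
  have e2 : ∫⁻ x, f x ∂(Measure.pi fun _ => intensity (rate lam n) (markLaw n d)) =
      ENNReal.ofReal (rate lam n) * ∫⁻ t in Set.Ioi 0, h t := by
    have := lintegral_pi_prod (ι := Unit) (intensity (rate lam n) (markLaw n d))
      (g := fun _ p => h p.1) fun _ => by fun_prop
    simp only [Finset.univ_unique, Finset.prod_singleton] at this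
    refine this.trans ?_
    rw [intensity, lintegral_prod _ (by fun_prop)]
    simp [lintegral_smul_measure]
  rw [← e2, ← e]
  refine lintegral_congr fun ω => ?_
  let e' : ℕ ≃ (Unit ↪ ℕ) :=
    { toFun := fun k => ⟨fun _ => k, fun _ _ _ => rfl⟩
      invFun := fun i => i ()
      left_inv := fun _ => rfl
      right_inv := fun _ => rfl }
  rw [← e'.tsum_eq]
  rfl

/-- The mean number of calls that arrive after time `t₁` and meet an initial call. -/
lemma lintegral_initAlive_arrival_le [IsProbabilityMeasure μ] (S : Input μ lam n d)
    [Fact (0 < rate lam n)]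
    (hint : Integrable (fun ω => ((S.init ω).total : ℝ)) μ) {t₁ : ℝ} (ht : 0 ≤ t₁) :
    ∫⁻ ω, ∑' j, {ω | t₁ ≤ S.arrival j ω ∧ S.InitAlive (S.arrival j ω) ω}.indicator 1 ω ∂μ ≤
      ENNReal.ofReal (rate lam n * S.meanInit * Real.exp (-t₁)) := by
  let A : Set ((LoadVector n × (Route n × ℕ → ℝ)) × ℝ) :=
    {q | t₁ ≤ q.2 ∧ ∃ r k, k < q.1.1 r ∧ q.2 ≤ q.1.2 (r, k)}
  have hA : MeasurableSet A := by
    have : A = {q | t₁ ≤ q.2} ∩ ⋃ r, ⋃ k, {q | k < q.1.1 r} ∩ {q | q.2 ≤ q.1.2 (r, k)} := by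
      ext q; simp [A]
    rw [this]
    refine (measurableSet_le (by fun_prop) (by fun_prop)).inter
      (MeasurableSet.iUnion fun r => MeasurableSet.iUnion fun k => ?_)
    exact (measurableSet_lt (by fun_prop) (by fun_prop)).inter
      (measurableSet_le (by fun_prop) (by fun_prop))
  let I : Ω → LoadVector n × (Route n × ℕ → ℝ) := fun ω => (S.init ω, fun p => S.residual p ω)
  have mI : Measurable I := S.measurable_init.prodMk (measurable_pi_iff.2 S.measurable_residual)
  have pI := Measure.isProbabilityMeasure_map (μ := μ) mI.aemeasurable
  let h : ℝ → ℝ≥0∞ := fun t => (μ.map I) ((fun x => (x, t)) ⁻¹' A)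
  have hh : Measurable h := measurable_measure_prodMk_right hA
  have hle : ∀ t, h t ≤ (Set.Ici t₁).indicator
      (fun t => ENNReal.ofReal (S.meanInit * Real.exp (-t))) t := by
    intro t
    by_cases h1 : t₁ ≤ t
    · rw [Set.indicator_of_mem (by exact h1)]
      refine le_trans ?_ (S.measure_initAlive_le hint (ht.trans h1))
      simp only [h]
      rw [Measure.map_apply mI (hA.preimage (by fun_prop))]
      exact measure_mono fun ω hω => hω.2
    · rw [Set.indicator_of_notMem (by exact h1)]
      have : (fun x => (x, t)) ⁻¹' A = ∅ := by
        ext x; simp [A, h1]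
      simp [h, this]
  have mT : ∀ j, Measurable fun z : ℕ → ℝ × (Call n d × ℝ) => (markedPoint z j).1 := by
    intro j; fun_prop
  have e1 : ∀ j, ∫⁻ ω, {ω | t₁ ≤ S.arrival j ω ∧ S.InitAlive (S.arrival j ω) ω}.indicator 1 ω ∂μ =
      ∫⁻ ω, h (S.arrival j ω) ∂μ := by
    intro j
    have hi := (indepFun_iff_map_prod_eq_prod_map_map mI.aemeasurable
      S.measurable_gaps.aemeasurable).1 S.indep_initial_gaps
    have hA' : MeasurableSet ((fun q : (LoadVector n × (Route n × ℕ → ℝ)) ×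
        (ℕ → ℝ × (Call n d × ℝ)) => (q.1, (markedPoint q.2 j).1)) ⁻¹' A) :=
      hA.preimage (measurable_fst.prodMk ((mT j).comp measurable_snd))
    have h1 : {ω | t₁ ≤ S.arrival j ω ∧ S.InitAlive (S.arrival j ω) ω} =
        (fun ω => (I ω, S.gaps ω)) ⁻¹' ((fun q : (LoadVector n × (Route n × ℕ → ℝ)) ×
        (ℕ → ℝ × (Call n d × ℝ)) => (q.1, (markedPoint q.2 j).1)) ⁻¹' A) := rfl
    have h2 := (mI.prodMk S.measurable_gaps) hA'
    rw [h1, lintegral_indicator_one h2, ← Measure.map_apply (mI.prodMk S.measurable_gaps) hA', hi,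
      Measure.prod_apply_symm hA', lintegral_map _ S.measurable_gaps]
    · rfl
    · exact measurable_measure_prodMk_right hA'
  have mAr : ∀ j, Measurable (S.arrival j) := fun j => (mT j).comp S.measurable_gaps
  have mS : ∀ j, AEMeasurable ({ω | t₁ ≤ S.arrival j ω ∧
      S.InitAlive (S.arrival j ω) ω}.indicator (1 : Ω → ℝ≥0∞)) μ := by
    intro j
    refine (measurable_one.indicator ?_).aemeasurable
    exact (mI.prodMk (mAr j)) hA
  rw [lintegral_tsum mS]
  simp_rw [e1]
  rw [← lintegral_tsum (f := fun j ω => h (S.arrival j ω)) fun j => (hh.comp (mAr j)).aemeasurable,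
    S.lintegral_tsum_arrival hh]
  calc _ ≤ ENNReal.ofReal (rate lam n) * ∫⁻ t in Set.Ioi t₁,
        ENNReal.ofReal (S.meanInit * Real.exp (-t)) := by
        refine mul_le_mul' le_rfl ?_
        rw [restrict_Ioi_eq_restrict_Ici (a := t₁), ← lintegral_indicator measurableSet_Ici]
        exact (lintegral_mono hle).trans (lintegral_mono' Measure.restrict_le_self le_rfl)
    _ = _ := by
        have hM : 0 ≤ S.meanInit := integral_nonneg fun ω => by positivity
        rw [← ofReal_integral_eq_lintegral_ofReal, integral_const_mul, integral_exp_neg_Ioi,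
          ← ENNReal.ofReal_mul, mul_assoc]
        · exact (Fact.out : 0 < rate lam n).le
        · exact (integrableOn_exp_neg_Ioi t₁).const_mul _
        · exact ae_of_all _ fun t => by positivity

end Input

/-! ### Counting calls -/

section Counting

variable {n d : ℕ}

/-- The pair of end nodes of a call. -/
def Call.ends (c : Call n d) : Sym2 (Fin n) := c.1.1

/-- The `m`-th candidate node of a call. -/
def Call.cand (c : Call n d) (m : Fin d) : Fin n := c.1.2 m

/-- The set of candidate nodes of a call. -/
def Call.cands (c : Call n d) : Finset (Fin n) := Finset.univ.image c.cand

lemma Call.cand_notMem (c : Call n d) (m : Fin d) : c.cand m ∉ c.ends := c.2.2 m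

lemma Call.mem_cands {c : Call n d} {w : Fin n} : w ∈ c.cands ↔ ∃ m, c.cand m = w := by
  simp [Call.cands]

lemma Call.ends_route (c : Call n d) (m : Fin d) : (c.route m).ends = c.ends := rfl

lemma Call.via_route (c : Call n d) (m : Fin d) : (c.route m).via = c.cand m := rfl

/-- A call is a pair of distinct nodes with a tuple of other nodes. -/
def callEquiv (n d : ℕ) : Call n d ≃
    Σ e : {e : Sym2 (Fin n) // ¬ e.IsDiag}, (Fin d → {w : Fin n // w ∉ e.1}) where
  toFun c := ⟨⟨c.1.1, c.2.1⟩, fun m => ⟨c.1.2 m, c.2.2 m⟩⟩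
  invFun p := ⟨(p.1.1, fun m => (p.2 m).1), p.1.2, fun m => (p.2 m).2⟩
  left_inv _ := rfl
  right_inv _ := rfl

@[simp]
lemma callEquiv_symm_fst (e : {e : Sym2 (Fin n) // ¬ e.IsDiag})
    (f : Fin d → {w : Fin n // w ∉ e.1}) : ((callEquiv n d).symm ⟨e, f⟩).ends = e.1 := rfl

@[simp]
lemma callEquiv_symm_snd (e : {e : Sym2 (Fin n) // ¬ e.IsDiag})
    (f : Fin d → {w : Fin n // w ∉ e.1}) (m : Fin d) :
    ((callEquiv n d).symm ⟨e, f⟩).cand m = (f m).1 := rfl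

lemma sum_call {A : Type*} [AddCommMonoid A] (F : Call n d → A) :
    ∑ c, F c = ∑ e : {e : Sym2 (Fin n) // ¬ e.IsDiag}, ∑ f : Fin d → {w : Fin n // w ∉ e.1},
      F ((callEquiv n d).symm ⟨e, f⟩) := by
  rw [← (callEquiv n d).symm.sum_comp, Fintype.sum_sigma]

lemma card_notMem {e : Sym2 (Fin n)} (he : ¬ e.IsDiag) :
    Fintype.card {w : Fin n // w ∉ e} = n - 2 := by
  have h := Sym2.card_toFinset_of_not_isDiag e he
  rw [Fintype.card_subtype_compl, Fintype.card_fin, ← h, ← Fintype.card_coe]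
  congr 1
  exact Fintype.card_congr (Equiv.subtypeEquivRight fun w => by simp)

lemma card_call (n d : ℕ) : Fintype.card (Call n d) = n.choose 2 * (n - 2) ^ d := by
  rw [Fintype.card_congr (callEquiv n d), Fintype.card_sigma]
  simp only [Fintype.card_fun, Fintype.card_fin]
  rw [Finset.sum_congr rfl fun e _ => by rw [card_notMem e.2]]
  rw [Finset.sum_const, Finset.card_univ, Sym2.card_subtype_not_diag, Fintype.card_fin, smul_eq_mul]

lemma card_incident (u : Fin n) :
    (Finset.univ.filter fun e : {e : Sym2 (Fin n) // ¬ e.IsDiag} => u ∈ e.1).card = n - 1 := by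
  have : (Finset.univ.filter fun e : {e : Sym2 (Fin n) // ¬ e.IsDiag} => u ∈ e.1).card =
      ((Finset.univ : Finset (Fin n)).erase u).card := by
    symm
    refine Finset.card_bij (fun v hv => ⟨s(u, v), by simpa [eq_comm] using hv⟩) ?_ ?_ ?_
    · intro v hv; simp
    · intro v hv v' hv' h
      exact Sym2.congr_right.1 (Subtype.ext_iff.1 h)
    · rintro ⟨e, he⟩ h
      obtain ⟨v, rfl⟩ : ∃ v, e = s(u, v) := by
        obtain ⟨v, hv⟩ := (Finset.mem_filter.1 h).2
        exact ⟨v, hv⟩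
      exact ⟨v, by simpa [eq_comm] using he, rfl⟩
  rw [this, Finset.card_erase_of_mem (Finset.mem_univ _), Finset.card_univ, Fintype.card_fin]

lemma card_candidate_eq {e : Sym2 (Fin n)} (he : ¬ e.IsDiag) (m : Fin d) {w : Fin n} (hw : w ∉ e) :
    (Finset.univ.filter fun f : Fin d → {w : Fin n // w ∉ e} => (f m).1 = w).card =
      (n - 2) ^ (d - 1) := by
  have := Fintype.card_filter_piFinset_const_eq_of_mem (ι := Fin d)
    (Finset.univ : Finset {w : Fin n // w ∉ e}) m (Finset.mem_univ ⟨w, hw⟩)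
  rw [Finset.card_univ, card_notMem he, Fintype.card_fin] at this
  rw [← this]
  congr 1
  ext f
  simp [Subtype.ext_iff]

lemma callProb_eq (C : Set (Call n d)) [DecidablePred (· ∈ C)] :
    callProb C = ((Finset.univ.filter (· ∈ C)).card : ℝ≥0∞) / (n.choose 2 * (n - 2) ^ d : ℕ) := by
  have : C = ((Finset.univ.filter (· ∈ C) : Finset (Call n d)) : Set (Call n d)) := by ext; simp
  rw [callProb, ← card_call]
  conv_lhs => rw [this]
  rw [Measure.count_apply_finset, mul_comm, ENNReal.div_eq_inv_mul, mul_comm]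

/-- The calls for a given node with a given candidate arrive at a bounded rate. -/
lemma rate_mul_callProb_incident_le {lam : ℝ} (hlam : 0 < lam) (hn : 3 ≤ n) (hd : 0 < d)
    (u w : Fin n) :
    ENNReal.ofReal (rate lam n) * callProb {c : Call n d | u ∈ c.ends ∧ w ∈ c.cands} ≤
      ENNReal.ofReal (2 * lam * d) := by
  classical
  have h1 : (Finset.univ.filter fun c : Call n d => u ∈ c.ends ∧ w ∈ c.cands).card ≤
      d * ((n - 1) * (n - 2) ^ (d - 1)) := by
    calc _ ≤ (Finset.univ.biUnion fun m : Fin d =>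
          Finset.univ.filter fun c : Call n d => u ∈ c.ends ∧ c.cand m = w).card := by
          refine Finset.card_le_card fun c => ?_
          simp [Call.cands]
      _ ≤ ∑ m : Fin d, (Finset.univ.filter fun c : Call n d => u ∈ c.ends ∧ c.cand m = w).card :=
          Finset.card_biUnion_le
      _ ≤ ∑ m : Fin d, (n - 1) * (n - 2) ^ (d - 1) := by
          refine Finset.sum_le_sum fun m _ => ?_
          rw [Finset.card_filter, sum_call]
          calc _ ≤ ∑ e : {e : Sym2 (Fin n) // ¬ e.IsDiag}, if u ∈ e.1 then (n - 2) ^ (d - 1)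
                else 0 := by
                refine Finset.sum_le_sum fun e _ => ?_
                rw [← Finset.card_filter]
                simp only [callEquiv_symm_fst, callEquiv_symm_snd]
                by_cases hu : u ∈ e.1
                · simp only [hu, true_and, if_true]
                  by_cases hw : w ∈ e.1
                  · rw [Finset.card_eq_zero.2]
                    · exact Nat.zero_le _
                    · ext f
                      simp only [Finset.mem_filter_univ, Finset.notMem_empty, iff_false]
                      intro h
                      exact (f m).2 (h ▸ hw)
                  · exact (card_candidate_eq e.2 m hw).le
                · simp [hu]
            _ = _ := by
                rw [← Finset.sum_filter, Finset.sum_const, card_incident, smul_eq_mul]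
      _ = _ := by simp
  rw [callProb_eq, rate, ← ENNReal.ofReal_natCast, ← ENNReal.ofReal_natCast,
    ← ENNReal.ofReal_div_of_pos, ← ENNReal.ofReal_mul (by positivity)]
  · refine ENNReal.ofReal_le_ofReal ?_
    have hc : 0 < n.choose 2 := Nat.choose_pos (by omega)
    have h2 : ((Finset.univ.filter fun c : Call n d => u ∈ c.ends ∧ w ∈ c.cands).card : ℝ) ≤
      d * ((n - 1 : ℕ) * (n - 2 : ℕ) ^ (d - 1)) := by exact_mod_cast h1
    have h3 : (0 : ℝ) < (n - 2 : ℕ) := by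
      have : 0 < n - 2 := by omega
      exact_mod_cast this
    have h4 : ((n - 1 : ℕ) : ℝ) ≤ 2 * (n - 2 : ℕ) := by
      have : n - 1 ≤ 2 * (n - 2) := by omega
      exact_mod_cast this
    have h5 : (0 : ℝ) < n.choose 2 := by exact_mod_cast hc
    have h6 : ((n - 2 : ℕ) : ℝ) ^ d = (n - 2 : ℕ) ^ (d - 1) * (n - 2 : ℕ) := by
      rw [← pow_succ]; congr 1; omega
    push_cast
    rw [mul_div_assoc', div_le_iff₀ (by positivity), h6]
    calc _ ≤ lam * (n.choose 2 : ℝ) * (d * ((n - 1 : ℕ) * (n - 2 : ℕ) ^ (d - 1))) := by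
          have : 0 ≤ lam * (n.choose 2 : ℝ) := by positivity
          exact mul_le_mul_of_nonneg_left h2 this
      _ ≤ lam * (n.choose 2 : ℝ) * (d * ((2 * (n - 2 : ℕ)) * (n - 2 : ℕ) ^ (d - 1))) := by
          gcongr
      _ = _ := by ring
  · have : 0 < n.choose 2 * (n - 2) ^ d :=
      Nat.mul_pos (Nat.choose_pos (by omega)) (pow_pos (by omega) _)
    exact_mod_cast this

lemma rate_mul_callProb_first {lam : ℝ} (hlam : 0 < lam) (hn : 3 ≤ n) (hd : 0 < d)
    {u y w : Fin n} (huy : u ≠ y) (hwu : w ≠ u) (hwy : w ≠ y) :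
    ENNReal.ofReal (rate lam n) * callProb {c : Call n d | c.ends = s(u, y) ∧ c.cand ⟨0, hd⟩ = w} =
      ENNReal.ofReal (lam / (n - 2 : ℕ)) := by
  classical
  have h1 : (Finset.univ.filter fun c : Call n d => c.ends = s(u, y) ∧ c.cand ⟨0, hd⟩ = w).card =
      (n - 2) ^ (d - 1) := by
    have he : ¬ (s(u, y)).IsDiag := by simpa using huy
    have hw : w ∉ s(u, y) := by simp [hwu, hwy]
    rw [Finset.card_filter, sum_call]
    rw [Finset.sum_eq_single ⟨s(u, y), he⟩]
    · rw [← Finset.card_filter, ← card_candidate_eq he ⟨0, hd⟩ hw]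
      simp
    · intro e _ hne
      have : e.1 ≠ s(u, y) := fun h => hne (Subtype.ext h)
      simp [this]
    · simp
  have hc : 0 < n.choose 2 := Nat.choose_pos (by omega)
  have h3 : (0 : ℝ) < (n - 2 : ℕ) := by
    have : 0 < n - 2 := by omega
    exact_mod_cast this
  have h5 : (0 : ℝ) < n.choose 2 := by exact_mod_cast hc
  have h6 : ((n - 2 : ℕ) : ℝ) ^ d = (n - 2 : ℕ) ^ (d - 1) * (n - 2 : ℕ) := by
    rw [← pow_succ]; congr 1; omega
  rw [callProb_eq]
  simp only [Set.mem_ofPred_eq]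
  rw [h1, rate, ← ENNReal.ofReal_natCast, ← ENNReal.ofReal_natCast,
    ← ENNReal.ofReal_div_of_pos, ← ENNReal.ofReal_mul (by positivity)]
  · congr 1
    push_cast
    rw [h6]
    field_simp
  · push_cast
    positivity

/-- The candidates of a call with few distinct candidates: this is the generating function of the
number of distinct values of a function. -/
lemma sum_pow_card_image_le {S : Type*} [Fintype S] [DecidableEq S] {q : ℝ} (hq : 0 ≤ q) (d : ℕ) :
    ∑ f : Fin (d + 1) → S, q ^ (Finset.univ.image f).card ≤
      (Fintype.card S * q) * (Fintype.card S * q + (d + 1)) ^ d := by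
  induction d with
  | zero =>
    simp
  | succ d ih =>
    rw [← (Fin.consEquiv fun _ => S).sum_comp, Fintype.sum_prod_type_right]
    have key : ∀ f : Fin (d + 1) → S, ∑ w : S,
        q ^ (Finset.univ.image ((Fin.consEquiv fun _ => S) (w, f) : Fin (d + 2) → S)).card ≤
          q ^ (Finset.univ.image f).card * (Fintype.card S * q + (d + 1)) := by
      intro f
      have h1 : ∀ w : S, (Finset.univ.image
          ((Fin.consEquiv fun _ => S) (w, f) : Fin (d + 2) → S)) =
            insert w (Finset.univ.image f) := by
        intro w
        ext x
        simp [Fin.consEquiv, Fin.exists_fin_succ, eq_comm]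
      have h2 : ∀ w : S, q ^ (insert w (Finset.univ.image f)).card ≤
          q ^ (Finset.univ.image f).card * (q + if w ∈ Finset.univ.image f then 1 else 0) := by
        intro w
        by_cases hw : w ∈ Finset.univ.image f
        · rw [Finset.insert_eq_of_mem hw, if_pos hw]
          exact le_mul_of_one_le_right (by positivity) (by linarith)
        · rw [Finset.card_insert_of_notMem hw, if_neg hw, pow_succ, add_zero]
      simp_rw [h1]
      refine (Finset.sum_le_sum fun w _ => h2 w).trans ?_
      rw [← Finset.mul_sum, Finset.sum_add_distrib]
      refine mul_le_mul_of_nonneg_left ?_ (by positivity)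
      refine add_le_add (by simp) ?_
      rw [← Finset.sum_filter, Finset.sum_const, nsmul_eq_mul, mul_one]
      have : (Finset.univ.filter (· ∈ Finset.univ.image f)).card ≤ d + 1 := by
        simpa using Finset.card_image_le (f := f) (s := Finset.univ)
      exact_mod_cast this
    calc _ ≤ ∑ f : Fin (d + 1) → S, q ^ (Finset.univ.image f).card *
          (Fintype.card S * q + (d + 1)) := Finset.sum_le_sum fun f _ => key f
      _ ≤ ((Fintype.card S * q) * (Fintype.card S * q + (d + 1)) ^ d) *
          (Fintype.card S * q + (d + 1)) := by
          rw [← Finset.sum_mul]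
          exact mul_le_mul_of_nonneg_right ih (by positivity)
      _ = (Fintype.card S * q) * (Fintype.card S * q + (d + 1)) ^ (d + 1) := by ring
      _ ≤ _ := by
          push_cast
          gcongr
          linarith

lemma card_cands_callEquiv_symm (e : {e : Sym2 (Fin n) // ¬ e.IsDiag})
    (f : Fin d → {w : Fin n // w ∉ e.1}) :
    ((callEquiv n d).symm ⟨e, f⟩).cands.card = (Finset.univ.image f).card := by
  rw [← Finset.card_image_of_injective (Finset.univ.image f) Subtype.val_injective,
    Finset.image_image]
  rfl

lemma sum_call_pow_cands_le (hd : 0 < d) {q : ℝ} (hq : 0 ≤ q) :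
    ∑ c : Call n d, q ^ c.cands.card ≤
      (n.choose 2) * (((n - 2 : ℕ) * q) * ((n - 2 : ℕ) * q + d) ^ (d - 1)) := by
  obtain ⟨d, rfl⟩ : ∃ d', d = d' + 1 := ⟨d - 1, by omega⟩
  rw [sum_call]
  calc _ ≤ ∑ e : {e : Sym2 (Fin n) // ¬ e.IsDiag},
        (((n - 2 : ℕ) * q) * ((n - 2 : ℕ) * q + (d + 1 : ℕ)) ^ d) := by
        refine Finset.sum_le_sum fun e _ => ?_
        have h := sum_pow_card_image_le (S := {w : Fin n // w ∉ e.1}) hq d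
        rw [card_notMem e.2] at h
        push_cast
        refine le_trans (le_of_eq ?_) h
        simp_rw [card_cands_callEquiv_symm]
    _ = _ := by
        rw [Finset.sum_const, Finset.card_univ, Sym2.card_subtype_not_diag, Fintype.card_fin,
          nsmul_eq_mul]
        simp

lemma card_call_cands_eq_one (hd : 0 < d) :
    n.choose 2 * (n - 2) ≤ (Finset.univ.filter fun c : Call n d => c.cands.card = 1).card := by
  rw [Finset.card_filter, sum_call]
  have h : ∀ e : {e : Sym2 (Fin n) // ¬ e.IsDiag}, n - 2 ≤
      ∑ f : Fin d → {w : Fin n // w ∉ e.1},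
        if ((callEquiv n d).symm ⟨e, f⟩).cands.card = 1 then 1 else 0 := by
    intro e
    simp_rw [card_cands_callEquiv_symm]
    have hne : Nonempty (Fin d) := ⟨⟨0, hd⟩⟩
    rw [← Finset.card_filter, ← card_notMem e.2, ← Finset.card_univ,
      ← Finset.card_image_of_injective _ (Function.const_injective (α := Fin d))]
    refine Finset.card_le_card fun f hf => ?_
    obtain ⟨w, _, rfl⟩ := Finset.mem_image.1 hf
    simp only [Finset.mem_filter_univ]
    rw [Finset.card_eq_one]
    exact ⟨w, by ext; simp [Function.const, eq_comm]⟩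
  refine le_trans (le_of_eq ?_) (Finset.sum_le_sum fun e _ => h e)
  rw [Finset.sum_const, Finset.card_univ, Sym2.card_subtype_not_diag, Fintype.card_fin, smul_eq_mul]

lemma card_call_cands_eq :
    n.choose 2 * (n - 2).descFactorial d ≤
      (Finset.univ.filter fun c : Call n d => c.cands.card = d).card := by
  rw [Finset.card_filter, sum_call]
  have h : ∀ e : {e : Sym2 (Fin n) // ¬ e.IsDiag}, (n - 2).descFactorial d ≤
      ∑ f : Fin d → {w : Fin n // w ∉ e.1},
        if ((callEquiv n d).symm ⟨e, f⟩).cands.card = d then 1 else 0 := by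
    intro e
    simp_rw [card_cands_callEquiv_symm]
    rw [← Finset.card_filter]
    have hc := Fintype.card_embedding_eq (α := Fin d) (β := {w : Fin n // w ∉ e.1})
    rw [card_notMem e.2, Fintype.card_fin] at hc
    rw [← hc, ← Finset.card_univ, ← Finset.card_image_of_injective _
      (DFunLike.coe_injective : Function.Injective fun f : Fin d ↪ {w : Fin n // w ∉ e.1} => ⇑f)]
    refine Finset.card_le_card fun f hf => ?_
    obtain ⟨w, _, rfl⟩ := Finset.mem_image.1 hf
    simp only [Finset.mem_filter_univ]
    rw [Finset.card_image_of_injective _ w.injective, Finset.card_univ, Fintype.card_fin]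
  refine le_trans (le_of_eq ?_) (Finset.sum_le_sum fun e _ => h e)
  rw [Finset.sum_const, Finset.card_univ, Sym2.card_subtype_not_diag, Fintype.card_fin, smul_eq_mul]

end Counting

/-! ### Link loads -/

namespace Input

variable {Ω : Type*} [MeasurableSpace Ω] {μ : Measure Ω} {lam : ℝ} {n d : ℕ}

/-- The calls that are in progress when the `j`-th call arrives and occupy the link `vw`. -/
noncomputable def linkCalls (S : Input μ lam n d) (choice : ℕ → Ω → Option (Fin d)) (j : ℕ) (ω : Ω)
    (v w : Fin n) : Finset ℕ := by
  classical exact (Finset.range j).filter fun i => S.arrival j ω ≤ S.arrival i ω + S.dur i ω ∧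
    ∃ m, choice i ω = some m ∧ v ∈ (S.call i ω).ends ∧ (S.call i ω).cand m = w

lemma mem_linkCalls {S : Input μ lam n d} {choice : ℕ → Ω → Option (Fin d)} {j : ℕ} {ω : Ω}
    {v w : Fin n} {i : ℕ} : i ∈ S.linkCalls choice j ω v w ↔
      i < j ∧ S.arrival j ω ≤ S.arrival i ω + S.dur i ω ∧
        ∃ m, choice i ω = some m ∧ v ∈ (S.call i ω).ends ∧ (S.call i ω).cand m = w := by
  simp [linkCalls]

/-- The load of a link once all initial calls have ended. -/
lemma link_loadBefore {S : Input μ lam n d} {choice : ℕ → Ω → Option (Fin d)} {j : ℕ} {ω : Ω}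
    (h : ¬ S.InitAlive (S.arrival j ω) ω) (v w : Fin n) :
    (S.loadBefore choice j ω).link v w = (S.linkCalls choice j ω v w).card := by
  classical
  have h0 : ∀ r, ((Finset.range (S.init ω r)).filter fun k =>
      S.arrival j ω ≤ S.residual (r, k) ω).card = 0 := by
    intro r
    rw [Finset.card_eq_zero, Finset.filter_eq_empty_iff]
    intro k hk h'
    exact h ⟨r, k, Finset.mem_range.1 hk, h'⟩
  simp only [LoadVector.link, loadBefore, h0, zero_add]
  rw [linkCalls, Finset.card_filter]
  simp_rw [Finset.card_filter]
  rw [← Finset.sum_filter, Finset.sum_comm]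
  refine Finset.sum_congr rfl fun i _ => ?_
  by_cases hal : S.arrival j ω ≤ S.arrival i ω + S.dur i ω
  · simp only [hal, true_and]
    cases hc : choice i ω with
    | none => simp
    | some m =>
      simp [Finset.sum_ite_eq, Call.ends_route, Call.via_route]
  · simp [hal]

lemma arrival_mono {S : Input μ lam n d} {ω : Ω} (h : ∀ i, 0 ≤ S.gap i ω) {i j : ℕ} (hij : i ≤ j) :
    S.arrival i ω ≤ S.arrival j ω :=
  Finset.sum_le_sum_of_subset_of_nonneg (Finset.range_subset_range.2 (by omega)) fun k _ _ => h k

lemma ae_gap_nonneg (S : Input μ lam n d) : ∀ᵐ ω ∂μ, ∀ i, 0 ≤ S.gap i ω := by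
  refine ae_all_iff.2 fun i => ?_
  have h := expMeasure_Iio_zero (lam * (n.choose 2 : ℝ))
  rw [← S.law_gap i, Measure.map_apply (S.measurable_gap i) measurableSet_Iio] at h
  rw [ae_iff]
  simp_rw [not_le]
  exact h

/-- Campbell's formula for a call `x` and further calls, whose weights depend on `x` and are
independent of each other. -/
lemma lintegral_tsum_point [IsProbabilityMeasure μ] (S : Input μ lam n d) [Fact (0 < rate lam n)]
    {ι : Type*} [Fintype ι] {G : ℝ × (Call n d × ℝ) → ℝ≥0∞} (hG : Measurable G)
    {g : ι → ℝ × (Call n d × ℝ) → ℝ × (Call n d × ℝ) → ℝ≥0∞}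
    (hg : ∀ a, Measurable (Function.uncurry (g a))) :
    ∫⁻ ω, ∑' i : Option ι ↪ ℕ, (G (S.point (i none) ω) *
        ∏ a, g a (S.point (i none) ω) (S.point (i (some a)) ω)) ∂μ =
      ∫⁻ x, G x * ∏ a, ∫⁻ y, g a x y ∂(intensity (rate lam n) (markLaw n d))
        ∂(intensity (rate lam n) (markLaw n d)) := by
  have := S.isProbabilityMeasure_markLaw
  have : Countable (Option ι ↪ ℕ) := DFunLike.coe_injective.countable
  rw [← lintegral_tsum_option hG hg, ← S.map_gaps, lintegral_map _ S.measurable_gaps]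
  · rfl
  refine Measurable.tsum fun i => (hG.comp (measurable_markedPoint _)).mul ?_
  refine Finset.measurable_fun_prod _ fun a _ => ?_
  exact (hg a).comp (f := fun z : ℕ → ℝ × (Call n d × ℝ) =>
    (markedPoint z (i none), markedPoint z (i (some a)))) (by fun_prop)

end Input

/-- Disjoint sets with at least `D` elements carry at least `(D!)^k` families of enumerations. -/
lemma exists_embedding_of_le_card {W : Type*} [Finite W] {D j : ℕ} {A : W → Finset ℕ}
    (hA : ∀ w, D ≤ (A w).card) (hdisj : ∀ w w' i, i ∈ A w → i ∈ A w' → w = w')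
    (hj : ∀ w, j ∉ A w) :
    ∃ b : Option (W × Fin D) ↪ ℕ, b none = j ∧ ∀ w l, b (some (w, l)) ∈ A w := by
  have h1 : ∀ w, ∃ e : Fin D ↪ A w, True := fun w => by
    obtain ⟨e⟩ := Function.Embedding.nonempty_of_card_le (α := Fin D) (β := A w)
      (by simpa using hA w)
    exact ⟨e, trivial⟩
  choose e _ using h1
  refine ⟨⟨fun o => o.elim j fun p => (e p.1 p.2).1, ?_⟩, rfl, fun w l => (e w l).2⟩
  rintro (_ | ⟨w, l⟩) (_ | ⟨w', l'⟩) h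
  · rfl
  · exact absurd (show j ∈ A w' from (show j = _ from h) ▸ (e w' l').2) (hj w')
  · exact absurd (show j ∈ A w from (show _ = j from h) ▸ (e w l).2) (hj w)
  · have h' : (e w l).1 = (e w' l').1 := h
    obtain rfl := hdisj w w' _ (e w l).2 (h' ▸ (e w' l').2)
    obtain rfl := (e w).injective (Subtype.ext h')
    rfl

/-- Every family of permutations of the enumerated sets gives another such embedding. -/
noncomputable def permEmbedding {W : Type*} {D : ℕ} (b : Option (W × Fin D) ↪ ℕ)
    (σ : W → Equiv.Perm (Fin D)) : Option (W × Fin D) ↪ ℕ :=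
  (Equiv.optionCongr (Equiv.prodShear (Equiv.refl W) σ)).toEmbedding.trans b

@[simp]
lemma permEmbedding_none {W : Type*} {D : ℕ} (b : Option (W × Fin D) ↪ ℕ)
    (σ : W → Equiv.Perm (Fin D)) : permEmbedding b σ none = b none := rfl

@[simp]
lemma permEmbedding_some {W : Type*} {D : ℕ} (b : Option (W × Fin D) ↪ ℕ)
    (σ : W → Equiv.Perm (Fin D)) (w : W) (l : Fin D) :
    permEmbedding b σ (some (w, l)) = b (some (w, σ w l)) := rfl

lemma permEmbedding_injective {W : Type*} {D : ℕ} (b : Option (W × Fin D) ↪ ℕ) :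
    Function.Injective (permEmbedding b) := by
  intro σ τ h
  funext w
  ext l
  have h1 := DFunLike.congr_fun h (some (w, l))
  simp only [permEmbedding_some] at h1
  have h2 := b.injective h1
  simp only [Option.some.injEq, Prod.mk.injEq, true_and] at h2
  rw [h2]

/-- If every index of `J` is the distinguished point of an embedding whose permutations all lie in
`P`, then `P` has at least `(D!) ^ k` times as many elements as `J`. -/
lemma encard_mul_factorial_le {W : Type*} [Fintype W] {D : ℕ} {J : Set ℕ}
    {P : Set (Option (W × Fin D) ↪ ℕ)}
    (h : ∀ j ∈ J, ∃ b : Option (W × Fin D) ↪ ℕ, b none = j ∧ ∀ σ, permEmbedding b σ ∈ P) :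
    J.encard * (D.factorial ^ Fintype.card W : ℕ) ≤ P.encard := by
  classical
  have h' : ∀ j : J, ∃ b : Option (W × Fin D) ↪ ℕ, b none = j ∧ ∀ σ, permEmbedding b σ ∈ P :=
    fun j => h j j.2
  choose b hb1 hb2 using h'
  let φ : J × (W → Equiv.Perm (Fin D)) → P := fun p => ⟨permEmbedding (b p.1) p.2, hb2 p.1 p.2⟩
  have hφ : Function.Injective φ := by
    rintro ⟨j, σ⟩ ⟨j', σ'⟩ h
    have h0 := Subtype.ext_iff.1 h
    have h1 := DFunLike.congr_fun h0 none
    simp only [φ, permEmbedding_none, hb1] at h1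
    obtain rfl := Subtype.ext h1
    rw [Prod.mk.injEq]
    exact ⟨rfl, permEmbedding_injective _ h0⟩
  have h1 := ENat.card_le_card_of_injective hφ
  rw [ENat.card_prod] at h1
  simpa [ENat.card_coe_set_eq, Fintype.card_perm] using h1

/-- If the elements of `U` with the same distinguished point differ by permutations only, then `U`
has at most `(D!) ^ k` times as many elements as distinguished points. -/
lemma encard_le_mul_factorial {W : Type*} [Fintype W] {D : ℕ} {U : Set (Option (W × Fin D) ↪ ℕ)}
    {J : Set ℕ} (h1 : ∀ b ∈ U, b none ∈ J)
    (h2 : ∀ b ∈ U, ∀ b' ∈ U, b' none = b none → ∃ σ, b' = permEmbedding b σ) :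
    U.encard ≤ J.encard * (D.factorial ^ Fintype.card W : ℕ) := by
  classical
  have h3 : ∀ j : {j | ∃ b ∈ U, b none = j}, ∃ b ∈ U, b none = j := fun j => j.2
  choose B hB1 hB2 using h3
  have h4 : ∀ b : U, ∃ σ, b.1 = permEmbedding (B ⟨b.1 none, b.1, b.2, rfl⟩) σ := fun b =>
    h2 _ (hB1 _) _ b.2 (hB2 ⟨b.1 none, b.1, b.2, rfl⟩).symm
  choose σ hσ using h4
  let φ : U → J × (W → Equiv.Perm (Fin D)) := fun b => (⟨b.1 none, h1 _ b.2⟩, σ b)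
  have hφ : Function.Injective φ := by
    intro b b' h
    simp only [φ, Prod.mk.injEq, Subtype.mk.injEq] at h
    refine Subtype.ext ?_
    have e : (⟨b.1 none, b.1, b.2, rfl⟩ : {j | ∃ b ∈ U, b none = j}) =
        ⟨b'.1 none, b'.1, b'.2, rfl⟩ := Subtype.ext h.1
    rw [hσ b, hσ b', h.2, e]
  have h5 := ENat.card_le_card_of_injective hφ
  rw [ENat.card_prod] at h5
  simpa [ENat.card_coe_set_eq, Fintype.card_perm] using h5

lemma tsum_indicator_eq_encard {X : Type*} (J : Set X) :
    ∑' j, J.indicator (1 : X → ℝ≥0∞) j = ((J.encard : ℕ∞) : ℝ≥0∞) := by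
  rw [← tsum_subtype]
  simp [ENat.card_coe_set_eq]

/-! ### Patterns of calls -/

/-- An arrival time with a call and its duration. -/
abbrev MarkedCall (n d : ℕ) : Type := ℝ × (Call n d × ℝ)

namespace Input

variable {Ω : Type*} [MeasurableSpace Ω] {μ : Measure Ω} {lam : ℝ} {n d : ℕ} {ι : Type*}

/-- The families of distinct calls, one of them distinguished, such that the distinguished call
lies in `A` and each other call `a` stands in the relation `B a` to the distinguished one. -/
def patternSet (S : Input μ lam n d) (A : Set (MarkedCall n d))
    (B : ι → Set (MarkedCall n d × MarkedCall n d)) (ω : Ω) : Set (Option ι ↪ ℕ) :=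
  {b | S.point (b none) ω ∈ A ∧ ∀ a, (S.point (b none) ω, S.point (b (some a)) ω) ∈ B a}

lemma encard_patternSet [Fintype ι] (S : Input μ lam n d) (A : Set (MarkedCall n d))
    (B : ι → Set (MarkedCall n d × MarkedCall n d)) (ω : Ω) :
    (((S.patternSet A B ω).encard : ℕ∞) : ℝ≥0∞) = ∑' b : Option ι ↪ ℕ,
      (A.indicator 1 (S.point (b none) ω) *
        ∏ a, (B a).indicator 1 (S.point (b none) ω, S.point (b (some a)) ω)) := by
  rw [← tsum_indicator_eq_encard]
  refine tsum_congr fun b => ?_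
  by_cases h : b ∈ S.patternSet A B ω
  · rw [Set.indicator_of_mem h, Set.indicator_of_mem h.1, Pi.one_apply, Pi.one_apply, one_mul]
    exact (Finset.prod_eq_one fun a _ => Set.indicator_of_mem (h.2 a) _).symm
  · rw [Set.indicator_of_notMem h]
    simp only [patternSet, Set.mem_ofPred_eq, not_and_or, not_forall] at h
    rcases h with h | ⟨a, h⟩
    · rw [Set.indicator_of_notMem h, zero_mul]
    · rw [Finset.prod_eq_zero (Finset.mem_univ a) (Set.indicator_of_notMem h _), mul_zero]

/-- The patterns are determined by the interarrival times, calls and durations. -/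
lemma exists_measurable_encard_patternSet [Fintype ι] (S : Input μ lam n d)
    {A : Set (MarkedCall n d)} (hA : MeasurableSet A)
    {B : ι → Set (MarkedCall n d × MarkedCall n d)} (hB : ∀ a, MeasurableSet (B a)) :
    ∃ f : (ℕ → MarkedCall n d) → ℝ≥0∞, Measurable f ∧
      ∀ ω, (((S.patternSet A B ω).encard : ℕ∞) : ℝ≥0∞) = f (S.gaps ω) := by
  have : Countable (Option ι ↪ ℕ) := DFunLike.coe_injective.countable
  refine ⟨fun z => ∑' b : Option ι ↪ ℕ, (A.indicator 1 (markedPoint z (b none)) *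
    ∏ a, (B a).indicator 1 (markedPoint z (b none), markedPoint z (b (some a)))), ?_,
    fun ω => S.encard_patternSet A B ω⟩
  refine Measurable.tsum fun i => Measurable.mul ?_ (Finset.measurable_fun_prod _ fun a _ => ?_)
  · exact (measurable_one.indicator hA).comp (measurable_markedPoint _)
  · exact (measurable_one.indicator (hB a)).comp
      ((measurable_markedPoint _).prodMk (measurable_markedPoint _))

lemma measurable_encard_patternSet [Fintype ι] (S : Input μ lam n d) {A : Set (MarkedCall n d)}
    (hA : MeasurableSet A) {B : ι → Set (MarkedCall n d × MarkedCall n d)}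
    (hB : ∀ a, MeasurableSet (B a)) :
    Measurable fun ω => (((S.patternSet A B ω).encard : ℕ∞) : ℝ≥0∞) := by
  obtain ⟨f, hf, h⟩ := S.exists_measurable_encard_patternSet hA hB
  simp_rw [h]
  exact hf.comp S.measurable_gaps

/-- The mean number of patterns: the calls that are related to the distinguished call contribute
independent factors. -/
lemma lintegral_encard_patternSet [IsProbabilityMeasure μ] [Fintype ι] (S : Input μ lam n d)
    [Fact (0 < rate lam n)] {A : Set (MarkedCall n d)} (hA : MeasurableSet A)
    {B : ι → Set (MarkedCall n d × MarkedCall n d)} (hB : ∀ a, MeasurableSet (B a)) :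
    ∫⁻ ω, (((S.patternSet A B ω).encard : ℕ∞) : ℝ≥0∞) ∂μ =
      ∫⁻ x in A, ∏ a, intensity (rate lam n) (markLaw n d) (Prod.mk x ⁻¹' B a)
        ∂(intensity (rate lam n) (markLaw n d)) := by
  simp_rw [encard_patternSet]
  rw [S.lintegral_tsum_point (measurable_one.indicator hA)
    (g := fun a x y => (B a).indicator 1 (x, y)) fun a => measurable_one.indicator (hB a),
    ← lintegral_indicator hA]
  refine lintegral_congr fun x => ?_
  by_cases hx : x ∈ A
  · rw [Set.indicator_of_mem hx, Set.indicator_of_mem hx, Pi.one_apply, one_mul]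
    refine Finset.prod_congr rfl fun a _ => ?_
    rw [← lintegral_indicator_one (measurable_prodMk_left (hB a))]
    rfl
  · rw [Set.indicator_of_notMem hx, Set.indicator_of_notMem hx, zero_mul]

lemma lintegral_encard_patternSet_le [IsProbabilityMeasure μ] [Fintype ι] (S : Input μ lam n d)
    [Fact (0 < rate lam n)] {A : Set (MarkedCall n d)} (hA : MeasurableSet A)
    {B : ι → Set (MarkedCall n d × MarkedCall n d)} (hB : ∀ a, MeasurableSet (B a))
    {h : ι → ℝ≥0∞} (hle : ∀ x ∈ A, ∀ a,
      intensity (rate lam n) (markLaw n d) (Prod.mk x ⁻¹' B a) ≤ h a) :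
    ∫⁻ ω, (((S.patternSet A B ω).encard : ℕ∞) : ℝ≥0∞) ∂μ ≤
      intensity (rate lam n) (markLaw n d) A * ∏ a, h a := by
  rw [S.lintegral_encard_patternSet hA hB, mul_comm, ← setLIntegral_const]
  exact setLIntegral_mono' hA fun x hx => Finset.prod_le_prod' fun a _ => hle x hx a

lemma lintegral_encard_patternSet_eq [IsProbabilityMeasure μ] [Fintype ι] (S : Input μ lam n d)
    [Fact (0 < rate lam n)] {A : Set (MarkedCall n d)} (hA : MeasurableSet A)
    {B : ι → Set (MarkedCall n d × MarkedCall n d)} (hB : ∀ a, MeasurableSet (B a))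
    {h : ι → ℝ≥0∞} (heq : ∀ x ∈ A, ∀ a,
      intensity (rate lam n) (markLaw n d) (Prod.mk x ⁻¹' B a) = h a) :
    ∫⁻ ω, (((S.patternSet A B ω).encard : ℕ∞) : ℝ≥0∞) ∂μ =
      intensity (rate lam n) (markLaw n d) A * ∏ a, h a := by
  rw [S.lintegral_encard_patternSet hA hB, mul_comm, ← setLIntegral_const]
  exact setLIntegral_congr_fun hA fun x hx => Finset.prod_congr rfl fun a _ => heq x hx a

end Input

/-! ### The upper bound for the mean number of lost calls -/

lemma callProb_mono {n d : ℕ} {C C' : Set (Call n d)} (h : C ⊆ C') : callProb C ≤ callProb C' :=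
  mul_le_mul' le_rfl (measure_mono h)

lemma callProb_union_le {n d : ℕ} (C C' : Set (Call n d)) :
    callProb (C ∪ C') ≤ callProb C + callProb C' := by
  rw [callProb, callProb, callProb, ← mul_add]
  exact mul_le_mul' le_rfl (measure_union_le _ _)

/-- The calls that share an end node with `e` and have the candidate `w`. -/
def adjacentCalls {n : ℕ} (d : ℕ) (e : Sym2 (Fin n)) (w : Fin n) : Set (Call n d) :=
  {c | (∃ v ∈ e, v ∈ c.ends) ∧ w ∈ c.cands}

lemma rate_mul_callProb_adjacentCalls_le {n d : ℕ} {lam : ℝ} (hlam : 0 < lam) (hn : 3 ≤ n)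
    (hd : 0 < d) (e : Sym2 (Fin n)) (w : Fin n) :
    ENNReal.ofReal (rate lam n) * callProb (adjacentCalls d e w) ≤
      ENNReal.ofReal (4 * lam * d) := by
  induction e with | _ u v
  have h1 : adjacentCalls d s(u, v) w ⊆ {c : Call n d | u ∈ c.ends ∧ w ∈ c.cands} ∪
      {c : Call n d | v ∈ c.ends ∧ w ∈ c.cands} := by
    rintro c ⟨⟨x, hx, hxc⟩, hw⟩
    rcases Sym2.mem_iff.1 hx with rfl | rfl
    · exact Or.inl ⟨hxc, hw⟩
    · exact Or.inr ⟨hxc, hw⟩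
  calc _ ≤ ENNReal.ofReal (rate lam n) * (callProb {c : Call n d | u ∈ c.ends ∧ w ∈ c.cands} +
        callProb {c : Call n d | v ∈ c.ends ∧ w ∈ c.cands}) :=
        mul_le_mul' le_rfl ((callProb_mono h1).trans (callProb_union_le _ _))
    _ ≤ ENNReal.ofReal (2 * lam * d) + ENNReal.ofReal (2 * lam * d) := by
        rw [mul_add]
        exact add_le_add (rate_mul_callProb_incident_le hlam hn hd u w)
          (rate_mul_callProb_incident_le hlam hn hd v w)
    _ = _ := by
        rw [← ENNReal.ofReal_add (by positivity) (by positivity)]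
        congr 1
        ring

lemma callProb_singleton {n d : ℕ} (c : Call n d) :
    callProb {c} = (Fintype.card (Call n d) : ℝ≥0∞)⁻¹ := by
  simp [callProb]

/-- The arrival of the call `c` in the time interval `[s, t]`. -/
def arrivalSet {n d : ℕ} (s t : ℝ) (c : Call n d) : Set (MarkedCall n d) :=
  {x | x.1 ∈ Set.Icc s t ∧ x.2.1 = c}

lemma measurableSet_arrivalSet {n d : ℕ} (s t : ℝ) (c : Call n d) :
    MeasurableSet (arrivalSet s t c) := by
  have h1 : MeasurableSet {x : MarkedCall n d | x.1 ∈ Set.Icc s t} :=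
    measurableSet_Icc.preimage measurable_fst
  have h2 : MeasurableSet {x : MarkedCall n d | x.2.1 = c} :=
    (show MeasurableSet ({c} : Set (Call n d)) from trivial).preimage
      (f := fun x : MarkedCall n d => x.2.1) (by fun_prop)
  exact h1.inter h2

lemma intensity_arrivalSet {n d : ℕ} [IsProbabilityMeasure (markLaw n d)] (L : ℝ) {s t : ℝ}
    (hs : 0 ≤ s) (c : Call n d) :
    intensity L (markLaw n d) (arrivalSet s t c) =
      ENNReal.ofReal L * (Fintype.card (Call n d) : ℝ≥0∞)⁻¹ * ENNReal.ofReal (t - s) := by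
  have : Fact ((0 : ℝ) < 1) := ⟨one_pos⟩
  have h1 : arrivalSet s t c = {x | x.2.1 ∈ ({c} : Set (Call n d)) ∧
      (x.1, x.2.2) ∈ Set.Icc s t ×ˢ (Set.univ : Set ℝ)} := by
    ext x
    simp [arrivalSet, and_comm]
  rw [h1, intensity_eq_mul L _ (measurableSet_Icc.prod MeasurableSet.univ), callProb_singleton,
    Measure.prod_prod, measure_univ, mul_one, restrict_Ioi_eq_restrict_Ici,
    Measure.restrict_apply measurableSet_Icc]
  have h2 : Set.Icc s t ∩ Set.Ici 0 = Set.Icc s t := Set.inter_eq_left.2 fun x hx => hs.trans hx.1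
  rw [h2, Real.volume_Icc]

/-- The pairs of marked points `x`, `y` such that `y` is a call in `C` that arrives no later than
`x` and is still in progress when `x` arrives. -/
def inProgressSet {n d : ℕ} (C : Set (Call n d)) :
    Set (MarkedCall n d × MarkedCall n d) :=
  {p | p.2.2.1 ∈ C ∧ p.2.1 ≤ p.1.1 ∧ p.1.1 ≤ p.2.1 + p.2.2.2}

lemma measurableSet_inProgressSet {n d : ℕ} (C : Set (Call n d)) :
    MeasurableSet (inProgressSet C) := by
  have h1 : MeasurableSet {p : MarkedCall n d × MarkedCall n d | p.2.2.1 ∈ C} :=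
    (show MeasurableSet C from trivial).preimage
      (f := fun p : MarkedCall n d × MarkedCall n d => p.2.2.1) (by fun_prop)
  have h2 : MeasurableSet {p : MarkedCall n d × MarkedCall n d | p.2.1 ≤ p.1.1} :=
    measurableSet_le (by fun_prop) (by fun_prop)
  have h3 : MeasurableSet {p : MarkedCall n d × MarkedCall n d |
      p.1.1 ≤ p.2.1 + p.2.2.2} := measurableSet_le (by fun_prop) (by fun_prop)
  exact h1.inter (h2.inter h3)

lemma intensity_inProgressSet_le {n d : ℕ} [IsProbabilityMeasure (markLaw n d)] (L : ℝ)
    (C : Set (Call n d)) (x : MarkedCall n d) :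
    intensity L (markLaw n d) (Prod.mk x ⁻¹' inProgressSet C) ≤ ENNReal.ofReal L * callProb C := by
  have h := intensity_eq_mul L C (measurableSet_inProgress x.1 x.1)
  refine (le_of_eq h).trans ((mul_le_mul' le_rfl (prod_inProgress_le le_rfl)).trans ?_)
  simp

namespace Input

variable {Ω : Type*} [MeasurableSpace Ω] {μ : Measure Ω} {lam : ℝ} {n d : ℕ}

/-- The patterns formed by an arrival of the call `c` in the time interval `[s, t]` and, for
each of its candidates `w`, a list of `D` calls in progress that might use a link from an end node
of `c` to `w`. -/
abbrev blockings (S : Input μ lam n d) (D : ℕ) (s t : ℝ) (c : Call n d) (ω : Ω) :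
    Set (Option (c.cands × Fin D) ↪ ℕ) :=
  S.patternSet (arrivalSet s t c) (fun a => inProgressSet (adjacentCalls d c.ends a.1)) ω

lemma measurable_encard_blockings (S : Input μ lam n d) (D : ℕ) (s t : ℝ) (c : Call n d) :
    Measurable fun ω => (((S.blockings D s t c ω).encard : ℕ∞) : ℝ≥0∞) :=
  S.measurable_encard_patternSet (measurableSet_arrivalSet s t c)
    fun _ => measurableSet_inProgressSet _

lemma lintegral_encard_blockings_le [IsProbabilityMeasure μ] (S : Input μ lam n d) (hlam : 0 < lam)
    (hn : 3 ≤ n) (hd : 0 < d) (D : ℕ) {s t : ℝ} (hs : 0 ≤ s) (c : Call n d) :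
    ∫⁻ ω, (((S.blockings D s t c ω).encard : ℕ∞) : ℝ≥0∞) ∂μ ≤
      ENNReal.ofReal (rate lam n) * (Fintype.card (Call n d) : ℝ≥0∞)⁻¹ * ENNReal.ofReal (t - s) *
        (ENNReal.ofReal (4 * lam * d) ^ D) ^ c.cands.card := by
  have := S.isProbabilityMeasure_markLaw
  have : Fact (0 < rate lam n) :=
    ⟨mul_pos hlam (by exact_mod_cast Nat.choose_pos (by omega : 2 ≤ n))⟩
  refine (S.lintegral_encard_patternSet_le (measurableSet_arrivalSet s t c)
    (fun _ => measurableSet_inProgressSet _) (h := fun _ => ENNReal.ofReal (4 * lam * d))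
    fun x _ a => (intensity_inProgressSet_le _ _ x).trans
      (rate_mul_callProb_adjacentCalls_le hlam hn hd _ _)).trans (le_of_eq ?_)
  rw [intensity_arrivalSet _ hs]
  simp only [Finset.prod_const, Finset.card_univ, Fintype.card_prod, Fintype.card_coe,
    Fintype.card_fin]
  rw [← pow_mul, mul_comm D]

/-- A call that is lost after the end of all initial calls is the distinguished call of at least
`(D!) ^ k` blocking patterns. -/
lemma encard_lost_mul_factorial_le_blockings {S : Input μ lam n d}
    {choice : ℕ → Ω → Option (Fin d)}
    {D : ℕ} {s t : ℝ} {ω : Ω} (hgap : ∀ i, 0 ≤ S.gap i ω)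
    (hlost : ∀ j, choice j ω = none → ∀ m,
      ¬ (S.loadBefore choice j ω).Available D ((S.call j ω).route m)) (c : Call n d) :
    {j | S.arrival j ω ∈ Set.Icc s t ∧ choice j ω = none ∧ ¬ S.InitAlive (S.arrival j ω) ω ∧
      S.call j ω = c}.encard * (D.factorial ^ c.cands.card : ℕ) ≤
        (S.blockings D s t c ω).encard := by
  rw [← Fintype.card_coe]
  refine encard_mul_factorial_le fun j hj => ?_
  obtain ⟨hj1, hj2, hj3, rfl⟩ := hj
  have h1 : ∀ w : (S.call j ω).cands, ∃ v ∈ (S.call j ω).ends,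
      D ≤ (S.linkCalls choice j ω v w).card := by
    rintro ⟨w, hw⟩
    obtain ⟨m, rfl⟩ := Call.mem_cands.1 hw
    have := hlost j hj2 m
    simp only [LoadVector.Available, not_forall, not_lt] at this
    obtain ⟨v, hv, h⟩ := this
    rw [link_loadBefore hj3] at h
    exact ⟨v, hv, h⟩
  choose v hv hD using h1
  obtain ⟨b, hb1, hb2⟩ := exists_embedding_of_le_card (j := j) hD (by
      intro w w' i hi hi'
      obtain ⟨_, _, m, hm, _, h⟩ := mem_linkCalls.1 hi
      obtain ⟨_, _, m', hm', _, h'⟩ := mem_linkCalls.1 hi'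
      rw [hm, Option.some.injEq] at hm'
      subst hm'
      exact Subtype.ext (h.symm.trans h'))
    (fun w hj => absurd (mem_linkCalls.1 hj).1 (lt_irrefl j))
  refine ⟨b, hb1, fun σ => ⟨?_, ?_⟩⟩
  · rw [permEmbedding_none, hb1]
    exact ⟨hj1, rfl⟩
  · rintro ⟨w, l⟩
    rw [permEmbedding_none, hb1, permEmbedding_some]
    obtain ⟨h1, h2, m, _, h3, h4⟩ := mem_linkCalls.1 (hb2 w (σ w l))
    exact ⟨⟨⟨v w, hv w, h3⟩, Call.mem_cands.2 ⟨m, h4⟩⟩, arrival_mono hgap h1.le, h2⟩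

/-- The two terms are the mean number of calls that meet an initial call, and the mean number of
blocking patterns divided by `(D!) ^ k` and summed over the types of calls. -/
theorem meanLost_le [IsProbabilityMeasure μ] (S : Input μ lam n d) (hlam : 0 < lam) (hn : 3 ≤ n)
    (hd : 0 < d) {D : ℕ} {choice : ℕ → Ω → Option (Fin d)} (hS : S.IsGDAR D choice)
    (hint : Integrable (fun ω => ((S.init ω).total : ℝ)) μ) {s t : ℝ} (hs : 0 ≤ s) (hst : s ≤ t)
    {q : ℝ} (hq : q = (4 * lam * d) ^ D / (D.factorial : ℝ)) :
    S.meanLost choice s t ≤ ENNReal.ofReal (rate lam n * S.meanInit * Real.exp (-s)) +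
      ENNReal.ofReal (rate lam n * (t - s) * (q * (q + d / (n - 2 : ℕ)) ^ (d - 1))) := by
  have hr : 0 < rate lam n :=
    mul_pos hlam (by exact_mod_cast Nat.choose_pos (by omega : 2 ≤ n))
  have : Fact (0 < rate lam n) := ⟨hr⟩
  have hq0 : 0 ≤ q := by rw [hq]; positivity
  have hD : (D.factorial : ℝ≥0∞) ≠ 0 := by exact_mod_cast D.factorial_ne_zero
  have hD' : (D.factorial : ℝ≥0∞) ≠ ∞ := ENNReal.natCast_ne_top _
  have h1 : ∀ᵐ ω ∂μ, (({j : ℕ | S.arrival j ω ∈ Set.Icc s t ∧ choice j ω = none}.encard : ℕ∞) :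
      ℝ≥0∞) ≤ ∑ c : Call n d,
        (((S.blockings D s t c ω).encard : ℕ∞) : ℝ≥0∞) * ((D.factorial : ℝ≥0∞) ^ c.cands.card)⁻¹ +
        ∑' j, {ω | s ≤ S.arrival j ω ∧ S.InitAlive (S.arrival j ω) ω}.indicator 1 ω := by
    filter_upwards [S.ae_gap_nonneg, hS.lost] with ω hgap hlost
    have h2 : ∀ c : Call n d, ∑' j, {j | S.arrival j ω ∈ Set.Icc s t ∧ choice j ω = none ∧
        ¬ S.InitAlive (S.arrival j ω) ω ∧ S.call j ω = c}.indicator (1 : ℕ → ℝ≥0∞) j ≤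
          (((S.blockings D s t c ω).encard : ℕ∞) : ℝ≥0∞) *
            ((D.factorial : ℝ≥0∞) ^ c.cands.card)⁻¹ := by
      intro c
      rw [tsum_indicator_eq_encard, ← div_eq_mul_inv,
        ENNReal.le_div_iff_mul_le (Or.inl (pow_ne_zero _ hD)) (Or.inl (ENNReal.pow_ne_top hD'))]
      have h3 := ENat.toENNReal_mono
        (encard_lost_mul_factorial_le_blockings (s := s) (t := t) hgap hlost c)
      rw [ENat.toENNReal_mul] at h3
      refine le_trans (le_of_eq ?_) h3
      push_cast
      rfl
    refine le_trans ?_ (add_le_add (Finset.sum_le_sum fun c _ => h2 c) le_rfl)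
    rw [← tsum_indicator_eq_encard, ← Summable.tsum_finsetSum fun _ _ => ENNReal.summable,
      ← ENNReal.tsum_add]
    refine ENNReal.tsum_le_tsum fun j => ?_
    refine Set.indicator_apply_le' ?_ fun _ => bot_le
    rintro ⟨hj1, hj2⟩
    rw [Pi.one_apply]
    by_cases hal : S.InitAlive (S.arrival j ω) ω
    · refine le_add_left ?_
      rw [Set.indicator_of_mem (by exact ⟨hj1.1, hal⟩)]
      exact le_rfl
    · refine le_add_right ?_
      refine le_trans ?_ (Finset.single_le_sum (fun _ _ => zero_le)
        (Finset.mem_univ (S.call j ω)))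
      rw [Set.indicator_of_mem (by exact ⟨hj1, hj2, hal, rfl⟩)]
      exact le_rfl
  rw [meanLost, add_comm]
  refine (lintegral_mono_ae h1).trans ?_
  rw [lintegral_add_left (Finset.measurable_fun_sum _ fun c _ =>
    (S.measurable_encard_blockings D s t c).mul_const _)]
  refine add_le_add ?_ (S.lintegral_initAlive_arrival_le hint hs)
  rw [lintegral_finsetSum _ fun c _ => (S.measurable_encard_blockings D s t c).mul_const _]
  have hN : (0 : ℝ) < Fintype.card (Call n d) := by
    rw [card_call]
    exact_mod_cast Nat.mul_pos (Nat.choose_pos (by omega)) (pow_pos (by omega) _)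
  have h3 : ∀ c : Call n d, ∫⁻ ω, (((S.blockings D s t c ω).encard : ℕ∞) : ℝ≥0∞) *
      ((D.factorial : ℝ≥0∞) ^ c.cands.card)⁻¹ ∂μ ≤
        ENNReal.ofReal (rate lam n * (t - s) / Fintype.card (Call n d) * q ^ c.cands.card) := by
    intro c
    rw [lintegral_mul_const _ (S.measurable_encard_blockings D s t c)]
    refine (mul_le_mul' (S.lintegral_encard_blockings_le hlam hn hd D hs c) le_rfl).trans
      (le_of_eq ?_)
    rw [ENNReal.ofReal_mul (p := rate lam n * (t - s) / Fintype.card (Call n d))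
        (by have := sub_nonneg.2 hst; positivity),
      ENNReal.ofReal_pow hq0, hq, ENNReal.ofReal_div_of_pos hN, ENNReal.ofReal_natCast,
      ENNReal.ofReal_div_of_pos (by positivity), ENNReal.ofReal_natCast,
      ENNReal.ofReal_pow (by positivity),
      ENNReal.ofReal_mul hr.le, div_eq_mul_inv, div_eq_mul_inv, mul_pow, ENNReal.inv_pow]
    ring
  refine (Finset.sum_le_sum fun c _ => h3 c).trans ?_
  rw [← ENNReal.ofReal_sum_of_nonneg fun c _ => by
    have := sub_nonneg.2 hst; positivity]
  refine ENNReal.ofReal_le_ofReal ?_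
  rw [← Finset.mul_sum]
  have h4 := sum_call_pow_cands_le (n := n) hd hq0
  have hst' := sub_nonneg.2 hst
  refine (mul_le_mul_of_nonneg_left h4 (by positivity)).trans (le_of_eq ?_)
  have h5 : (0 : ℝ) < (n - 2 : ℕ) := by
    have : 0 < n - 2 := by omega
    exact_mod_cast this
  have h6 : (0 : ℝ) < n.choose 2 := by exact_mod_cast Nat.choose_pos (by omega : 2 ≤ n)
  rw [card_call]
  obtain ⟨d, rfl⟩ : ∃ d', d = d' + 1 := ⟨d - 1, by omega⟩
  have h7 : ((n - 2 : ℕ) * q + (d + 1 : ℕ) : ℝ) =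
      (n - 2 : ℕ) * (q + (d + 1 : ℕ) / (n - 2 : ℕ)) := by
    field_simp
  rw [h7, mul_pow]
  push_cast
  field_simp
  ring

end Input

/-! ### Asymptotics of the capacity -/

section Asymptotics

open Topology

variable {α : ℝ} {D : ℕ → ℕ}

lemma tendsto_log_natCast : Tendsto (fun n : ℕ => Real.log n) atTop atTop :=
  Real.tendsto_log_atTop.comp tendsto_natCast_atTop_atTop

lemma tendsto_capacity_mul_div (hα : 0 < α) (hD : (fun n : ℕ => (D n : ℝ)) ~[atTop]
    (fun n : ℕ => α * (Real.log n / Real.log (Real.log n)))) :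
    Tendsto (fun n : ℕ => (D n : ℝ) * Real.log (Real.log n) / Real.log n) atTop (𝓝 α) := by
  have h1 : ∀ᶠ n : ℕ in atTop, 0 < Real.log n := tendsto_log_natCast.eventually_gt_atTop 0
  have h2 : ∀ᶠ n : ℕ in atTop, 0 < Real.log (Real.log n) :=
    (Real.tendsto_log_atTop.comp tendsto_log_natCast).eventually_gt_atTop 0
  have h3 : ∀ᶠ n : ℕ in atTop, α * (Real.log n / Real.log (Real.log n)) ≠ 0 := by
    filter_upwards [h1, h2] with n h1 h2
    positivity
  have h4 := ((isEquivalent_iff_tendsto_one h3).1 hD).const_mul α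
  rw [mul_one] at h4
  refine h4.congr' ?_
  filter_upwards [h1, h2] with n h1 h2
  simp only [Pi.div_apply]
  field_simp

lemma tendsto_capacity_div (hα : 0 < α) (hD : (fun n : ℕ => (D n : ℝ)) ~[atTop]
    (fun n : ℕ => α * (Real.log n / Real.log (Real.log n)))) :
    Tendsto (fun n : ℕ => (D n : ℝ) / Real.log n) atTop (𝓝 0) := by
  have h2 := Real.tendsto_log_atTop.comp tendsto_log_natCast
  have h := (tendsto_capacity_mul_div hα hD).div_atTop h2
  refine h.congr' ?_
  filter_upwards [h2.eventually_gt_atTop 0] with n h2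
  simp only [Function.comp_apply] at h2 ⊢
  field_simp

/-- `D log D` is asymptotic to `α log n`. -/
lemma tendsto_capacity_mul_log_div (hα : 0 < α) (hD : (fun n : ℕ => (D n : ℝ)) ~[atTop]
    (fun n : ℕ => α * (Real.log n / Real.log (Real.log n)))) :
    Tendsto (fun n : ℕ => (D n : ℝ) * Real.log (D n) / Real.log n) atTop (𝓝 α) := by
  have h1 := tendsto_log_natCast
  have h2 := Real.tendsto_log_atTop.comp h1
  have hr := tendsto_capacity_mul_div hα hD
  have h3 : Tendsto (fun n : ℕ => Real.log ((D n : ℝ) * Real.log (Real.log n) / Real.log n) /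
      Real.log (Real.log n)) atTop (𝓝 0) :=
    ((Real.continuousAt_log hα.ne').tendsto.comp hr).div_atTop h2
  have h4 : Tendsto (fun n : ℕ => Real.log (Real.log (Real.log n)) / Real.log (Real.log n)) atTop
      (𝓝 0) := by
    have : Tendsto (fun x : ℝ => Real.log x / x) atTop (𝓝 0) :=
      Real.isLittleO_log_id_atTop.tendsto_div_nhds_zero
    exact this.comp h2
  have h5 := hr.mul ((h3.sub h4).add_const 1)
  rw [sub_zero, zero_add, mul_one] at h5
  refine h5.congr' ?_
  filter_upwards [h1.eventually_gt_atTop 0, h2.eventually_gt_atTop 0, hr.eventually_const_lt hα]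
    with n h1 h2 h3
  simp only [Function.comp_apply] at h2
  have hDn : (0 : ℝ) < D n := by
    by_contra h
    have : (D n : ℝ) = 0 := le_antisymm (not_lt.1 h) (Nat.cast_nonneg _)
    rw [this] at h3
    simp at h3
  rw [Real.log_div (by positivity) (by positivity), Real.log_mul (by positivity) (by positivity)]
  field_simp
  ring

lemma tendsto_capacity (hα : 0 < α) (hD : (fun n : ℕ => (D n : ℝ)) ~[atTop]
    (fun n : ℕ => α * (Real.log n / Real.log (Real.log n)))) : Tendsto D atTop atTop := by
  have h1 := tendsto_log_natCast
  have h2 : Tendsto (fun x : ℝ => x / Real.log x) atTop atTop := by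
    have h0 : Tendsto (fun x : ℝ => Real.log x / x) atTop (𝓝[>] 0) := by
      refine tendsto_nhdsWithin_iff.2 ⟨Real.isLittleO_log_id_atTop.tendsto_div_nhds_zero, ?_⟩
      filter_upwards [eventually_gt_atTop 1] with x hx
      exact div_pos (Real.log_pos hx) (by linarith)
    refine h0.inv_tendsto_nhdsGT_zero.congr fun x => ?_
    simp
  exact tendsto_natCast_atTop_iff.1 (hD.symm.tendsto_atTop ((h2.comp h1).const_mul_atTop hα))

/-- A Poisson probability at the capacity is at least `n ^ (-α - o(1))`. -/
lemma eventually_rpow_le_pow_div_factorial (hα : 0 < α) (hD : (fun n : ℕ => (D n : ℝ)) ~[atTop]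
    (fun n : ℕ => α * (Real.log n / Real.log (Real.log n)))) {α' β : ℝ} (hα' : α < α')
    (hβ : 0 < β) :
    ∀ᶠ n : ℕ in atTop, (n : ℝ) ^ (-α') ≤ β ^ D n / ((D n).factorial : ℝ) := by
  have h := (tendsto_capacity_mul_log_div hα hD).sub
    ((tendsto_capacity_div hα hD).const_mul (Real.log β))
  rw [mul_zero, sub_zero] at h
  filter_upwards [h.eventually_lt_const hα', tendsto_log_natCast.eventually_gt_atTop 0,
    eventually_gt_atTop 0, (tendsto_capacity hα hD).eventually_gt_atTop 0] with n h hl hn hDn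
  have hn' : (0 : ℝ) < n := by exact_mod_cast hn
  have hDn' : (0 : ℝ) < D n := by exact_mod_cast hDn
  have h1 : ((D n).factorial : ℝ) ≤ (D n : ℝ) ^ D n := by exact_mod_cast Nat.factorial_le_pow _
  have h2 : β ^ D n / (D n : ℝ) ^ D n ≤ β ^ D n / ((D n).factorial : ℝ) := by gcongr
  refine le_trans ?_ h2
  rw [← Real.log_le_log_iff (by positivity) (by positivity), Real.log_rpow hn',
    Real.log_div (by positivity) (by positivity), Real.log_pow, Real.log_pow]
  rw [mul_div_assoc', ← sub_div, div_lt_iff₀ hl] at h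
  linarith

/-- A Poisson probability at the capacity is at most `n ^ (-α + o(1))`. -/
lemma eventually_pow_div_factorial_le_rpow (hα : 0 < α) (hD : (fun n : ℕ => (D n : ℝ)) ~[atTop]
    (fun n : ℕ => α * (Real.log n / Real.log (Real.log n)))) {α' m : ℝ} (hα' : α' < α)
    (hm : 0 < m) :
    ∀ᶠ n : ℕ in atTop, m ^ D n / ((D n).factorial : ℝ) ≤ (n : ℝ) ^ (-α') := by
  have h := (tendsto_capacity_mul_log_div hα hD).sub
    ((tendsto_capacity_div hα hD).const_mul (1 + Real.log m))
  rw [mul_zero, sub_zero] at h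
  filter_upwards [h.eventually_const_lt hα', tendsto_log_natCast.eventually_gt_atTop 0,
    eventually_gt_atTop 0, (tendsto_capacity hα hD).eventually_gt_atTop 0] with n h hl hn hDn
  have hn' : (0 : ℝ) < n := by exact_mod_cast hn
  have hDn' : (0 : ℝ) < D n := by exact_mod_cast hDn
  have h1 : (D n : ℝ) ^ D n / ((D n).factorial : ℝ) ≤ Real.exp (D n) :=
    Real.pow_div_factorial_le_exp _ hDn'.le _
  have h2 : m ^ D n / ((D n).factorial : ℝ) ≤ m ^ D n / (D n : ℝ) ^ D n * Real.exp (D n) := by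
    refine le_trans (le_of_eq ?_) (mul_le_mul_of_nonneg_left h1 (by positivity))
    field_simp
  refine h2.trans ?_
  rw [← Real.log_le_log_iff (by positivity) (by positivity), Real.log_rpow hn',
    Real.log_mul (by positivity) (by positivity),
    Real.log_div (by positivity) (by positivity), Real.log_pow, Real.log_pow, Real.log_exp]
  rw [mul_div_assoc', ← sub_div, lt_div_iff₀ hl] at h
  linarith

lemma tendsto_natCast_rpow_neg {x : ℝ} (hx : x < 0) :
    Tendsto (fun n : ℕ => (n : ℝ) ^ x) atTop (𝓝 0) := by
  have := (tendsto_rpow_neg_atTop (neg_pos.2 hx)).comp tendsto_natCast_atTop_atTop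
  simpa [Function.comp_def] using this

lemma add_pow_le_two_pow_mul {a b : ℝ} (ha : 0 ≤ a) (hb : 0 ≤ b) (k : ℕ) :
    (a + b) ^ k ≤ 2 ^ k * (a ^ k + b ^ k) := by
  rcases le_total a b with h | h
  · calc (a + b) ^ k ≤ (2 * b) ^ k := by gcongr; linarith
      _ ≤ _ := by rw [mul_pow]; gcongr; linarith [pow_nonneg ha k]
  · calc (a + b) ^ k ≤ (2 * a) ^ k := by gcongr; linarith
      _ ≤ _ := by rw [mul_pow]; gcongr; linarith [pow_nonneg hb k]

/-- The factor with the exponent `d - 1` is dominated by either of its two terms, which leads to the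
exponents `K + 2 - d α` and `K + 3 - d - α` of `n`. -/
lemma eventually_upper_bound_le {lam K : ℝ} (hlam : 0 < lam) {d : ℕ} (hd : 0 < d) (hα : 0 < α)
    (hD : (fun n : ℕ => (D n : ℝ)) ~[atTop]
      (fun n : ℕ => α * (Real.log n / Real.log (Real.log n))))
    (h1 : (K + 2) / d < α) (h2 : K + 3 - d < α) {δ : ℝ} (hδ : 0 < δ) :
    ∀ᶠ n : ℕ in atTop, rate lam n * (n : ℝ) ^ K *
      ((4 * lam * d) ^ D n / ((D n).factorial : ℝ) *
        ((4 * lam * d) ^ D n / ((D n).factorial : ℝ) + d / (n - 2 : ℕ)) ^ (d - 1)) ≤ δ := by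
  obtain ⟨α', h3, h4⟩ := exists_between (max_lt h1 h2)
  have hd' : (0 : ℝ) < d := by exact_mod_cast hd
  have h5 : K + 2 - d * α' < 0 := by
    have := (le_max_left _ _).trans_lt h3
    rw [div_lt_iff₀ hd'] at this
    linarith
  have h6 : K + 3 - d - α' < 0 := by
    have := (le_max_right _ _).trans_lt h3
    linarith
  have hlim : Tendsto (fun n : ℕ => lam * 2 ^ (d - 1) * (n : ℝ) ^ (K + 2 - d * α') +
      lam * 2 ^ (d - 1) * (3 * d) ^ (d - 1) * (n : ℝ) ^ (K + 3 - d - α')) atTop (𝓝 0) := by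
    have := ((tendsto_natCast_rpow_neg h5).const_mul (lam * 2 ^ (d - 1))).add
      ((tendsto_natCast_rpow_neg h6).const_mul (lam * 2 ^ (d - 1) * (3 * d) ^ (d - 1)))
    simpa using this
  filter_upwards [eventually_pow_div_factorial_le_rpow hα hD h4 (m := 4 * lam * d) (by positivity),
    eventually_ge_atTop 3, hlim.eventually_lt_const hδ] with n hq hn hlt
  refine le_trans ?_ hlt.le
  have hn' : (0 : ℝ) < n := by
    have : 0 < n := by omega
    exact_mod_cast this
  have hr : rate lam n ≤ lam * (n : ℝ) ^ (2 : ℝ) := by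
    rw [rate]
    have : (n.choose 2 : ℝ) ≤ (n : ℝ) ^ 2 := by exact_mod_cast Nat.choose_le_pow n 2
    have h : (n : ℝ) ^ (2 : ℝ) = (n : ℝ) ^ 2 := by exact_mod_cast Real.rpow_natCast (n : ℝ) 2
    rw [h]
    exact mul_le_mul_of_nonneg_left this hlam.le
  have hdn : (d : ℝ) / (n - 2 : ℕ) ≤ 3 * d / n := by
    have h0 : (0 : ℝ) < (n - 2 : ℕ) := by
      have : 0 < n - 2 := by omega
      exact_mod_cast this
    have h0' : (n : ℝ) ≤ 3 * (n - 2 : ℕ) := by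
      have : n ≤ 3 * (n - 2) := by omega
      exact_mod_cast this
    rw [div_le_div_iff₀ h0 hn']
    nlinarith
  set q := (4 * lam * d) ^ D n / ((D n).factorial : ℝ) with hqdef
  have hq0 : 0 ≤ q := by positivity
  have e1 : (n : ℝ) ^ (2 : ℝ) * (n : ℝ) ^ K * (n : ℝ) ^ (-α') * ((n : ℝ) ^ (-α')) ^ (d - 1) =
      (n : ℝ) ^ (K + 2 - d * α') := by
    rw [← Real.rpow_natCast ((n : ℝ) ^ (-α')), ← Real.rpow_mul hn'.le, ← Real.rpow_add hn',
      ← Real.rpow_add hn', ← Real.rpow_add hn']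
    congr 1
    rw [Nat.cast_sub hd]
    push_cast
    ring
  have e2 : (n : ℝ) ^ (2 : ℝ) * (n : ℝ) ^ K * (n : ℝ) ^ (-α') * (1 / n) ^ (d - 1) =
      (n : ℝ) ^ (K + 3 - d - α') := by
    rw [one_div, ← Real.rpow_neg_one, ← Real.rpow_natCast ((n : ℝ) ^ (-1 : ℝ)),
      ← Real.rpow_mul hn'.le, ← Real.rpow_add hn', ← Real.rpow_add hn', ← Real.rpow_add hn']
    congr 1
    rw [Nat.cast_sub hd]
    push_cast
    ring
  have hr0 : 0 ≤ rate lam n := by unfold rate; positivity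
  calc _ ≤ lam * (n : ℝ) ^ (2 : ℝ) * (n : ℝ) ^ K * ((n : ℝ) ^ (-α') *
        (2 ^ (d - 1) * (((n : ℝ) ^ (-α')) ^ (d - 1) + (3 * d / n) ^ (d - 1)))) := by
        have h7 : (q + d / (n - 2 : ℕ)) ^ (d - 1) ≤
            2 ^ (d - 1) * (((n : ℝ) ^ (-α')) ^ (d - 1) + (3 * d / n) ^ (d - 1)) := by
          refine le_trans ?_ (add_pow_le_two_pow_mul (by positivity) (by positivity) _)
          gcongr
        gcongr
    _ = lam * 2 ^ (d - 1) * ((n : ℝ) ^ (2 : ℝ) * (n : ℝ) ^ K * (n : ℝ) ^ (-α') *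
          ((n : ℝ) ^ (-α')) ^ (d - 1)) + lam * 2 ^ (d - 1) * (3 * d) ^ (d - 1) *
            ((n : ℝ) ^ (2 : ℝ) * (n : ℝ) ^ K * (n : ℝ) ^ (-α') * (1 / n) ^ (d - 1)) := by
        rw [div_eq_mul_one_div (3 * (d : ℝ)) (n : ℝ), mul_pow (3 * (d : ℝ)) (1 / (n : ℝ))]
        ring
    _ = _ := by rw [e1, e2]

end Asymptotics

/-- Whatever is left of the initial calls at time `log (M + 1) + 3 log n` is negligible. -/
lemma initial_bound_le {lam M t₁ : ℝ} (hlam : 0 < lam) (hM : 0 ≤ M) {n : ℕ} (hn : 0 < n)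
    (ht : t₁ ≥ Real.log (M + 1) + 3 * Real.log n) :
    M * Real.exp (-t₁) ≤ 1 / (n : ℝ) ^ 3 ∧ rate lam n * M * Real.exp (-t₁) ≤ lam / n := by
  have hn' : (0 : ℝ) < n := by exact_mod_cast hn
  have h1 : M * Real.exp (-t₁) ≤ 1 / (n : ℝ) ^ 3 := by
    have h2 : Real.exp (-t₁) ≤ 1 / ((M + 1) * (n : ℝ) ^ 3) := by
      calc Real.exp (-t₁) ≤ Real.exp (-(Real.log (M + 1) + 3 * Real.log n)) :=
            Real.exp_le_exp.2 (by linarith)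
        _ = _ := by
            rw [Real.exp_neg, Real.exp_add, Real.exp_log (by linarith), one_div,
              show 3 * Real.log n = Real.log ((n : ℝ) ^ 3) by simp, Real.exp_log (by positivity)]
    calc M * Real.exp (-t₁) ≤ (M + 1) * (1 / ((M + 1) * (n : ℝ) ^ 3)) := by gcongr; linarith
      _ = _ := by field_simp
  refine ⟨h1, ?_⟩
  have hr : rate lam n ≤ lam * (n : ℝ) ^ 2 := by
    rw [rate]
    have : (n.choose 2 : ℝ) ≤ (n : ℝ) ^ 2 := by exact_mod_cast Nat.choose_le_pow n 2
    exact mul_le_mul_of_nonneg_left this hlam.le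
  calc _ = rate lam n * (M * Real.exp (-t₁)) := by ring
    _ ≤ lam * (n : ℝ) ^ 2 * (1 / (n : ℝ) ^ 3) := by gcongr
    _ = _ := by field_simp

/-! ### The upper bound for large networks -/

lemma nonneg_of_ge_log_add {M t₁ : ℝ} (hM : 0 ≤ M) {n : ℕ} (hn : 0 < n)
    (ht : t₁ ≥ Real.log (M + 1) + 3 * Real.log n) : Real.log n ≤ t₁ ∧ 0 ≤ t₁ := by
  have h1 : 0 ≤ Real.log (M + 1) := Real.log_nonneg (by linarith)
  have h2 : 0 ≤ Real.log n := Real.log_nonneg (by exact_mod_cast hn)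
  constructor <;> linarith

/-- Both orders of magnitude in the upper bound are negligible, whichever of them dominates. -/
lemma capacity_conditions {K α : ℝ} {d : ℕ} (hd : 0 < d)
    (h1 : K < (d : ℝ) - 2 → α > (K + 2) / d) (h2 : K ≥ (d : ℝ) - 2 → α > K + 3 - d) :
    (K + 2) / d < α ∧ K + 3 - d < α := by
  have hd' : (1 : ℝ) ≤ d := by exact_mod_cast hd
  rcases lt_or_ge K ((d : ℝ) - 2) with h | h
  · refine ⟨h1 h, lt_of_le_of_lt ?_ (h1 h)⟩
    rw [le_div_iff₀ (by linarith)]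
    nlinarith
  · refine ⟨?_, h2 h⟩
    have := h2 h
    rw [div_lt_iff₀ (by linarith)]
    nlinarith

lemma Input.meanInit_nonneg {Ω : Type*} [MeasurableSpace Ω] {μ : Measure Ω} {lam : ℝ} {n d : ℕ}
    (S : Input μ lam n d) : 0 ≤ S.meanInit := integral_nonneg fun ω => by positivity

theorem eventually_meanLost_le {lam : ℝ} (hlam : 0 < lam) {d : ℕ} (hd : 0 < d) {K α : ℝ}
    (hα : 0 < α) {D : ℕ → ℕ} (hD : (fun n : ℕ => (D n : ℝ)) ~[atTop]
      (fun n : ℕ => α * (Real.log n / Real.log (Real.log n))))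
    (h1 : (K + 2) / d < α) (h2 : K + 3 - d < α) {δ : ℝ} (hδ : 0 < δ) :
    ∀ᶠ n : ℕ in atTop, ∀ (Ω : Type*) [MeasurableSpace Ω] (μ : Measure Ω) [IsProbabilityMeasure μ]
      (S : Input μ lam n d) (choice : ℕ → Ω → Option (Fin d)), S.IsGDAR (D n) choice →
        Integrable (fun ω => ((S.init ω).total : ℝ)) μ →
          ∀ t₁ : ℝ, t₁ ≥ Real.log (S.meanInit + 1) + 3 * Real.log n →
            S.meanLost choice t₁ (t₁ + (n : ℝ) ^ K) ≤ ENNReal.ofReal δ := by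
  have hlim : Tendsto (fun n : ℕ => lam / (n : ℝ)) atTop (nhds 0) :=
    tendsto_const_nhds.div_atTop tendsto_natCast_atTop_atTop
  filter_upwards [eventually_upper_bound_le hlam hd hα hD h1 h2 (half_pos hδ),
    eventually_ge_atTop 3, hlim.eventually_lt_const (half_pos hδ)]
    with n hn1 hn hn2 Ω _ μ _ S choice hS hint t₁ ht
  have hn0 : 0 < n := by omega
  have ht0 := (nonneg_of_ge_log_add S.meanInit_nonneg hn0 ht).2
  have hK : (0 : ℝ) ≤ (n : ℝ) ^ K := by positivity
  refine (S.meanLost_le hlam hn hd hS hint ht0 (by linarith) rfl).trans ?_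
  have e := (initial_bound_le hlam S.meanInit_nonneg hn0 ht).2
  rw [add_sub_cancel_left]
  calc _ ≤ ENNReal.ofReal (δ / 2) + ENNReal.ofReal (δ / 2) :=
        add_le_add (ENNReal.ofReal_le_ofReal (e.trans hn2.le)) (ENNReal.ofReal_le_ofReal hn1)
    _ = _ := by rw [← ENNReal.ofReal_add (by linarith) (by linarith), add_halves]

/-! ### Extensions of patterns -/

namespace Input

variable {Ω : Type*} [MeasurableSpace Ω] {μ : Measure Ω} {lam : ℝ} {n d : ℕ} {ι : Type*}

/-- The further calls that stand in the relation `H` to the distinguished call of `b`. -/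
def extras (S : Input μ lam n d) (H : Set (MarkedCall n d × MarkedCall n d)) (ω : Ω)
    (b : Option ι ↪ ℕ) : Set ℕ :=
  {i | i ∉ Set.range b ∧ (S.point (b none) ω, S.point i ω) ∈ H}

/-- Patterns with at least `D` extra calls give rise to many extended patterns: each list of `r` of
these calls extends the pattern. -/
lemma encard_crowded_mul_le (S : Input μ lam n d) (A : Set (MarkedCall n d))
    (B : ι → Set (MarkedCall n d × MarkedCall n d))
    (H : Set (MarkedCall n d × MarkedCall n d)) (D r : ℕ) (ω : Ω) :
    {b ∈ S.patternSet A B ω | (D : ℕ∞) ≤ (S.extras H ω b).encard}.encard *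
      (D.descFactorial r : ℕ) ≤
        (S.patternSet A (Sum.elim B fun _ : Fin r => H) ω).encard := by
  set Z := {b ∈ S.patternSet A B ω | (D : ℕ∞) ≤ (S.extras H ω b).encard}
  have h1 : ∀ b : Z, ∃ f : Fin D → ℕ, Function.Injective f ∧ ∀ x, f x ∈ S.extras H ω b.1 := by
    intro b
    obtain ⟨t, hts, ht⟩ := Set.exists_subset_encard_eq b.2.2
    have hf : t.Finite := Set.finite_of_encard_eq_coe ht
    have := hf.to_subtype
    have hc : Nat.card t = D := by
      rw [Nat.card_coe_set_eq, Set.ncard, ht, ENat.toNat_natCast]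
    let e := Finite.equivFinOfCardEq hc
    exact ⟨fun x => (e.symm x).1, Subtype.val_injective.comp e.symm.injective,
      fun x => hts (e.symm x).2⟩
  choose f hf1 hf2 using h1
  let φ : Z × (Fin r ↪ Fin D) → S.patternSet A (Sum.elim B fun _ : Fin r => H) ω := fun p =>
    ⟨⟨fun o => o.elim (p.1.1 none) (Sum.elim (fun a => p.1.1 (some a)) fun x => f p.1 (p.2 x)), by
      have hn : ∀ x o, p.1.1 o ≠ f p.1 (p.2 x) := fun x o h => (hf2 p.1 (p.2 x)).1 ⟨o, h⟩
      rintro (_ | a | x) (_ | a' | x') h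
      · rfl
      · exact absurd (p.1.1.injective h) (by simp)
      · exact absurd h (hn _ _)
      · exact absurd (p.1.1.injective h) (by simp)
      · exact congrArg (fun o : Option ι => o.map (Sum.inl : ι → ι ⊕ Fin r)) (p.1.1.injective h)
      · exact absurd h (hn _ _)
      · exact absurd h.symm (hn _ _)
      · exact absurd h.symm (hn _ _)
      · rw [p.2.injective (hf1 p.1 h)]⟩, p.1.2.1.1, by
      rintro (a | x)
      · exact p.1.2.1.2 a
      · exact (hf2 p.1 (p.2 x)).2⟩
  have hφ : Function.Injective φ := by
    rintro ⟨b, e⟩ ⟨b', e'⟩ h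
    have h2 : ∀ o, (φ (b, e)).1 o = (φ (b', e')).1 o := fun o => by rw [h]
    obtain rfl : b = b' := by
      refine Subtype.ext (DFunLike.ext _ _ ?_)
      rintro (_ | a)
      · exact h2 none
      · exact h2 (some (Sum.inl a))
    rw [Prod.mk.injEq]
    refine ⟨rfl, DFunLike.ext _ _ fun x => hf1 b (h2 (some (Sum.inr x)))⟩
  have h3 := ENat.card_le_card_of_injective hφ
  rw [ENat.card_prod] at h3
  simpa [ENat.card_coe_set_eq, Fintype.card_embedding_eq] using h3

end Input

/-! ### Configurations of calls that block a call -/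

section Relations

variable {n d : ℕ}

/-- The second call is for `{u, y}` with first candidate `w`, arrives in the time `η` before the
first call and lasts for a time at least `η`. -/
def saturatingSet (hd : 0 < d) (η : ℝ) (u y w : Fin n) : Set (MarkedCall n d × MarkedCall n d) :=
  {p | (p.2.2.1.ends = s(u, y) ∧ p.2.2.1.cand ⟨0, hd⟩ = w) ∧
    p.2.1 ∈ Set.Ico (p.1.1 - η) p.1.1 ∧ p.2.2.2 ∈ Set.Ici η}

/-- The second call has the end `u` and a candidate in `W`, and it arrives or ends in the time `η`
before the arrival of the first call. -/
def disturbingSet (η : ℝ) (u : Fin n) (W : Finset (Fin n)) :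
    Set (MarkedCall n d × MarkedCall n d) :=
  {p | (u ∈ p.2.2.1.ends ∧ ∃ w ∈ W, w ∈ p.2.2.1.cands) ∧
    (p.2.1 ∈ Set.Icc (p.1.1 - η) p.1.1 ∨ p.2.1 + p.2.2.2 ∈ Set.Icc (p.1.1 - η) p.1.1)}

/-- The second call has the end `y` and the candidate `w`, and it is in progress at some time in the
time `η` before the arrival of the first call. -/
def occupyingSet (η : ℝ) (y w : Fin n) : Set (MarkedCall n d × MarkedCall n d) :=
  {p | (y ∈ p.2.2.1.ends ∧ w ∈ p.2.2.1.cands) ∧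
    p.2.1 ≤ p.1.1 ∧ p.1.1 - η ≤ p.2.1 + p.2.2.2}

end Relations

namespace Input

variable {Ω : Type*} [MeasurableSpace Ω] {μ : Measure Ω} {lam : ℝ} {n d : ℕ}

/-- The patterns formed by a call in `A` and `D` saturating calls for each node `w` in `W`: these
are the calls for the pairs `{u, y (w, l)}`. -/
abbrev saturations (S : Input μ lam n d) (hd : 0 < d) (η : ℝ) (A : Set (MarkedCall n d)) (u : Fin n)
    (W : Finset (Fin n)) (D : ℕ) (y : W × Fin D → Fin n) (ω : Ω) : Set (Option (W × Fin D) ↪ ℕ) :=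
  S.patternSet A (fun a => saturatingSet hd η u (y a) a.1) ω

/-- The saturation patterns that are not disturbed by other calls. -/
def cleanSaturations (S : Input μ lam n d) (hd : 0 < d) (η : ℝ) (A : Set (MarkedCall n d))
    (u : Fin n) (W : Finset (Fin n)) (D : ℕ) (y : W × Fin D → Fin n) (ω : Ω) :
    Set (Option (W × Fin D) ↪ ℕ) :=
  {b ∈ S.saturations hd η A u W D y ω |
    S.extras (disturbingSet η u W) ω b = ∅ ∧
      ∀ a, (S.extras (occupyingSet η (y a) a.1) ω b).encard < D}

lemma not_initAlive_of_le {S : Input μ lam n d} {s t : ℝ} {ω : Ω} (h : ¬ S.InitAlive s ω)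
    (hst : s ≤ t) : ¬ S.InitAlive t ω :=
  fun ⟨r, k, h1, h2⟩ => h ⟨r, k, h1, hst.trans h2⟩

/-- Under the first-fit algorithm, a call that is preceded by a clean saturation pattern is lost.
For each candidate `w`, either all saturating calls for `w` are accepted on `w`, or one of them
finds the link `uw` full; as nothing else changes on the link `uw`, it is full in both cases
when the distinguished call arrives. -/
lemma choice_eq_none_of_mem_cleanSaturations {S : Input μ lam n d}
    {choice : ℕ → Ω → Option (Fin d)} {ω : Ω} {D : ℕ} {hd : 0 < d} {η t₁ t₂ : ℝ} {c : Call n d}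
    {u : Fin n} {y : c.cands × Fin D → Fin n} (hu : u ∈ c.ends)
    (hy : Function.Injective y) (hyu : ∀ a, y a ≠ u)
    (hgap : ∀ i, 0 ≤ S.gap i ω) (hinit : ¬ S.InitAlive (t₁ - η) ω)
    (havail : ∀ j m, choice j ω = some m →
      (S.loadBefore choice j ω).Available D ((S.call j ω).route m))
    (hlost : ∀ j, choice j ω = none →
      ∀ m, ¬ (S.loadBefore choice j ω).Available D ((S.call j ω).route m))
    (hfirst : ∀ j m, choice j ω = some m →
      ∀ m' < m, ¬ (S.loadBefore choice j ω).Available D ((S.call j ω).route m'))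
    {b : Option (c.cands × Fin D) ↪ ℕ}
    (hb : b ∈ S.cleanSaturations hd η (arrivalSet t₁ t₂ c) u c.cands D y ω) :
    choice (b none) ω = none := by
  obtain ⟨⟨⟨hj1, hj2⟩, hsat⟩, hE, hF⟩ := hb
  set j := b none with hj
  change S.arrival j ω ∈ Set.Icc t₁ t₂ at hj1
  change S.call j ω = c at hj2
  have lt_of_arrival : ∀ {i i'}, S.arrival i ω < S.arrival i' ω → i < i' := fun {i i'} h => by
    by_contra h'
    exact absurd (arrival_mono hgap (not_lt.1 h')) (not_le.2 h)
  have hsat' : ∀ a, ((S.call (b (some a)) ω).ends = s(u, y a) ∧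
      (S.call (b (some a)) ω).cand ⟨0, hd⟩ = a.1) ∧
      S.arrival (b (some a)) ω ∈ Set.Ico (S.arrival j ω - η) (S.arrival j ω) ∧
        η ≤ S.dur (b (some a)) ω := hsat
  have hE' : ∀ i, i ∉ Set.range b → u ∈ (S.call i ω).ends →
      (∃ w ∈ c.cands, w ∈ (S.call i ω).cands) → S.arrival i ω + S.dur i ω ∈
        Set.Icc (S.arrival j ω - η) (S.arrival j ω) → False := by
    intro i h1 h2 h3 h4
    exact Set.notMem_empty i (hE ▸ ⟨h1, ⟨h2, h3⟩, Or.inr h4⟩)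
  have hlt : ∀ a, b (some a) < j := fun a => lt_of_arrival (hsat' a).2.1.2
  have hη : ∀ a, S.arrival j ω ≤ S.arrival (b (some a)) ω + S.dur (b (some a)) ω := fun a => by
    have h1 := (hsat' a).2.1.1
    have h2 := (hsat' a).2.2
    linarith
  have hinit_j : ¬ S.InitAlive (S.arrival j ω) ω ∨ D = 0 := by
    rcases Nat.eq_zero_or_pos D with h | h
    · exact Or.inr h
    · left
      have hne : c.cands.Nonempty := ⟨c.cand ⟨0, hd⟩, Call.mem_cands.2 ⟨_, rfl⟩⟩
      obtain ⟨w, hw⟩ := hne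
      have h1 := (hsat' (⟨w, hw⟩, ⟨0, h⟩)).2.1
      refine not_initAlive_of_le hinit ?_
      have := h1.1.trans_lt h1.2
      linarith [hj1.1]
  by_contra hne
  obtain ⟨m, hm⟩ := Option.ne_none_iff_exists'.1 hne
  have hav := havail j m hm u (by rw [Call.ends_route, hj2]; exact hu)
  rcases hinit_j with hinit_j | hD
  swap
  · simp [hD] at hav
  rw [link_loadBefore hinit_j, Call.via_route, hj2] at hav
  refine absurd hav (not_lt.2 ?_)
  set w : c.cands := ⟨c.cand m, Call.mem_cands.2 ⟨m, rfl⟩⟩ with hw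
  by_cases hall : ∀ l, ∃ m', choice (b (some (w, l))) ω = some m' ∧
      (S.call (b (some (w, l))) ω).cand m' = w
  · calc D = (Finset.univ.image fun l : Fin D => b (some (w, l))).card := by
          rw [Finset.card_image_of_injective _ fun l l' h => by simpa using b.injective h,
            Finset.card_univ, Fintype.card_fin]
      _ ≤ _ := by
          refine Finset.card_le_card fun i hi => ?_
          obtain ⟨l, _, rfl⟩ := Finset.mem_image.1 hi
          obtain ⟨m', h1, h2⟩ := hall l
          refine mem_linkCalls.2 ⟨hlt _, hη _, m', h1, ?_, h2⟩
          rw [(hsat' _).1.1]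
          exact Sym2.mem_mk_left _ _
  push Not at hall
  obtain ⟨l, hl⟩ := hall
  set i := b (some (w, l)) with hi
  obtain ⟨⟨hends, hcand⟩, harr, hdur⟩ := hsat' (w, l)
  rw [← hi] at hends hcand harr hdur
  have hnot : ¬ (S.loadBefore choice i ω).Available D ((S.call i ω).route ⟨0, hd⟩) := by
    cases hc : choice i ω with
    | none => exact hlost i hc _
    | some m' =>
      refine hfirst i m' hc _ (Fin.lt_def.2 (Nat.pos_of_ne_zero fun h0 => ?_))
      obtain rfl : m' = ⟨0, hd⟩ := Fin.ext h0
      exact hl _ hc hcand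
  simp only [LoadVector.Available, not_forall, not_lt, Call.ends_route, Call.via_route, hends,
    hcand] at hnot
  obtain ⟨v, hv, hfull⟩ := hnot
  rw [link_loadBefore (not_initAlive_of_le hinit (by linarith [harr.1, hj1.1]))] at hfull
  rcases Sym2.mem_iff.1 hv with rfl | rfl
  · -- The link `uw` is full when the call `i` arrives, and its calls outlast the call `j`.
    refine hfull.trans (Finset.card_le_card fun i' hi' => ?_)
    obtain ⟨h1, h2, m', h3, h4, h5⟩ := mem_linkCalls.1 hi'
    refine mem_linkCalls.2 ⟨h1.trans (hlt _), ?_, m', h3, h4, h5⟩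
    by_contra h6
    rw [not_le] at h6
    by_cases h7 : i' ∈ Set.range b
    · obtain ⟨_ | a, rfl⟩ := h7
      · exact absurd (h1.trans (hlt _)) (lt_irrefl _)
      · exact absurd (hη a) (not_le.2 h6)
    · exact hE' i' h7 h4 ⟨w, w.2, Call.mem_cands.2 ⟨m', h5⟩⟩ ⟨harr.1.trans h2, h6.le⟩
  · -- Only calls outside the pattern can occupy the other link.
    refine absurd ?_ (not_le.2 (hF (w, l)))
    refine le_trans ?_ (Set.encard_le_encard
      (s := (S.linkCalls choice i ω (y (w, l)) w : Set ℕ)) ?_)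
    · rw [Set.encard_coe_eq_coe_finsetCard]
      exact_mod_cast hfull
    · intro i' hi'
      obtain ⟨h1, h2, m', h3, h4, h5⟩ := mem_linkCalls.1 (Finset.mem_coe.1 hi')
      refine ⟨?_, ⟨h4, Call.mem_cands.2 ⟨m', h5⟩⟩, ?_, ?_⟩
      · rintro ⟨_ | a, rfl⟩
        · exact absurd (h1.trans (hlt _)) (lt_irrefl _)
        · rw [(hsat' a).1.1, Sym2.mem_iff] at h4
          rcases h4 with h4 | h4
          · exact hyu _ h4
          · rw [hy h4] at hi
            exact absurd (hi ▸ h1) (lt_irrefl _)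
      · exact (arrival_mono hgap h1.le).trans harr.2.le
      · exact harr.1.trans h2

/-- A clean saturation pattern contains all calls that can take part in a saturation pattern for the
same call. -/
lemma exists_eq_permEmbedding {S : Input μ lam n d} {ω : Ω} {D : ℕ} {hd : 0 < d} {η : ℝ}
    {A : Set (MarkedCall n d)} {u : Fin n} {W : Finset (Fin n)} {y y' : W × Fin D → Fin n}
    {b b' : Option (W × Fin D) ↪ ℕ} (hb : b ∈ S.cleanSaturations hd η A u W D y ω)
    (hb' : b' ∈ S.saturations hd η A u W D y' ω) (hj : b' none = b none) :
    ∃ σ, b' = permEmbedding b σ := by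
  have h1 : ∀ w l, ∃ l', b (some (w, l')) = b' (some (w, l)) := by
    intro w l
    have h2 := hb'.2 (w, l)
    rw [hj] at h2
    obtain ⟨⟨hends, hcand⟩, harr, hdur⟩ := h2
    have h3 : b' (some (w, l)) ∈ Set.range b := by
      by_contra h
      refine Set.notMem_empty (b' (some (w, l))) (hb.2.1 ▸
        ⟨h, ⟨?_, w, w.2, Call.mem_cands.2 ⟨_, hcand⟩⟩, Or.inl ⟨harr.1, harr.2.le⟩⟩)
      rw [hends]
      exact Sym2.mem_mk_left _ _
    obtain ⟨_ | ⟨w', l'⟩, h4⟩ := h3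
    · rw [← hj] at h4
      exact absurd (b'.injective h4) (by simp)
    · have h5 := (hb.1.2 (w', l')).1.2
      rw [h4] at h5
      obtain rfl : w' = w := Subtype.ext (h5.symm.trans hcand)
      exact ⟨l', h4⟩
  choose τ hτ using h1
  have hinj : ∀ w, Function.Injective (τ w) := fun w l l' h => by
    have := (hτ w l).symm.trans ((congrArg (fun x => b (some (w, x))) h).trans (hτ w l'))
    simpa using b'.injective this
  refine ⟨fun w => Equiv.ofBijective (τ w) (Finite.injective_iff_bijective.1 (hinj w)),
    DFunLike.ext _ _ ?_⟩
  rintro (_ | ⟨w, l⟩)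
  · exact hj
  · exact (hτ w l).symm

/-- The lost calls of type `c` that arrive in the time interval `[s, t]`. -/
def lostCalls (S : Input μ lam n d) (choice : ℕ → Ω → Option (Fin d)) (s t : ℝ) (c : Call n d)
    (ω : Ω) : Set ℕ :=
  {j | S.arrival j ω ∈ Set.Icc s t ∧ choice j ω = none ∧ S.call j ω = c}

/-- Each lost call is the distinguished call of at most `(D!) ^ k` clean saturation patterns. -/
lemma sum_encard_cleanSaturations_le {S : Input μ lam n d}
    {choice : ℕ → Ω → Option (Fin d)} {ω : Ω} {D : ℕ} {hd : 0 < d} {η t₁ t₂ : ℝ} {c : Call n d}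
    {u : Fin n} (hu : u ∈ c.ends) {Y : Finset (c.cands × Fin D → Fin n)}
    (hY : ∀ y ∈ Y, Function.Injective y ∧ ∀ a, y a ≠ u)
    (hgap : ∀ i, 0 ≤ S.gap i ω) (hinit : ¬ S.InitAlive (t₁ - η) ω)
    (havail : ∀ j m, choice j ω = some m →
      (S.loadBefore choice j ω).Available D ((S.call j ω).route m))
    (hlost : ∀ j, choice j ω = none →
      ∀ m, ¬ (S.loadBefore choice j ω).Available D ((S.call j ω).route m))
    (hfirst : ∀ j m, choice j ω = some m →
      ∀ m' < m, ¬ (S.loadBefore choice j ω).Available D ((S.call j ω).route m')) :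
    ∑ y ∈ Y, (S.cleanSaturations hd η (arrivalSet t₁ t₂ c) u c.cands D y ω).encard ≤
      (S.lostCalls choice t₁ t₂ c ω).encard * (D.factorial ^ c.cands.card : ℕ) := by
  set U : (c.cands × Fin D → Fin n) → Set (Option (c.cands × Fin D) ↪ ℕ) := fun y =>
    S.cleanSaturations hd η (arrivalSet t₁ t₂ c) u c.cands D y ω with hU
  have hdisj : ∀ y ∈ Y, ∀ y' ∈ Y, y ≠ y' → Disjoint (U y) (U y') := by
    intro y _ y' _ hne
    rw [Set.disjoint_left]
    intro b hb hb'
    refine hne (funext fun a => ?_)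
    have h := (hb.1.2 a).1.1.symm.trans (hb'.1.2 a).1.1
    exact Sym2.congr_right.1 h
  have hsum : ∀ Z ⊆ Y, ∑ y ∈ Z, (U y).encard = (⋃ y ∈ Z, U y).encard := by
    classical
    intro Z
    induction Z using Finset.induction_on with
    | empty => simp
    | insert y Z hy ih =>
      intro hZ
      rw [Finset.sum_insert hy, ih ((Finset.subset_insert _ _).trans hZ),
        Finset.set_biUnion_insert, Set.encard_union_eq]
      rw [Set.disjoint_iUnion₂_right]
      intro y' hy'
      exact hdisj y (hZ (Finset.mem_insert_self _ _)) y' (hZ (Finset.mem_insert_of_mem hy'))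
        fun h => hy (h ▸ hy')
  change ∑ y ∈ Y, (U y).encard ≤ _
  rw [hsum Y subset_rfl, ← Fintype.card_coe c.cands]
  refine encard_le_mul_factorial ?_ ?_
  · intro b hb
    obtain ⟨y, hy, hb⟩ := Set.mem_iUnion₂.1 hb
    exact ⟨hb.1.1.1, choice_eq_none_of_mem_cleanSaturations hu (hY y hy).1 (hY y hy).2 hgap hinit
      havail hlost hfirst hb, hb.1.1.2⟩
  · intro b hb b' hb' h
    obtain ⟨y, hy, hb⟩ := Set.mem_iUnion₂.1 hb
    obtain ⟨y', hy', hb'⟩ := Set.mem_iUnion₂.1 hb'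
    exact exists_eq_permEmbedding hb hb'.1 h

/-- All saturation patterns are clean, except for those that extend by one disturbing call or by two
calls on the same link. -/
lemma encard_saturations_le (S : Input μ lam n d) {ω : Ω} {D : ℕ} (hD : 2 ≤ D) {hd : 0 < d} {η : ℝ}
    {A : Set (MarkedCall n d)} {u : Fin n} {W : Finset (Fin n)} {y : W × Fin D → Fin n} :
    (((S.saturations hd η A u W D y ω).encard : ℕ∞) : ℝ≥0∞) ≤
      (((S.cleanSaturations hd η A u W D y ω).encard : ℕ∞) : ℝ≥0∞) +
      ((((S.patternSet A (Sum.elim (fun a => saturatingSet hd η u (y a) a.1)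
        fun _ : Fin 1 => disturbingSet η u W) ω).encard : ℕ∞) : ℝ≥0∞) +
      ∑ a, (((S.patternSet A (Sum.elim (fun a => saturatingSet hd η u (y a) a.1)
        fun _ : Fin 2 => occupyingSet η (y a) a.1) ω).encard : ℕ∞) : ℝ≥0∞) /
          (D.descFactorial 2 : ℝ≥0∞)) := by
  have h1 : ∀ b, b ∈ S.saturations hd η A u W D y ω →
      b ∈ S.cleanSaturations hd η A u W D y ω ∨
      b ∈ {b ∈ S.saturations hd η A u W D y ω |
        1 ≤ (S.extras (disturbingSet η u W) ω b).encard} ∨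
      ∃ a, b ∈ {b ∈ S.saturations hd η A u W D y ω |
        (D : ℕ∞) ≤ (S.extras (occupyingSet η (y a) a.1) ω b).encard} := by
    intro b hb
    by_cases h : b ∈ S.cleanSaturations hd η A u W D y ω
    · exact Or.inl h
    · right
      by_contra! h'
      refine h ⟨hb, ?_, fun a => not_le.1 fun h2 => h'.2 a ⟨hb, h2⟩⟩
      exact Set.not_nonempty_iff_eq_empty.1 fun h2 =>
        h'.1 ⟨hb, Set.one_le_encard_iff_nonempty.2 h2⟩
  have h2 : ∀ {D' r : ℕ} (H : Set (MarkedCall n d × MarkedCall n d)), D'.descFactorial r ≠ 0 →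
      ∑' b, {b ∈ S.saturations hd η A u W D y ω |
        (D' : ℕ∞) ≤ (S.extras H ω b).encard}.indicator (1 : (Option (W × Fin D) ↪ ℕ) → ℝ≥0∞) b ≤
      (((S.patternSet A (Sum.elim (fun a => saturatingSet hd η u (y a) a.1)
        fun _ : Fin r => H) ω).encard : ℕ∞) : ℝ≥0∞) / (D'.descFactorial r : ℝ≥0∞) := by
    intro D' r H h0
    rw [tsum_indicator_eq_encard, ENNReal.le_div_iff_mul_le (Or.inl (by exact_mod_cast h0))
      (Or.inl (ENNReal.natCast_ne_top _))]
    exact_mod_cast ENat.toENNReal_mono (S.encard_crowded_mul_le A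
      (fun a => saturatingSet hd η u (y a) a.1) H D' r ω)
  have h3 := h2 (D' := 1) (r := 1) (disturbingSet η u W) (by simp)
  simp only [Nat.descFactorial_one, Nat.cast_one, div_one] at h3
  have h4 : D.descFactorial 2 ≠ 0 := fun h =>
    absurd (Nat.descFactorial_eq_zero_iff_lt.1 h) (by omega)
  refine le_trans ?_ (add_le_add le_rfl (add_le_add h3 (Finset.sum_le_sum fun a _ =>
    h2 (D' := D) (r := 2) (occupyingSet η (y a) a.1) h4)))
  rw [← tsum_indicator_eq_encard, ← tsum_indicator_eq_encard,
    ← Summable.tsum_finsetSum fun _ _ => ENNReal.summable, ← ENNReal.tsum_add, ← ENNReal.tsum_add]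
  refine ENNReal.tsum_le_tsum fun b => Set.indicator_apply_le' (fun hb => ?_) fun _ => bot_le
  rw [Pi.one_apply]
  rcases h1 b hb with h | h | ⟨a, h⟩
  · rw [Set.indicator_of_mem h]
    exact le_add_right le_rfl
  · rw [Set.indicator_of_mem h]
    exact le_add_left (le_add_right le_rfl)
  · refine le_add_left (le_add_left (le_trans ?_ (Finset.single_le_sum (fun _ _ => bot_le)
      (Finset.mem_univ a))))
    rw [Set.indicator_of_mem h]
    exact le_rfl

end Input

/-! ### The lower bound for the mean number of lost calls -/

section Intensities

variable {n d : ℕ} {lam : ℝ}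

lemma measurableSet_call_mem (C : Set (Call n d)) :
    MeasurableSet {p : MarkedCall n d × MarkedCall n d | p.2.2.1 ∈ C} :=
  (show MeasurableSet C from trivial).preimage
    (f := fun p : MarkedCall n d × MarkedCall n d => p.2.2.1) (by fun_prop)

lemma measurableSet_saturatingSet (hd : 0 < d) (η : ℝ) (u y w : Fin n) :
    MeasurableSet (saturatingSet hd η u y w) := by
  have h1 := measurableSet_call_mem {c : Call n d | c.ends = s(u, y) ∧ c.cand ⟨0, hd⟩ = w}
  have h2 : MeasurableSet {p : MarkedCall n d × MarkedCall n d | p.1.1 - η ≤ p.2.1} :=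
    measurableSet_le (by fun_prop) (by fun_prop)
  have h3 : MeasurableSet {p : MarkedCall n d × MarkedCall n d | p.2.1 < p.1.1} :=
    measurableSet_lt (by fun_prop) (by fun_prop)
  have h4 : MeasurableSet {p : MarkedCall n d × MarkedCall n d | η ≤ p.2.2.2} :=
    measurableSet_le (by fun_prop) (by fun_prop)
  exact h1.inter ((h2.inter h3).inter h4)

lemma measurableSet_disturbingSet (η : ℝ) (u : Fin n) (W : Finset (Fin n)) :
    MeasurableSet (disturbingSet (d := d) η u W) := by
  have h1 := measurableSet_call_mem {c : Call n d | u ∈ c.ends ∧ ∃ w ∈ W, w ∈ c.cands}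
  have h2 : MeasurableSet {p : MarkedCall n d × MarkedCall n d | p.1.1 - η ≤ p.2.1} :=
    measurableSet_le (by fun_prop) (by fun_prop)
  have h3 : MeasurableSet {p : MarkedCall n d × MarkedCall n d | p.2.1 ≤ p.1.1} :=
    measurableSet_le (by fun_prop) (by fun_prop)
  have h4 : MeasurableSet {p : MarkedCall n d × MarkedCall n d | p.1.1 - η ≤ p.2.1 + p.2.2.2} :=
    measurableSet_le (by fun_prop) (by fun_prop)
  have h5 : MeasurableSet {p : MarkedCall n d × MarkedCall n d | p.2.1 + p.2.2.2 ≤ p.1.1} :=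
    measurableSet_le (by fun_prop) (by fun_prop)
  exact h1.inter ((h2.inter h3).union (h4.inter h5))

lemma measurableSet_occupyingSet (η : ℝ) (y w : Fin n) :
    MeasurableSet (occupyingSet (d := d) η y w) := by
  have h1 := measurableSet_call_mem {c : Call n d | y ∈ c.ends ∧ w ∈ c.cands}
  have h3 : MeasurableSet {p : MarkedCall n d × MarkedCall n d | p.2.1 ≤ p.1.1} :=
    measurableSet_le (by fun_prop) (by fun_prop)
  have h4 : MeasurableSet {p : MarkedCall n d × MarkedCall n d | p.1.1 - η ≤ p.2.1 + p.2.2.2} :=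
    measurableSet_le (by fun_prop) (by fun_prop)
  exact h1.inter (h3.inter h4)

variable [IsProbabilityMeasure (markLaw n d)]

lemma intensity_saturatingSet (hlam : 0 < lam) (hn : 3 ≤ n) (hd : 0 < d) {η : ℝ} (hη : 0 ≤ η)
    {u y w : Fin n} (huy : u ≠ y) (hwu : w ≠ u) (hwy : w ≠ y) {x : MarkedCall n d}
    (hx : η ≤ x.1) :
    intensity (rate lam n) (markLaw n d) (Prod.mk x ⁻¹' saturatingSet hd η u y w) =
      ENNReal.ofReal (lam / (n - 2 : ℕ) * (η * Real.exp (-η))) := by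
  have h := intensity_eq_mul (rate lam n) {c : Call n d | c.ends = s(u, y) ∧ c.cand ⟨0, hd⟩ = w}
    ((measurableSet_Ico (a := x.1 - η) (b := x.1)).prod (measurableSet_Ici (a := η)))
  rw [rate_mul_callProb_first hlam hn hd huy hwu hwy, prod_Ico_Ici (by linarith) hη,
    sub_sub_cancel, ← ENNReal.ofReal_mul hη, ← ENNReal.ofReal_mul (by positivity)] at h
  exact h

lemma intensity_disturbingSet_le (hlam : 0 < lam) (hn : 3 ≤ n) (hd : 0 < d) {η : ℝ} (u : Fin n)
    (W : Finset (Fin n)) (x : MarkedCall n d) :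
    intensity (rate lam n) (markLaw n d) (Prod.mk x ⁻¹' disturbingSet η u W) ≤
      ENNReal.ofReal (W.card * (2 * lam * d) * (2 * η)) := by
  have h := intensity_eq_mul (rate lam n) {c : Call n d | u ∈ c.ends ∧ ∃ w ∈ W, w ∈ c.cands}
    (measurableSet_arriveOrEnd (x.1 - η) x.1)
  have h1 : ENNReal.ofReal (rate lam n) *
      callProb {c : Call n d | u ∈ c.ends ∧ ∃ w ∈ W, w ∈ c.cands} ≤
        ENNReal.ofReal (W.card * (2 * lam * d)) := by
    have h2 : {c : Call n d | u ∈ c.ends ∧ ∃ w ∈ W, w ∈ c.cands} =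
        ⋃ w ∈ W, {c : Call n d | u ∈ c.ends ∧ w ∈ c.cands} := by
      ext c
      simp only [Set.mem_iUnion, Set.mem_ofPred_eq, exists_prop]
      tauto
    have h3 : callProb {c : Call n d | u ∈ c.ends ∧ ∃ w ∈ W, w ∈ c.cands} ≤
        ∑ w ∈ W, callProb {c : Call n d | u ∈ c.ends ∧ w ∈ c.cands} := by
      rw [h2]
      simp only [callProb]
      rw [← Finset.mul_sum]
      exact mul_le_mul' le_rfl (measure_biUnion_finset_le _ _)
    calc _ ≤ ∑ w ∈ W, ENNReal.ofReal (2 * lam * d) := by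
          refine (mul_le_mul' le_rfl h3).trans ?_
          rw [Finset.mul_sum]
          exact Finset.sum_le_sum fun w _ => rate_mul_callProb_incident_le hlam hn hd u w
      _ = _ := by
          rw [Finset.sum_const, nsmul_eq_mul, ENNReal.ofReal_mul (Nat.cast_nonneg _),
            ENNReal.ofReal_natCast]
  refine (le_of_eq h).trans ((mul_le_mul' h1 prod_arriveOrEnd_le).trans (le_of_eq ?_))
  rw [sub_sub_cancel, ENNReal.ofReal_mul (p := W.card * (2 * lam * d)) (by positivity),
    ENNReal.ofReal_mul (p := 2) (by norm_num), ENNReal.ofReal_ofNat, mul_comm (2 : ℝ≥0∞)]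

lemma intensity_occupyingSet_le (hlam : 0 < lam) (hn : 3 ≤ n) (hd : 0 < d) {η : ℝ} (hη : 0 ≤ η)
    (y w : Fin n) (x : MarkedCall n d) :
    intensity (rate lam n) (markLaw n d) (Prod.mk x ⁻¹' occupyingSet η y w) ≤
      ENNReal.ofReal (2 * lam * d * (1 + η)) := by
  have h := intensity_eq_mul (rate lam n) {c : Call n d | y ∈ c.ends ∧ w ∈ c.cands}
    (measurableSet_inProgress (x.1 - η) x.1)
  refine (le_of_eq h).trans ?_
  refine (mul_le_mul' (rate_mul_callProb_incident_le hlam hn hd y w)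
    (prod_inProgress_le (by linarith))).trans (le_of_eq ?_)
  rw [sub_sub_cancel, ENNReal.ofReal_mul (p := 2 * lam * d) (by positivity)]

end Intensities

namespace Input

variable {Ω : Type*} [MeasurableSpace Ω] {μ : Measure Ω} {lam : ℝ} {n d : ℕ}

/-- The initial calls are independent of all patterns of calls. -/
lemma setLIntegral_encard_patternSet [IsProbabilityMeasure μ] {ι : Type*} [Fintype ι]
    (S : Input μ lam n d)
    {A : Set (MarkedCall n d)} (hA : MeasurableSet A)
    {B : ι → Set (MarkedCall n d × MarkedCall n d)} (hB : ∀ a, MeasurableSet (B a)) (t : ℝ) :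
    ∫⁻ ω in {ω | S.InitAlive t ω}ᶜ, (((S.patternSet A B ω).encard : ℕ∞) : ℝ≥0∞) ∂μ =
      μ {ω | S.InitAlive t ω}ᶜ * ∫⁻ ω, (((S.patternSet A B ω).encard : ℕ∞) : ℝ≥0∞) ∂μ := by
  obtain ⟨f, hf, h⟩ := S.exists_measurable_encard_patternSet hA hB
  simp_rw [h]
  let C : Set (LoadVector n × (Route n × ℕ → ℝ)) := {q | ∃ r k, k < q.1 r ∧ t ≤ q.2 (r, k)}ᶜ
  have hC : MeasurableSet C := by
    have : C = (⋃ r, ⋃ k, {q | k < q.1 r} ∩ {q | t ≤ q.2 (r, k)})ᶜ := by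
      ext q; simp [C]
    rw [this]
    refine (MeasurableSet.iUnion fun r => MeasurableSet.iUnion fun k => ?_).compl
    exact (measurableSet_lt (by fun_prop) (by fun_prop)).inter
      (measurableSet_le (by fun_prop) (by fun_prop))
  have e := lintegral_mul_eq_lintegral_mul_lintegral_of_indepFun
    (f := fun ω => C.indicator 1 (S.init ω, fun p => S.residual p ω)) (g := fun ω => f (S.gaps ω))
    (μ := μ)
    ((measurable_one.indicator hC).comp
      (S.measurable_init.prodMk (measurable_pi_iff.2 S.measurable_residual)))
    (hf.comp S.measurable_gaps)
    (S.indep_initial_gaps.comp (measurable_one.indicator hC) hf)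
  have hms := (S.measurableSet_initAlive t).compl
  have e1 : ∀ ω, C.indicator (1 : LoadVector n × (Route n × ℕ → ℝ) → ℝ≥0∞)
      (S.init ω, fun p => S.residual p ω) =
      ({ω | S.InitAlive t ω}ᶜ).indicator 1 ω := fun ω => rfl
  rw [← lintegral_indicator hms]
  simp only [Pi.mul_apply, e1] at e
  rw [lintegral_indicator_one hms] at e
  rw [← e]
  refine lintegral_congr fun ω => ?_
  by_cases hω : ω ∈ {ω | S.InitAlive t ω}ᶜ
  · rw [Set.indicator_of_mem hω, Set.indicator_of_mem hω, Pi.one_apply, one_mul]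
  · rw [Set.indicator_of_notMem hω, Set.indicator_of_notMem hω, zero_mul]

lemma measurable_arrival (S : Input μ lam n d) (j : ℕ) : Measurable (S.arrival j) :=
  Finset.measurable_fun_sum _ fun i _ => S.measurable_gap i

lemma measurable_encard_lostCalls {S : Input μ lam n d} {choice : ℕ → Ω → Option (Fin d)} {D : ℕ}
    (hS : S.IsGDAR D choice) (s t : ℝ) (c : Call n d) :
    Measurable fun ω => (((S.lostCalls choice s t c ω).encard : ℕ∞) : ℝ≥0∞) := by
  simp_rw [← tsum_indicator_eq_encard]
  refine Measurable.tsum fun j => ?_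
  have h1 : MeasurableSet {ω | S.arrival j ω ∈ Set.Icc s t} :=
    measurableSet_Icc.preimage (S.measurable_arrival j)
  have h2 : MeasurableSet {ω | S.call j ω = c} :=
    (show MeasurableSet ({c} : Set (Call n d)) from trivial).preimage (S.measurable_call j)
  have h3 : MeasurableSet {ω | j ∈ S.lostCalls choice s t c ω} :=
    h1.inter ((hS.measurable_choice j none).inter h2)
  exact measurable_one.indicator h3

/-- The mean number of lost calls of a given type is at least a quarter of the mean number of
saturation patterns, if disturbances are rare. -/
lemma card_mul_le_lintegral_lostCalls [IsProbabilityMeasure μ] (S : Input μ lam n d)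
    (hlam : 0 < lam) (hn : 3 ≤ n) (hd : 0 < d) {D : ℕ} (hD : 2 ≤ D)
    {choice : ℕ → Ω → Option (Fin d)} (hS : S.IsFDAR D choice) {η t₁ t₂ : ℝ} (hη : 0 ≤ η)
    (hηt : η ≤ t₁) (hinit : μ {ω | S.InitAlive (t₁ - η) ω} ≤ 1 / 2) (c : Call n d) {u : Fin n}
    (hu : u ∈ c.ends) {Y : Finset (c.cands × Fin D → Fin n)}
    (hY : ∀ y ∈ Y, Function.Injective y ∧ ∀ a, y a ≠ u ∧ y a ∉ c.cands)
    (hsmall : c.cands.card * (2 * lam * d) * (2 * η) +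
      c.cands.card * D * ((2 * lam * d * (1 + η)) ^ 2 / (D.descFactorial 2 : ℝ)) ≤ 1 / 4) :
    (Y.card : ℝ≥0∞) * (ENNReal.ofReal (rate lam n) * (Fintype.card (Call n d) : ℝ≥0∞)⁻¹ *
      ENNReal.ofReal (t₂ - t₁) *
        ENNReal.ofReal (lam / (n - 2 : ℕ) * (η * Real.exp (-η))) ^ (c.cands.card * D)) / 4 ≤
      (D.factorial : ℝ≥0∞) ^ c.cands.card *
        ∫⁻ ω, (((S.lostCalls choice t₁ t₂ c ω).encard : ℕ∞) : ℝ≥0∞) ∂μ := by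
  have := S.isProbabilityMeasure_markLaw
  have : Fact (0 < rate lam n) :=
    ⟨mul_pos hlam (by exact_mod_cast Nat.choose_pos (by omega : 2 ≤ n))⟩
  set A : Set (MarkedCall n d) := arrivalSet t₁ t₂ c with hAdef
  have hA : MeasurableSet A := measurableSet_arrivalSet _ _ _
  set s : ℝ≥0∞ := ENNReal.ofReal (lam / (n - 2 : ℕ) * (η * Real.exp (-η)))
  -- `M` is the mean number of saturation patterns for each choice of `y`.
  set M := ENNReal.ofReal (rate lam n) * (Fintype.card (Call n d) : ℝ≥0∞)⁻¹ *
      ENNReal.ofReal (t₂ - t₁) * s ^ (c.cands.card * D)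
  have hAM : intensity (rate lam n) (markLaw n d) A * s ^ (c.cands.card * D) = M := by
    rw [intensity_arrivalSet _ (hη.trans hηt)]
  have hcu : ∀ w ∈ c.cands, w ≠ u := by
    rintro w hw rfl
    obtain ⟨m, rfl⟩ := Call.mem_cands.1 hw
    exact c.cand_notMem m hu
  have hsat : ∀ y ∈ Y, ∀ x ∈ A, ∀ a : c.cands × Fin D,
      intensity (rate lam n) (markLaw n d)
        (Prod.mk x ⁻¹' saturatingSet hd η u (y a) a.1) = s := by
    intro y hy x hx a
    exact intensity_saturatingSet hlam hn hd hη ((hY y hy).2 a).1.symm (hcu _ a.1.2)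
      (fun h => ((hY y hy).2 a).2 (h ▸ a.1.2)) (hηt.trans hx.1.1)
  have hBm : ∀ (y : c.cands × Fin D → Fin n) (a : c.cands × Fin D),
      MeasurableSet (saturatingSet hd η u (y a) (a.1 : Fin n)) :=
    fun y a => measurableSet_saturatingSet _ _ _ _ _
  have hmain : ∀ y ∈ Y, ∫⁻ ω, (((S.saturations hd η A u c.cands D y ω).encard : ℕ∞) : ℝ≥0∞) ∂μ =
      M := by
    intro y hy
    rw [S.lintegral_encard_patternSet_eq hA (hBm y) (hsat y hy), ← hAM]
    simp
  have hext : ∀ (r : ℕ) (H : Set (MarkedCall n d × MarkedCall n d)) (h : ℝ≥0∞),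
      (∀ x, intensity (rate lam n) (markLaw n d) (Prod.mk x ⁻¹' H) ≤ h) → MeasurableSet H →
      ∀ y ∈ Y, ∫⁻ ω, (((S.patternSet A (Sum.elim (fun a : c.cands × Fin D =>
        saturatingSet hd η u (y a) a.1) fun _ : Fin r => H) ω).encard : ℕ∞) : ℝ≥0∞) ∂μ ≤
          M * h ^ r := by
    intro r H h hH hHm y hy
    refine (S.lintegral_encard_patternSet_le hA (B := Sum.elim (fun a : c.cands × Fin D =>
        saturatingSet hd η u (y a) a.1) fun _ : Fin r => H) (h := Sum.elim (fun _ => s) fun _ => h)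
        ?_ ?_).trans (le_of_eq ?_)
    · rintro (a | x)
      · exact hBm y a
      · exact hHm
    · rintro x hx (a | _)
      · exact (hsat y hy x hx a).le
      · exact hH x
    · rw [Fintype.prod_sum_type, ← mul_assoc, ← hAM]
      simp
  have hDis := fun y : c.cands × Fin D → Fin n => S.measurable_encard_patternSet hA (B := Sum.elim
    (fun a : c.cands × Fin D => saturatingSet hd η u (y a) a.1)
      fun _ : Fin 1 => disturbingSet η u c.cands) (by
        rintro (a | x)
        · exact hBm y a
        · exact measurableSet_disturbingSet _ _ _)
  have hOcc := fun (y : c.cands × Fin D → Fin n) (a' : c.cands × Fin D) =>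
    S.measurable_encard_patternSet hA (B := Sum.elim
    (fun a : c.cands × Fin D => saturatingSet hd η u (y a) a.1)
      fun _ : Fin 2 => occupyingSet η (y a') a'.1) (by
        rintro (a | x)
        · exact hBm y a
        · exact measurableSet_occupyingSet _ _ _)
  -- `R y` bounds the number of saturation patterns that are not clean.
  let R : (c.cands × Fin D → Fin n) → Ω → ℝ≥0∞ := fun y ω =>
    (((S.patternSet A (Sum.elim (fun a : c.cands × Fin D => saturatingSet hd η u (y a) a.1)
      fun _ : Fin 1 => disturbingSet η u c.cands) ω).encard : ℕ∞) : ℝ≥0∞) +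
    ∑ a : c.cands × Fin D, (((S.patternSet A (Sum.elim (fun a : c.cands × Fin D =>
      saturatingSet hd η u (y a) a.1) fun _ : Fin 2 => occupyingSet η (y a) a.1) ω).encard : ℕ∞) :
        ℝ≥0∞) / (D.descFactorial 2 : ℝ≥0∞)
  have hF : (0 : ℝ) < D.descFactorial 2 := by
    exact_mod_cast Nat.pos_of_ne_zero fun h =>
      absurd (Nat.descFactorial_eq_zero_iff_lt.1 h) (by omega)
  have hRm : ∀ y, Measurable (R y) := fun y =>
    (hDis y).add (Finset.measurable_fun_sum _ fun a _ => (hOcc y a).div_const _)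
  have hR : ∀ y ∈ Y, ∫⁻ ω, R y ω ∂μ ≤ M / 4 := by
    intro y hy
    have h4 : (ENNReal.ofReal (1 / 4)) = 4⁻¹ := by
      rw [one_div, ENNReal.ofReal_inv_of_pos (by norm_num), ENNReal.ofReal_ofNat]
    rw [lintegral_add_left (hDis y), lintegral_finsetSum _ fun a _ => (hOcc y a).div_const _,
      div_eq_mul_inv, ← h4]
    refine le_trans ?_ (mul_le_mul' le_rfl (ENNReal.ofReal_le_ofReal hsmall))
    rw [ENNReal.ofReal_add (by positivity) (by positivity), mul_add]
    refine add_le_add ?_ ?_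
    · refine (hext 1 _ _ (intensity_disturbingSet_le hlam hn hd u c.cands)
        (measurableSet_disturbingSet _ _ _) y hy).trans (le_of_eq ?_)
      rw [pow_one]
    · have h5 : ∀ a : c.cands × Fin D, ∫⁻ ω, (((S.patternSet A (Sum.elim
          (fun a : c.cands × Fin D => saturatingSet hd η u (y a) a.1)
            fun _ : Fin 2 => occupyingSet η (y a) a.1) ω).encard : ℕ∞) : ℝ≥0∞) /
              (D.descFactorial 2 : ℝ≥0∞) ∂μ ≤
          M * ENNReal.ofReal ((2 * lam * d * (1 + η)) ^ 2 / (D.descFactorial 2 : ℝ)) := by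
        intro a
        simp_rw [div_eq_mul_inv _ (D.descFactorial 2 : ℝ≥0∞)]
        rw [lintegral_mul_const _ (hOcc y a)]
        refine (mul_le_mul' (hext 2 _ _ (intensity_occupyingSet_le hlam hn hd hη (y a) a.1)
          (measurableSet_occupyingSet _ _ _) y hy) le_rfl).trans (le_of_eq ?_)
        rw [ENNReal.ofReal_div_of_pos hF, ENNReal.ofReal_natCast,
          ENNReal.ofReal_pow (by positivity), div_eq_mul_inv, mul_assoc]
      refine (Finset.sum_le_sum fun a _ => h5 a).trans (le_of_eq ?_)
      rw [Finset.sum_const, Finset.card_univ, nsmul_eq_mul, Fintype.card_prod, Fintype.card_coe,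
        Fintype.card_fin, ENNReal.ofReal_mul (p := c.cands.card * D) (by positivity),
        ENNReal.ofReal_mul (Nat.cast_nonneg _), ENNReal.ofReal_natCast, ENNReal.ofReal_natCast]
      push_cast
      ring
  have hpt : ∀ᵐ ω ∂μ, ω ∈ {ω | S.InitAlive (t₁ - η) ω}ᶜ →
      ∑ y ∈ Y, (((S.saturations hd η A u c.cands D y ω).encard : ℕ∞) : ℝ≥0∞) ≤
        (D.factorial : ℝ≥0∞) ^ c.cands.card *
          (((S.lostCalls choice t₁ t₂ c ω).encard : ℕ∞) : ℝ≥0∞) + ∑ y ∈ Y, R y ω := by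
    filter_upwards [S.ae_gap_nonneg, hS.available, hS.lost, hS.first]
      with ω hgap havail hlost hfirst hω
    have h1 := sum_encard_cleanSaturations_le (t₂ := t₂) hu (fun y hy =>
      ⟨(hY y hy).1, fun a => ((hY y hy).2 a).1⟩) hgap hω havail hlost hfirst (hd := hd)
    have h2 := ENat.toENNReal_mono h1
    have h3 : ∀ f : (c.cands × Fin D → Fin n) → ℕ∞,
        ((∑ y ∈ Y, f y : ℕ∞) : ℝ≥0∞) = ∑ y ∈ Y, (f y : ℝ≥0∞) := fun f =>
      map_sum ENat.toENNRealRingHom f Y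
    rw [h3, ENat.toENNReal_mul] at h2
    refine (Finset.sum_le_sum fun y _ => S.encard_saturations_le hD).trans ?_
    rw [Finset.sum_add_distrib]
    refine add_le_add (h2.trans (le_of_eq ?_)) le_rfl
    rw [mul_comm]
    push_cast
    rfl
  have hhalf : 1 / 2 ≤ μ {ω | S.InitAlive (t₁ - η) ω}ᶜ := by
    rw [prob_compl_eq_one_sub (S.measurableSet_initAlive _)]
    refine le_trans (le_of_eq ?_) (tsub_le_tsub_left hinit 1)
    rw [one_div, ENNReal.one_sub_inv_two]
  have hkey : (Y.card : ℝ≥0∞) * M / 2 ≤ (D.factorial : ℝ≥0∞) ^ c.cands.card *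
      ∫⁻ ω, (((S.lostCalls choice t₁ t₂ c ω).encard : ℕ∞) : ℝ≥0∞) ∂μ + Y.card * M / 4 := by
    calc (Y.card : ℝ≥0∞) * M / 2 = ∑ y ∈ Y, 1 / 2 * M := by
          rw [Finset.sum_const, nsmul_eq_mul, div_eq_mul_inv, one_div, mul_assoc, mul_comm M]
      _ ≤ ∑ y ∈ Y, ∫⁻ ω in {ω | S.InitAlive (t₁ - η) ω}ᶜ,
            (((S.saturations hd η A u c.cands D y ω).encard : ℕ∞) : ℝ≥0∞) ∂μ := by
          refine Finset.sum_le_sum fun y hy => ?_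
          rw [S.setLIntegral_encard_patternSet hA (hBm y), hmain y hy]
          exact mul_le_mul' hhalf le_rfl
      _ = ∫⁻ ω in {ω | S.InitAlive (t₁ - η) ω}ᶜ,
            ∑ y ∈ Y, (((S.saturations hd η A u c.cands D y ω).encard : ℕ∞) : ℝ≥0∞) ∂μ :=
          (lintegral_finsetSum _ fun y _ => S.measurable_encard_patternSet hA (hBm y)).symm
      _ ≤ ∫⁻ ω in {ω | S.InitAlive (t₁ - η) ω}ᶜ, ((D.factorial : ℝ≥0∞) ^ c.cands.card *
            (((S.lostCalls choice t₁ t₂ c ω).encard : ℕ∞) : ℝ≥0∞) + ∑ y ∈ Y, R y ω) ∂μ :=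
          lintegral_mono_ae
            ((ae_restrict_iff' (S.measurableSet_initAlive _).compl).2 hpt)
      _ ≤ ∫⁻ ω, ((D.factorial : ℝ≥0∞) ^ c.cands.card *
            (((S.lostCalls choice t₁ t₂ c ω).encard : ℕ∞) : ℝ≥0∞) + ∑ y ∈ Y, R y ω) ∂μ :=
          setLIntegral_le_lintegral _ _
      _ = (D.factorial : ℝ≥0∞) ^ c.cands.card *
            ∫⁻ ω, (((S.lostCalls choice t₁ t₂ c ω).encard : ℕ∞) : ℝ≥0∞) ∂μ +
              ∑ y ∈ Y, ∫⁻ ω, R y ω ∂μ := by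
          have hm := measurable_encard_lostCalls hS.toIsGDAR t₁ t₂ c
          rw [lintegral_add_left (hm.const_mul _), lintegral_const_mul _ hm,
            lintegral_finsetSum _ fun y _ => hRm y]
      _ ≤ _ := by
          refine add_le_add le_rfl ((Finset.sum_le_sum hR).trans (le_of_eq ?_))
          rw [Finset.sum_const, nsmul_eq_mul]
          simp only [div_eq_mul_inv, mul_assoc]
  have hfin : (Y.card : ℝ≥0∞) * M / 4 ≠ ∞ := by
    have hM : M ≠ ∞ := by
      refine ENNReal.mul_ne_top (ENNReal.mul_ne_top (ENNReal.mul_ne_top ENNReal.ofReal_ne_top ?_)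
        ENNReal.ofReal_ne_top) (ENNReal.pow_ne_top ENNReal.ofReal_ne_top)
      rw [ENNReal.inv_ne_top, Nat.cast_ne_zero]
      exact (Fintype.card_pos_iff.2 ⟨c⟩).ne'
    exact ENNReal.div_ne_top (ENNReal.mul_ne_top (ENNReal.natCast_ne_top _) hM) (by norm_num)
  refine ENNReal.le_of_add_le_add_right hfin (le_trans (le_of_eq ?_) hkey)
  have h24 : (4 : ℝ≥0∞)⁻¹ + 4⁻¹ = 2⁻¹ := by
    rw [show (4 : ℝ≥0∞) = 2 * 2 by norm_num, ENNReal.mul_inv (Or.inl (by norm_num))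
      (Or.inl (by norm_num)), ← mul_add, ENNReal.inv_two_add_inv_two, mul_one]
  rw [div_eq_mul_inv, div_eq_mul_inv, ← mul_add, h24]

end Input

lemma Call.card_cands_le {n d : ℕ} (c : Call n d) : c.cands.card ≤ d := by
  refine Finset.card_image_le.trans (le_of_eq ?_)
  rw [Finset.card_univ, Fintype.card_fin]

/-- There are about `n ^ (k D)` ways to choose distinct other ends for `k D` saturating calls. -/
lemma exists_finset_injective {n d : ℕ} (D : ℕ) (c : Call n d) {u : Fin n} (hu : u ∈ c.ends)
    (hn : 2 * (d + d * D) ≤ n) :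
    ∃ Y : Finset (c.cands × Fin D → Fin n),
      (∀ y ∈ Y, Function.Injective y ∧ ∀ a, y a ≠ u ∧ y a ∉ c.cands) ∧
        ((n : ℝ) / 2) ^ (c.cands.card * D) ≤ Y.card := by
  classical
  have hcu : u ∉ c.cands := fun h => by
    obtain ⟨m, rfl⟩ := Call.mem_cands.1 h
    exact c.cand_notMem m hu
  have hk := c.card_cands_le
  have hc : Fintype.card {v : Fin n // v ∉ insert u c.cands} = n - (c.cands.card + 1) := by
    rw [Fintype.card_subtype_compl, Fintype.card_fin, Fintype.card_coe,
      Finset.card_insert_of_notMem hcu]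
  refine ⟨Finset.univ.image fun f : c.cands × Fin D ↪ {v : Fin n // v ∉ insert u c.cands} =>
    fun a => (f a).1, ?_, ?_⟩
  · intro y hy
    obtain ⟨f, _, rfl⟩ := Finset.mem_image.1 hy
    refine ⟨Subtype.val_injective.comp f.injective, fun a => ?_⟩
    simpa using (f a).2
  · rw [Finset.card_image_of_injective, Finset.card_univ, Fintype.card_embedding_eq, hc,
      Fintype.card_prod, Fintype.card_coe, Fintype.card_fin]
    · have h1 := Nat.pow_sub_le_descFactorial (n - (c.cands.card + 1)) (c.cands.card * D)
      have h2 : n ≤ 2 * (n - (c.cands.card + 1) + 1 - c.cands.card * D) := by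
        have : c.cands.card * D ≤ d * D := Nat.mul_le_mul_right _ hk
        have h0 : 0 < c.cands.card ∨ c.cands.card = 0 := by omega
        have : 0 < n := Fin.pos u
        rcases h0 with h0 | h0
        · omega
        · rw [h0] at *
          omega
      have h3 : (n : ℝ) / 2 ≤ (n - (c.cands.card + 1) + 1 - c.cands.card * D : ℕ) := by
        rw [div_le_iff₀ two_pos, mul_comm]
        exact_mod_cast h2
      calc _ ≤ ((n - (c.cands.card + 1) + 1 - c.cands.card * D : ℕ) : ℝ) ^ (c.cands.card * D) := by
            gcongr
        _ ≤ _ := by exact_mod_cast h1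
    · intro f g h
      ext a
      exact congrArg Fin.val (congrFun h a)

namespace Input

variable {Ω : Type*} [MeasurableSpace Ω] {μ : Measure Ω} {lam : ℝ} {n d : ℕ}

/-- The number of saturation patterns summed over the choices of `y`, in terms of a Poisson
probability at the capacity. -/
lemma le_lintegral_lostCalls [IsProbabilityMeasure μ] (S : Input μ lam n d)
    (hlam : 0 < lam) (hn : 3 ≤ n) (hd : 0 < d) {D : ℕ} (hD : 2 ≤ D) (hnD : 2 * (d + d * D) ≤ n)
    {choice : ℕ → Ω → Option (Fin d)} (hS : S.IsFDAR D choice) {η t₁ t₂ : ℝ} (hη : 0 ≤ η)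
    (hηt : η ≤ t₁) (ht : t₁ ≤ t₂) (hinit : μ {ω | S.InitAlive (t₁ - η) ω} ≤ 1 / 2)
    (hsmall : d * (2 * lam * d) * (2 * η) +
      d * D * ((2 * lam * d * (1 + η)) ^ 2 / (D.descFactorial 2 : ℝ)) ≤ 1 / 4) (c : Call n d) :
    ENNReal.ofReal (rate lam n * (t₂ - t₁) / (4 * Fintype.card (Call n d)) *
      ((lam * (η * Real.exp (-η)) / 2) ^ D / (D.factorial : ℝ)) ^ c.cands.card) ≤
        ∫⁻ ω, (((S.lostCalls choice t₁ t₂ c ω).encard : ℕ∞) : ℝ≥0∞) ∂μ := by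
  have hk := c.card_cands_le
  have hr : 0 < rate lam n :=
    mul_pos hlam (by exact_mod_cast Nat.choose_pos (by omega : 2 ≤ n))
  have hN : (0 : ℝ) < Fintype.card (Call n d) := by
    exact_mod_cast Fintype.card_pos_iff.2 ⟨c⟩
  have ht' := sub_nonneg.2 ht
  have hη' : 0 ≤ lam * (η * Real.exp (-η)) := by positivity
  obtain ⟨u, hu⟩ : ∃ u, u ∈ c.ends := by
    induction c.ends with | _ u v
    exact ⟨u, Sym2.mem_mk_left u v⟩
  obtain ⟨Y, hY, hYc⟩ := exists_finset_injective D c hu hnD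
  have hk' : (c.cands.card : ℝ) ≤ d := by exact_mod_cast hk
  have h := S.card_mul_le_lintegral_lostCalls hlam hn hd hD hS (t₂ := t₂) hη hηt hinit c hu hY (by
    refine le_trans ?_ hsmall
    gcongr)
  have hDf : (D.factorial : ℝ≥0∞) ^ c.cands.card ≠ 0 :=
    pow_ne_zero _ (by exact_mod_cast D.factorial_ne_zero)
  have hDf' : (D.factorial : ℝ≥0∞) ^ c.cands.card ≠ ∞ :=
    ENNReal.pow_ne_top (ENNReal.natCast_ne_top _)
  rw [← ENNReal.mul_le_mul_iff_right hDf hDf']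
  refine le_trans ?_ h
  have hn2 : (0 : ℝ) < (n - 2 : ℕ) := by
    have : 0 < n - 2 := by omega
    exact_mod_cast this
  have hn3 : ((n - 2 : ℕ) : ℝ) ≤ n := by exact_mod_cast Nat.sub_le n 2
  rw [← ENNReal.ofReal_natCast, ← ENNReal.ofReal_natCast, ← ENNReal.ofReal_natCast,
    ← ENNReal.ofReal_inv_of_pos hN, ← ENNReal.ofReal_pow (by positivity),
    ← ENNReal.ofReal_pow (by positivity), ← ENNReal.ofReal_mul hr.le,
    ← ENNReal.ofReal_mul (by positivity), ← ENNReal.ofReal_mul (by positivity),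
    ← ENNReal.ofReal_mul (by positivity), ← ENNReal.ofReal_mul (by positivity),
    show (4 : ℝ≥0∞) = ENNReal.ofReal 4 by simp, ← ENNReal.ofReal_div_of_pos (by norm_num)]
  refine ENNReal.ofReal_le_ofReal ?_
  have h1 : (lam * (η * Real.exp (-η)) / 2) ^ (c.cands.card * D) ≤
      (Y.card : ℝ) * (lam / (n - 2 : ℕ) * (η * Real.exp (-η))) ^ (c.cands.card * D) := by
    refine le_trans ?_ (mul_le_mul_of_nonneg_right hYc (by positivity))
    rw [← mul_pow]
    gcongr
    calc lam * (η * Real.exp (-η)) / 2 =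
          lam * (η * Real.exp (-η)) / 2 * ((n - 2 : ℕ) / (n - 2 : ℕ)) := by field_simp
      _ ≤ lam * (η * Real.exp (-η)) / 2 * (n / (n - 2 : ℕ)) := by gcongr
      _ = _ := by ring
  calc _ = rate lam n * (t₂ - t₁) / (4 * Fintype.card (Call n d)) *
        (lam * (η * Real.exp (-η)) / 2) ^ (c.cands.card * D) := by
        rw [div_pow, ← pow_mul, mul_comm D]
        field_simp
    _ ≤ rate lam n * (t₂ - t₁) / (4 * Fintype.card (Call n d)) * ((Y.card : ℝ) *
        (lam / (n - 2 : ℕ) * (η * Real.exp (-η))) ^ (c.cands.card * D)) := by gcongr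
    _ = _ := by
        field_simp

lemma sum_encard_lostCalls_le (S : Input μ lam n d) (choice : ℕ → Ω → Option (Fin d)) (s t : ℝ)
    (C : Finset (Call n d)) (ω : Ω) :
    ∑ c ∈ C, (((S.lostCalls choice s t c ω).encard : ℕ∞) : ℝ≥0∞) ≤
      (({j : ℕ | S.arrival j ω ∈ Set.Icc s t ∧ choice j ω = none}.encard : ℕ∞) : ℝ≥0∞) := by
  classical
  simp_rw [← tsum_indicator_eq_encard]
  rw [← Summable.tsum_finsetSum fun _ _ => ENNReal.summable]
  refine ENNReal.tsum_le_tsum fun j => ?_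
  have h1 : ∀ c, c ≠ S.call j ω →
      (S.lostCalls choice s t c ω).indicator (1 : ℕ → ℝ≥0∞) j = 0 := fun c hc =>
    Set.indicator_of_notMem (fun h => hc h.2.2.symm) _
  refine (Finset.sum_le_sum_of_subset (Finset.subset_univ C)).trans ?_
  rw [Finset.sum_eq_single (S.call j ω) (fun c _ => h1 c) (by simp)]
  refine Set.indicator_le_indicator_of_subset (fun j h => ?_) (fun _ => bot_le) j
  exact ⟨h.1, h.2.1⟩

/-- The lower bound from the calls with exactly `k` distinct candidates. -/
theorem le_meanLost [IsProbabilityMeasure μ] (S : Input μ lam n d)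
    (hlam : 0 < lam) (hn : 3 ≤ n) (hd : 0 < d) {D : ℕ} (hD : 2 ≤ D) (hnD : 2 * (d + d * D) ≤ n)
    {choice : ℕ → Ω → Option (Fin d)} (hS : S.IsFDAR D choice) {η t₁ t₂ : ℝ} (hη : 0 ≤ η)
    (hηt : η ≤ t₁) (ht : t₁ ≤ t₂) (hinit : μ {ω | S.InitAlive (t₁ - η) ω} ≤ 1 / 2)
    (hsmall : d * (2 * lam * d) * (2 * η) +
      d * D * ((2 * lam * d * (1 + η)) ^ 2 / (D.descFactorial 2 : ℝ)) ≤ 1 / 4) (k : ℕ) :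
    ENNReal.ofReal (((Finset.univ.filter fun c : Call n d => c.cands.card = k).card : ℝ) /
      Fintype.card (Call n d) * (rate lam n * (t₂ - t₁) / 4 *
        ((lam * (η * Real.exp (-η)) / 2) ^ D / (D.factorial : ℝ)) ^ k)) ≤
      S.meanLost choice t₁ t₂ := by
  set C := Finset.univ.filter fun c : Call n d => c.cands.card = k
  refine le_trans ?_ (lintegral_mono fun ω => S.sum_encard_lostCalls_le choice t₁ t₂ C ω)
  rw [lintegral_finsetSum _ fun c _ => measurable_encard_lostCalls hS.toIsGDAR t₁ t₂ c]
  refine le_trans (le_of_eq ?_) (Finset.sum_le_sum fun c _ =>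
    S.le_lintegral_lostCalls hlam hn hd hD hnD hS hη hηt ht hinit hsmall c)
  rw [Finset.sum_congr rfl fun c hc => by rw [(Finset.mem_filter.1 hc).2], Finset.sum_const,
    nsmul_eq_mul, ← ENNReal.ofReal_natCast, ← ENNReal.ofReal_mul (Nat.cast_nonneg _)]
  congr 1
  rw [div_mul_eq_mul_div, mul_div_assoc]
  congr 1
  ring

end Input

/-! ### Asymptotics of the lower bound -/

section LowerAsymptotics

open Topology

variable {α : ℝ} {D : ℕ → ℕ}

lemma eventually_mul_capacity_le (hα : 0 < α) (hD : (fun n : ℕ => (D n : ℝ)) ~[atTop]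
    (fun n : ℕ => α * (Real.log n / Real.log (Real.log n)))) (d : ℕ) :
    ∀ᶠ n : ℕ in atTop, 2 * (d + d * D n) ≤ n := by
  have h1 : Tendsto (fun n : ℕ => Real.log n / n) atTop (𝓝 0) :=
    (show Tendsto (fun x : ℝ => Real.log x / x) atTop (𝓝 0) from
      Real.isLittleO_log_id_atTop.tendsto_div_nhds_zero).comp tendsto_natCast_atTop_atTop
  have h2 : Tendsto (fun n : ℕ => 2 * (d : ℝ) / n) atTop (𝓝 0) :=
    tendsto_const_nhds.div_atTop tendsto_natCast_atTop_atTop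
  have h3 := h2.add (((tendsto_capacity_div hα hD).mul h1).const_mul (2 * (d : ℝ)))
  rw [mul_zero, mul_zero, add_zero] at h3
  filter_upwards [h3.eventually_lt_const one_pos, eventually_gt_atTop 0,
    tendsto_log_natCast.eventually_gt_atTop 0] with n h hn hl
  have hn' : (0 : ℝ) < n := by exact_mod_cast hn
  have h4 : (2 * (d : ℝ) + 2 * d * D n) / n < 1 := by
    refine lt_of_eq_of_lt ?_ h
    field_simp
  rw [div_lt_one hn'] at h4
  have : ((2 * (d + d * D n) : ℕ) : ℝ) < n := by
    push_cast
    linarith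
  exact_mod_cast this.le

/-- Disturbances of saturation patterns of a suitable fixed length `η` are rare for large
capacities. -/
lemma exists_eventually_disturbance_le {lam : ℝ} (hlam : 0 < lam) {d : ℕ} (hd : 0 < d)
    (hD : Tendsto D atTop atTop) :
    ∃ η : ℝ, 0 < η ∧ η ≤ 1 ∧ ∀ᶠ n : ℕ in atTop, d * (2 * lam * d) * (2 * η) +
      d * D n * ((2 * lam * d * (1 + η)) ^ 2 / ((D n).descFactorial 2 : ℝ)) ≤ 1 / 4 := by
  have hd' : (0 : ℝ) < d := by exact_mod_cast hd
  -- This makes the first term at most `1 / 8`; the second one tends to `0`.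
  refine ⟨min 1 (1 / (32 * lam * d ^ 2)), by positivity, min_le_left _ _, ?_⟩
  set η := min 1 (1 / (32 * lam * (d : ℝ) ^ 2)) with hη
  have hη0 : 0 < η := by positivity
  have hη1 : η ≤ 1 := min_le_left _ _
  have h1 : d * (2 * lam * d) * (2 * η) ≤ 1 / 8 := by
    calc d * (2 * lam * d) * (2 * η) ≤
          d * (2 * lam * d) * (2 * (1 / (32 * lam * (d : ℝ) ^ 2))) := by
          gcongr
          exact min_le_right _ _
      _ = 1 / 8 := by
          field_simp
          norm_num
  have hlim : Tendsto (fun n : ℕ => d * (2 * lam * d * 2) ^ 2 / ((D n : ℝ) - 1)) atTop (𝓝 0) := by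
    refine tendsto_const_nhds.div_atTop ?_
    exact tendsto_atTop_add_const_right _ (-1) (tendsto_natCast_atTop_atTop.comp hD)
  filter_upwards [hlim.eventually_lt_const (show (0 : ℝ) < 1 / 8 by norm_num),
    hD.eventually_ge_atTop 2] with n h2 hn
  have hD2 : (2 : ℝ) ≤ D n := by exact_mod_cast hn
  have h3 : ((D n).descFactorial 2 : ℝ) = D n * ((D n : ℝ) - 1) := by
    rw [Nat.descFactorial_succ, Nat.descFactorial_one, Nat.cast_mul, Nat.cast_sub (by omega)]
    push_cast
    ring
  have h4 : d * D n * ((2 * lam * d * (1 + η)) ^ 2 / ((D n).descFactorial 2 : ℝ)) ≤ 1 / 8 := by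
    refine le_trans ?_ h2.le
    rw [h3]
    have h5 : (0 : ℝ) < D n - 1 := by linarith
    have h6 : d * D n * ((2 * lam * d * (1 + η)) ^ 2 / (D n * ((D n : ℝ) - 1))) =
        d * (2 * lam * d * (1 + η)) ^ 2 / ((D n : ℝ) - 1) := by
      field_simp
    rw [h6]
    gcongr
    linarith
  linarith

/-- If a call has exactly `k` distinct candidates with probability at least `c₀ n ^ (-p)`, then the
mean number of lost calls in an interval of length `n ^ K` is at least of order
`n ^ (K + 2 - p - k α - o(1))`. -/
theorem eventually_le_meanLost {lam : ℝ} (hlam : 0 < lam) {d : ℕ} (hd : 0 < d) {K : ℝ}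
    (hα : 0 < α) (hD : (fun n : ℕ => (D n : ℝ)) ~[atTop]
      (fun n : ℕ => α * (Real.log n / Real.log (Real.log n))))
    {k : ℕ} {p c₀ α' ε : ℝ} (hc₀ : 0 < c₀) (hα' : α < α') (hε : ε ≤ K + 2 - p - k * α')
    (hk : ∀ᶠ n : ℕ in atTop, c₀ * (n : ℝ) ^ (-p) ≤
      ((Finset.univ.filter fun c : Call n d => c.cands.card = k).card : ℝ) /
        Fintype.card (Call n d)) :
    ∃ c : ℝ, 0 < c ∧ ∀ᶠ n : ℕ in atTop,
      ∀ (Ω : Type*) [MeasurableSpace Ω] (μ : Measure Ω) [IsProbabilityMeasure μ]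
        (S : Input μ lam n d) (choice : ℕ → Ω → Option (Fin d)), S.IsFDAR (D n) choice →
          Integrable (fun ω => ((S.init ω).total : ℝ)) μ →
            ∀ t₁ : ℝ, t₁ ≥ Real.log (S.meanInit + 1) + 3 * Real.log n →
              ENNReal.ofReal (c * (n : ℝ) ^ ε) ≤ S.meanLost choice t₁ (t₁ + (n : ℝ) ^ K) := by
  obtain ⟨η, hη0, hη1, hη⟩ := exists_eventually_disturbance_le hlam hd (tendsto_capacity hα hD)
  refine ⟨c₀ * (lam / 16), by positivity, ?_⟩
  filter_upwards [hη, hk, eventually_mul_capacity_le hα hD d, eventually_ge_atTop 3,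
    (tendsto_capacity hα hD).eventually_ge_atTop 2,
    eventually_rpow_le_pow_div_factorial hα hD hα' (β := lam * (η * Real.exp (-η)) / 2)
      (by positivity)]
    with n hsmall hk hnD hn hDn hq Ω _ μ _ S choice hS hint t₁ ht
  have hn0 : 0 < n := by omega
  have hn' : (0 : ℝ) < n := by exact_mod_cast hn0
  have hn3 : (3 : ℝ) ≤ n := by exact_mod_cast hn
  have hηt : η ≤ t₁ := by
    refine hη1.trans (le_trans ?_ (nonneg_of_ge_log_add S.meanInit_nonneg hn0 ht).1)
    rw [Real.le_log_iff_exp_le hn']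
    linarith [Real.exp_one_lt_three]
  have hinit : μ {ω | S.InitAlive (t₁ - η) ω} ≤ 1 / 2 := by
    refine (S.measure_initAlive_le hint (sub_nonneg.2 hηt)).trans ?_
    have h1 : S.meanInit * Real.exp (-(t₁ - η)) ≤ 1 / 2 := by
      calc S.meanInit * Real.exp (-(t₁ - η)) = S.meanInit * Real.exp (-t₁) * Real.exp η := by
            rw [mul_assoc, ← Real.exp_add]
            congr 2
            ring
        _ ≤ 1 / (n : ℝ) ^ 3 * Real.exp 1 := by
            have := (initial_bound_le hlam S.meanInit_nonneg hn0 ht).1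
            gcongr
        _ ≤ 1 / (3 : ℝ) ^ 3 * 3 := by
            gcongr
            exact Real.exp_one_lt_three.le
        _ ≤ 1 / 2 := by norm_num
    refine (ENNReal.ofReal_le_ofReal h1).trans (le_of_eq ?_)
    rw [one_div, one_div, ENNReal.ofReal_inv_of_pos two_pos, ENNReal.ofReal_ofNat]
  have hK : (0 : ℝ) ≤ (n : ℝ) ^ K := by positivity
  refine le_trans ?_ (S.le_meanLost hlam hn hd hDn hnD hS hη0.le hηt (by linarith) hinit hsmall k)
  refine ENNReal.ofReal_le_ofReal ?_
  rw [add_sub_cancel_left]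
  have hr : lam * (n : ℝ) ^ (2 : ℝ) / 4 ≤ rate lam n := by
    rw [rate, Nat.cast_choose_two]
    have h : (n : ℝ) ^ (2 : ℝ) = (n : ℝ) ^ 2 := by exact_mod_cast Real.rpow_natCast (n : ℝ) 2
    rw [h, mul_div_assoc]
    refine mul_le_mul_of_nonneg_left ?_ hlam.le
    nlinarith
  calc c₀ * (lam / 16) * (n : ℝ) ^ ε ≤ c₀ * (lam / 16) * (n : ℝ) ^ (K + 2 - p - k * α') := by
        gcongr
        linarith
    _ = c₀ * (n : ℝ) ^ (-p) * (lam * (n : ℝ) ^ (2 : ℝ) / 4 * (n : ℝ) ^ K / 4 *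
          ((n : ℝ) ^ (-α')) ^ k) := by
        have e : (n : ℝ) ^ (K + 2 - p - k * α') = (n : ℝ) ^ (-p) * (n : ℝ) ^ (2 : ℝ) * (n : ℝ) ^ K *
            ((n : ℝ) ^ (-α')) ^ k := by
          rw [← Real.rpow_natCast ((n : ℝ) ^ (-α')), ← Real.rpow_mul hn'.le, ← Real.rpow_add hn',
            ← Real.rpow_add hn', ← Real.rpow_add hn']
          congr 1
          ring
        rw [e]
        ring
    _ ≤ _ := by
        have : 0 ≤ rate lam n := le_trans (by positivity) hr
        gcongr

lemma eventually_le_card_cands_eq_one {d : ℕ} (hd : 0 < d) :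
    ∀ᶠ n : ℕ in atTop, 1 * (n : ℝ) ^ (-((d : ℝ) - 1)) ≤
      ((Finset.univ.filter fun c : Call n d => c.cands.card = 1).card : ℝ) /
        Fintype.card (Call n d) := by
  filter_upwards [eventually_ge_atTop 3] with n hn
  have hn' : (0 : ℝ) < n := by
    have : 0 < n := by omega
    exact_mod_cast this
  have hn2 : (0 : ℝ) < (n - 2 : ℕ) := by
    have : 0 < n - 2 := by omega
    exact_mod_cast this
  have hc : (0 : ℝ) < n.choose 2 := by exact_mod_cast Nat.choose_pos (by omega : 2 ≤ n)
  have h1 : ((n.choose 2 * (n - 2 : ℕ) : ℕ) : ℝ) ≤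
      (Finset.univ.filter fun c : Call n d => c.cands.card = 1).card := by
    exact_mod_cast card_call_cands_eq_one hd
  obtain ⟨d, rfl⟩ : ∃ d', d = d' + 1 := ⟨d - 1, by omega⟩
  have e : (n : ℝ) ^ (-(((d + 1 : ℕ) : ℝ) - 1)) = 1 / (n : ℝ) ^ d := by
    push_cast
    rw [add_sub_cancel_right, Real.rpow_neg hn'.le, Real.rpow_natCast, one_div]
  rw [one_mul, card_call, e]
  push_cast at h1 ⊢
  calc 1 / (n : ℝ) ^ d ≤ 1 / ((n - 2 : ℕ) : ℝ) ^ d := by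
        gcongr
        exact Nat.sub_le n 2
    _ = n.choose 2 * (n - 2 : ℕ) / (n.choose 2 * (n - 2 : ℕ) ^ (d + 1)) := by
        rw [pow_succ]
        field_simp
    _ ≤ _ := by gcongr

lemma eventually_le_card_cands_eq (d : ℕ) :
    ∀ᶠ n : ℕ in atTop, (1 / 2) ^ d * (n : ℝ) ^ (-(0 : ℝ)) ≤
      ((Finset.univ.filter fun c : Call n d => c.cands.card = d).card : ℝ) /
        Fintype.card (Call n d) := by
  filter_upwards [eventually_ge_atTop (2 * d + 3)] with n hn
  have hn2 : (0 : ℝ) < (n - 2 : ℕ) := by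
    have : 0 < n - 2 := by omega
    exact_mod_cast this
  have hc : (0 : ℝ) < n.choose 2 := by exact_mod_cast Nat.choose_pos (by omega : 2 ≤ n)
  have h1 : ((n.choose 2 * (n - 2).descFactorial d : ℕ) : ℝ) ≤
      (Finset.univ.filter fun c : Call n d => c.cands.card = d).card := by
    exact_mod_cast card_call_cands_eq
  have h2 : ((n - 2 + 1 - d : ℕ) : ℝ) ^ d ≤ ((n - 2).descFactorial d : ℝ) := by
    exact_mod_cast Nat.pow_sub_le_descFactorial (n - 2) d
  have h3 : 1 / 2 * ((n - 2 : ℕ) : ℝ) ≤ (n - 2 + 1 - d : ℕ) := by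
    have : n - 2 ≤ 2 * (n - 2 + 1 - d) := by omega
    have : ((n - 2 : ℕ) : ℝ) ≤ 2 * (n - 2 + 1 - d : ℕ) := by exact_mod_cast this
    linarith
  rw [neg_zero, Real.rpow_zero, mul_one, card_call]
  push_cast at h1 ⊢
  calc (1 / 2 : ℝ) ^ d = n.choose 2 * (1 / 2 * ((n - 2 : ℕ) : ℝ)) ^ d /
        (n.choose 2 * (n - 2 : ℕ) ^ d) := by
        rw [mul_pow]
        field_simp
    _ ≤ n.choose 2 * ((n - 2 + 1 - d : ℕ) : ℝ) ^ d / (n.choose 2 * (n - 2 : ℕ) ^ d) := by gcongr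
    _ ≤ n.choose 2 * ((n - 2).descFactorial d : ℝ) / (n.choose 2 * (n - 2 : ℕ) ^ d) := by gcongr
    _ ≤ _ := by gcongr

end LowerAsymptotics

end Routing

theorem theorem1 (lam : ℝ) (hlam : 0 < lam) (d : ℕ) (hd : 0 < d) :
    ∃ κ : ℝ, ∀ K α : ℝ, 0 < K → 0 < α → ∀ D : ℕ → ℕ,
      (fun n : ℕ => (D n : ℝ)) ~[atTop]
        (fun n : ℕ => α * (Real.log n / Real.log (Real.log n))) →
      -- (a)
      ((K < (d : ℝ) - 2 → α > (K + 2) / d) → (K ≥ (d : ℝ) - 2 → α > K + 3 - d) →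
        ∀ δ : ℝ, 0 < δ → ∀ᶠ n : ℕ in atTop,
          ∀ (Ω : Type*) [MeasurableSpace Ω] (μ : Measure Ω) [IsProbabilityMeasure μ]
            (S : Routing.Input μ lam n d) (choice : ℕ → Ω → Option (Fin d)),
            S.IsGDAR (D n) choice →
            Integrable (fun ω => ((S.init ω).total : ℝ)) μ →
            ∀ t₁ : ℝ, t₁ ≥ Real.log (S.meanInit + 1) + κ * Real.log n →
              S.meanLost choice t₁ (t₁ + (n : ℝ) ^ K) ≤ ENNReal.ofReal δ) ∧
      -- (b)
      (∀ ε : ℝ, 0 < ε →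
        (K < (d : ℝ) - 2 → α < (K + 2) / d ∧ ε < K + 2 - d * α) →
        (K ≥ (d : ℝ) - 2 → α < K + 3 - d ∧ ε < K + 3 - d - α) →
        ∃ c : ℝ, 0 < c ∧ ∀ᶠ n : ℕ in atTop,
          ∀ (Ω : Type*) [MeasurableSpace Ω] (μ : Measure Ω) [IsProbabilityMeasure μ]
            (S : Routing.Input μ lam n d) (choice : ℕ → Ω → Option (Fin d)),
            S.IsFDAR (D n) choice →
            Integrable (fun ω => ((S.init ω).total : ℝ)) μ →
            ∀ t₁ : ℝ, t₁ ≥ Real.log (S.meanInit + 1) + κ * Real.log n →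
              ENNReal.ofReal (c * (n : ℝ) ^ ε) ≤
                S.meanLost choice t₁ (t₁ + (n : ℝ) ^ K)) := by
  -- The factor `n ^ (-3)` for the remaining initial calls beats the arrival rate of order `n ^ 2`.
  refine ⟨3, fun K α _ hα D hD => ⟨fun h1 h2 δ hδ => ?_, fun ε hε h1 h2 => ?_⟩⟩
  · obtain ⟨h3, h4⟩ := Routing.capacity_conditions hd h1 h2
    exact Routing.eventually_meanLost_le hlam hd hα hD h3 h4 hδ
  · have hd' : (0 : ℝ) < d := by exact_mod_cast hd
    rcases lt_or_ge K ((d : ℝ) - 2) with h | h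
    · -- Calls with `d` distinct candidates give the right order of magnitude.
      have h3 : α < (K + 2 - ε) / d := by
        rw [lt_div_iff₀ hd']
        linarith [(h1 h).2]
      obtain ⟨α', h4, h5⟩ := exists_between h3
      rw [lt_div_iff₀ hd'] at h5
      exact Routing.eventually_le_meanLost hlam hd hα hD (k := d) (p := 0)
        (c₀ := (1 / 2) ^ d) (by positivity) h4 (by linarith) (Routing.eventually_le_card_cands_eq d)
    · -- Calls with equal candidates give the right order of magnitude.
      obtain ⟨α', h4, h5⟩ := exists_between (show α < K + 3 - d - ε by linarith [(h2 h).2])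
      exact Routing.eventually_le_meanLost hlam hd hα hD (k := 1) (p := (d : ℝ) - 1)
        one_pos h4 (by push_cast; linarith) (Routing.eventually_le_card_cands_eq_one hd)
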